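/- Let $\Omega\subset\mathbb R^3$ be a connected open set with Lipschitz boundary such that $\Omega\cap\{z>0\}=S\times(0,\infty)$, where $S\subset\mathbb R^2$ is a bounded domain with Lipschitz boundary, and such that $\Omega\cap\{z<0\}$ is bounded. Assume that $(x,y,z)\in\Omega$ implies $(-x,y,z)\in\Omega$, and set $\Omega_\pm=\{(x,y,z)\in\Omega:\pm x>0\}$ and $S_+=\{(x,y)\in S: x>0\}$. Assume that $S$ is not simply connected while $S_+$ is simply connected. For an open set $G\subset\mathbb R^3$ let $H(\mathrm{curl};G)=\{E\in L^2(G)^3:\mathrm{curl}\,E\in L^2(G)^3\}$ and $H(\mathrm{div};0)=\{E\in L^2(G)^3:\mathrm{div}\,E=0\}$ (complex-valued fields, derivatives in the sense of distributions), and let $H_N(\mathrm{curl})$ be the set of $E\in H(\mathrm{curl};G)$ with $E\times\nu=0$ on $\partial G$ in the weak sense, i.e. $\int_G E\cdot\mathrm{curl}\,\Phi=\int_G\mathrm{curl}\,E\cdot\Phi$ for all $\Phi\in H(\mathrm{curl};G)$. Let $A_G$ be the operator in the Hilbert space $H(\mathrm{div};0)$ with domain $\{E\in H_N(\mathrm{curl})\cap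 H(\mathrm{div};0):\mathrm{curl}\,\mathrm{curl}\,E\in L^2(G)^3\}$ and $A_GE=\mathrm{curl}\,\mathrm{curl}\,E$; write $A=A_\Omega$ and $A_+=A_{\Omega_+}$. For such an operator $T$ let $\sigma_{p}(T)$ be the set of its eigenvalues, $\sigma_{ess}(T)$ its essential spectrum, $\sigma_{emb}(T)=\sigma_p(T)\cap\sigma_{ess}(T)$ and $\sigma_d(T)=\sigma_p(T)\setminus\sigma_{emb}(T)$. Then $\sigma_{ess}(A)=[0,\infty)$, and every $\lambda\in\sigma_d(A_+)$ belongs to $\sigma_{emb}(A)$. More precisely, if $E^+=(E^+_x,E^+_y,E^+_z)$ is an eigenfunction of $A_+$ for $\lambda\in\sigma_d(A_+)$, then the field $E$ defined almost everywhere in $\Omega$ by $E=E^+$ in $\Omega_+$ and $$E(x,y,z)=\big(E^+_x(-x,y,z),\,-E^+_y(-x,y,z),\,-E^+_z(-x,y,z)\big)\quad\text{in }\Omega_-$$ is an eigenfunction of $A$ for the eigenvalue $\lambda$. -/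

import Mathlib

open MeasureTheory Filter Topology
open scoped ContDiff InnerProductSpace

noncomputable section

namespace Maxwell

/-- Physical space `ℝ³`; the coordinates `x, y, z` have the indices `0, 1, 2`. -/
abbrev Space : Type := EuclideanSpace ℝ (Fin 3)

/-- Values of complex vector fields. -/
abbrev CVec : Type := EuclideanSpace ℂ (Fin 3)

/-! ### Domains -/

/-- The open set `Ω ⊆ ℝ^d` has a Lipschitz continuous boundary: near each boundary point there are
a unit vector `e` and a Lipschitz function `γ` of the component orthogonal to `e` such that `Ω` is
locally the region strictly above the graph of `γ` in the direction `e`. -/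
def HasLipschitzBoundary {d : ℕ} (Ω : Set (EuclideanSpace ℝ (Fin d))) : Prop :=
  ∀ p ∈ frontier Ω, ∃ e : EuclideanSpace ℝ (Fin d), ‖e‖ = 1 ∧
    ∃ (K : NNReal) (γ : EuclideanSpace ℝ (Fin d) → ℝ), LipschitzWith K γ ∧
      ∃ U ∈ 𝓝 p, ∀ q ∈ U, q ∈ Ω ↔ γ (q - ⟪e, q⟫_ℝ • e) < ⟪e, q⟫_ℝ

/-- `Ω` is a Lipschitz domain of `ℝ³` which coincides with the half-cylinder `S × (0, ∞)` for
`z > 0`, where the section `S` is a bounded Lipschitz domain of the plane, and whose remaining part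
`{z < 0}`, the resonator, is bounded. -/
structure IsWaveguide (Ω : TopologicalSpace.Opens Space) (S : Set (EuclideanSpace ℝ (Fin 2))) :
    Prop where
  isConnected : IsConnected (Ω : Set Space)
  lipschitz : HasLipschitzBoundary (Ω : Set Space)
  section_isOpen : IsOpen S
  section_isConnected : IsConnected S
  section_isBounded : Bornology.IsBounded S
  section_lipschitz : HasLipschitzBoundary S
  cylinder : ∀ p : Space, 0 < p 2 → (p ∈ Ω ↔ !₂[p 0, p 1] ∈ S)
  resonator_isBounded : Bornology.IsBounded {p : Space | p ∈ Ω ∧ p 2 < 0}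

/-- The reflection `(x, y, z) ↦ (-x, y, z)`. -/
def reflectX (p : Space) : Space := !₂[-p 0, p 1, p 2]

/-- The half `Ω₊ = {(x, y, z) ∈ Ω | x > 0}`. -/
def halfGuide (Ω : TopologicalSpace.Opens Space) : TopologicalSpace.Opens Space where
  carrier := {p | p ∈ Ω ∧ 0 < p 0}
  is_open' := Ω.isOpen.inter
    (isOpen_lt continuous_const (show Continuous fun p : Space => p 0 by fun_prop))

/-- The half `S₊ = {(x, y) ∈ S | x > 0}`. -/
def halfSection (S : Set (EuclideanSpace ℝ (Fin 2))) : Set (EuclideanSpace ℝ (Fin 2)) :=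
  {s | s ∈ S ∧ 0 < s 0}

/-- The extension of a field given on `{x > 0}` to `{x < 0}` by reflection: the `x`-component is
extended evenly, the `y`- and `z`-components are extended oddly. (The value on the null set
`{x = 0}` is irrelevant.) -/
def reflectedExtension (F : Space → CVec) : Space → CVec := fun p =>
  if 0 < p 0 then F p
  else !₂[F (reflectX p) 0, -F (reflectX p) 1, -F (reflectX p) 2]

/-! ### Function spaces -/

/-- The space `L²(Ω)³` of complex vector fields. -/
abbrev L2Field (Ω : TopologicalSpace.Opens Space) : Type :=
  Lp CVec 2 (volume.restrict (Ω : Set Space))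

/-- Real-valued test functions: smooth with compact support contained in `Ω`. -/
def IsTestFunction (Ω : TopologicalSpace.Opens Space) (ψ : Space → ℝ) : Prop :=
  ContDiff ℝ ∞ ψ ∧ HasCompactSupport ψ ∧ tsupport ψ ⊆ (Ω : Set Space)

/-- The partial derivative `∂ψ/∂x_i`. -/
def pderiv (i : Fin 3) (ψ : Space → ℝ) (p : Space) : ℝ :=
  fderiv ℝ ψ p (EuclideanSpace.single i 1)

variable {Ω : TopologicalSpace.Opens Space}

lemma IsTestFunction.pderiv {ψ : Space → ℝ} (h : IsTestFunction Ω ψ) (i : Fin 3) :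
    IsTestFunction Ω (pderiv i ψ) := by
  obtain ⟨h1, h2, h3⟩ := h
  have hs : Function.support (Maxwell.pderiv i ψ) ⊆ tsupport ψ := by
    intro p hp
    by_contra hcon
    apply hp
    have : fderiv ℝ ψ p = 0 := by
      by_contra h0
      exact hcon (support_fderiv_subset ℝ h0)
    simp [Maxwell.pderiv, this]
  refine ⟨?_, ?_, ?_⟩
  · exact (h1.fderiv_right (m := ∞) (by simp)).clm_apply contDiff_const
  · exact h2.of_isClosed_subset (isClosed_tsupport _)
      (closure_minimal hs (isClosed_tsupport _))
  · exact (closure_minimal hs (isClosed_tsupport _)).trans h3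

lemma memLp_coord (E : L2Field Ω) (i : Fin 3) :
    MemLp (fun p => E p i) 2 (volume.restrict (Ω : Set Space)) := by
  exact (EuclideanSpace.proj i : CVec →L[ℂ] ℂ).comp_memLp' (Lp.memLp E)

lemma IsTestFunction.integrable {ψ : Space → ℝ} (h : IsTestFunction Ω ψ) (E : L2Field Ω)
    (i : Fin 3) : Integrable (fun p => ψ p • E p i) (volume.restrict (Ω : Set Space)) := by
  have h1 : MemLp ψ 2 (volume.restrict (Ω : Set Space)) :=
    (h.1.continuous.memLp_of_hasCompactSupport h.2.1)
  exact memLp_one_iff_integrable.1 ((memLp_coord E i).smul h1)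

/-- The integral of `ψ E_i` over `Ω`. -/
def testIntegral (ψ : Space → ℝ) (i : Fin 3) (E : L2Field Ω) : ℂ :=
  ∫ p in (Ω : Set Space), ψ p • E p i

lemma testIntegral_zero (ψ : Space → ℝ) (i : Fin 3) :
    testIntegral ψ i (0 : L2Field Ω) = 0 := by
  unfold testIntegral
  rw [← integral_zero Space ℂ]
  apply integral_congr_ae
  filter_upwards [Lp.coeFn_zero CVec 2 (volume.restrict (Ω : Set Space))] with p hp
  simp only [hp, Pi.zero_apply, PiLp.zero_apply, smul_zero]

lemma testIntegral_add {ψ : Space → ℝ} (h : IsTestFunction Ω ψ) (i : Fin 3) (E F : L2Field Ω) :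
    testIntegral ψ i (E + F) = testIntegral ψ i E + testIntegral ψ i F := by
  unfold testIntegral
  rw [← integral_add (h.integrable E i) (h.integrable F i)]
  apply integral_congr_ae
  filter_upwards [Lp.coeFn_add E F] with p hp
  simp only [hp, Pi.add_apply, PiLp.add_apply, smul_add]

lemma testIntegral_smul (ψ : Space → ℝ) (i : Fin 3) (c : ℂ) (E : L2Field Ω) :
    testIntegral ψ i (c • E) = c * testIntegral ψ i E := by
  unfold testIntegral
  rw [← integral_const_mul]
  apply integral_congr_ae
  filter_upwards [Lp.coeFn_smul c E] with p hp
  simp only [hp, Pi.smul_apply, PiLp.smul_apply, smul_eq_mul, Complex.real_smul]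
  ring

/-- The graph of the weak curl in `L²(Ω)³`: the pairs `(E, C)` with `C = curl E` in the sense of
distributions on `Ω`, that is `C_i = ∂_{i+1} E_{i+2} - ∂_{i+2} E_{i+1}` (indices modulo `3`). -/
def weakCurlGraph (Ω : TopologicalSpace.Opens Space) : Submodule ℂ (L2Field Ω × L2Field Ω) where
  carrier := {P | ∀ ψ : Space → ℝ, IsTestFunction Ω ψ → ∀ i : Fin 3,
    testIntegral ψ i P.2 =
      testIntegral (pderiv (i + 2) ψ) (i + 1) P.1 - testIntegral (pderiv (i + 1) ψ) (i + 2) P.1}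
  add_mem' := by
    intro P Q hP hQ ψ hψ i
    simp only [Prod.fst_add, Prod.snd_add]
    rw [testIntegral_add hψ, testIntegral_add (hψ.pderiv _), testIntegral_add (hψ.pderiv _),
      hP ψ hψ i, hQ ψ hψ i]
    ring
  zero_mem' := by
    intro ψ hψ i
    simp [testIntegral_zero]
  smul_mem' := by
    intro c P hP ψ hψ i
    simp only [Prod.smul_fst, Prod.smul_snd]
    rw [testIntegral_smul, testIntegral_smul, testIntegral_smul, hP ψ hψ i]
    ring

/-- The weak curl of a field is unique. -/
lemma weakCurlGraph_unique (P : L2Field Ω × L2Field Ω) (hP : P ∈ weakCurlGraph Ω)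
    (h0 : P.1 = 0) : P.2 = 0 := by
  have key : ∀ i : Fin 3, ∀ᵐ p ∂(volume : Measure Space), p ∈ (Ω : Set Space) → P.2 p i = 0 := by
    intro i
    apply Ω.isOpen.ae_eq_zero_of_integral_contDiff_smul_eq_zero
    · have hl := (memLp_coord P.2 i).locallyIntegrable (by norm_num)
      exact locallyIntegrableOn_of_locallyIntegrable_restrict hl
    · intro ψ h1 h2 h3
      have h := hP ψ ⟨h1, h2, h3⟩ i
      rw [h0, testIntegral_zero, testIntegral_zero, sub_zero] at h
      rw [← h]
      unfold testIntegral
      rw [setIntegral_eq_integral_of_forall_compl_eq_zero]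
      intro p hp
      rw [image_eq_zero_of_notMem_tsupport (fun hc => hp (h3 hc)), zero_smul]
  apply Lp.ext
  have hz : ∀ᵐ p ∂(volume.restrict (Ω : Set Space)), P.2 p = 0 := by
    rw [ae_restrict_iff' Ω.isOpen.measurableSet]
    filter_upwards [ae_all_iff.2 key] with p h hp
    ext i
    exact h i hp
  filter_upwards [hz, Lp.coeFn_zero CVec 2 (volume.restrict (Ω : Set Space))] with p h h'
  rw [h, h', Pi.zero_apply]

/-- The weak curl as an unbounded operator of `L²(Ω)³`, with domain
`H(curl; Ω) = {E ∈ L²(Ω)³ | curl E ∈ L²(Ω)³}`. -/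
def curl (Ω : TopologicalSpace.Opens Space) : L2Field Ω →ₗ.[ℂ] L2Field Ω :=
  (weakCurlGraph Ω).toLinearPMap

lemma graph_curl (Ω : TopologicalSpace.Opens Space) : (curl Ω).graph = weakCurlGraph Ω :=
  Submodule.toLinearPMap_graph_eq _ (fun P hP h0 => weakCurlGraph_unique P hP h0)

lemma curl_mem_graph (E : (curl Ω).domain) : ((E : L2Field Ω), curl Ω E) ∈ weakCurlGraph Ω := by
  rw [← graph_curl]
  exact (curl Ω).mem_graph E

/-- `H_N(curl)`: the fields `E ∈ H(curl; Ω)` with `E × ν = 0` on `∂Ω`, the vanishing of the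
tangential trace being understood in the usual weak sense given by Green's formula,
`∫_Ω E · curl Φ = ∫_Ω curl E · Φ` for all `Φ ∈ H(curl; Ω)`. -/
def HN (Ω : TopologicalSpace.Opens Space) : Submodule ℂ (L2Field Ω) where
  carrier := {E | ∃ hE : E ∈ (curl Ω).domain, ∀ Φ : (curl Ω).domain,
    ⟪curl Ω Φ, E⟫_ℂ = ⟪(Φ : L2Field Ω), curl Ω ⟨E, hE⟩⟫_ℂ}
  add_mem' := by
    rintro E F ⟨hE, hE'⟩ ⟨hF, hF'⟩
    refine ⟨add_mem hE hF, fun Φ => ?_⟩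
    have : curl Ω ⟨E + F, add_mem hE hF⟩ = curl Ω ⟨E, hE⟩ + curl Ω ⟨F, hF⟩ :=
      (curl Ω).map_add ⟨E, hE⟩ ⟨F, hF⟩
    rw [this, inner_add_right, inner_add_right, hE', hF']
  zero_mem' := by
    refine ⟨zero_mem _, fun Φ => ?_⟩
    have : curl Ω ⟨0, zero_mem _⟩ = 0 := (curl Ω).map_zero
    rw [this, inner_zero_right, inner_zero_right]
  smul_mem' := by
    rintro c E ⟨hE, hE'⟩
    refine ⟨Submodule.smul_mem _ c hE, fun Φ => ?_⟩
    have : curl Ω ⟨c • E, Submodule.smul_mem _ c hE⟩ = c • curl Ω ⟨E, hE⟩ :=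
      (curl Ω).map_smul c ⟨E, hE⟩
    rw [this, inner_smul_right, inner_smul_right, hE']

/-- The Hilbert space `H(div; 0)` of the fields `E ∈ L²(Ω)³` with `div E = 0` in the sense of
distributions on `Ω`. -/
def HDivZero (Ω : TopologicalSpace.Opens Space) : Submodule ℂ (L2Field Ω) where
  carrier := {E | ∀ ψ : Space → ℝ, IsTestFunction Ω ψ →
    ∑ i : Fin 3, testIntegral (pderiv i ψ) i E = 0}
  add_mem' := by
    intro E F hE hF ψ hψ
    have h1 := hE ψ hψ
    have h2 := hF ψ hψ
    simp only [fun i : Fin 3 => testIntegral_add (hψ.pderiv i) i E F]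
    rw [Finset.sum_add_distrib, h1, h2, add_zero]
  zero_mem' := by
    intro ψ hψ
    exact Finset.sum_eq_zero fun i _ => testIntegral_zero _ _
  smul_mem' := by
    intro c E hE ψ hψ
    have h := hE ψ hψ
    simp only [testIntegral_smul]
    rw [← Finset.mul_sum, h, mul_zero]

lemma pderiv_comm {ψ : Space → ℝ} (hψ : ContDiff ℝ ∞ ψ) (i j : Fin 3) :
    pderiv i (pderiv j ψ) = pderiv j (pderiv i ψ) := by
  have h2 : ContDiff ℝ 2 ψ := hψ.of_le (WithTop.coe_le_coe.2 le_top)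
  have hd : Differentiable ℝ (fderiv ℝ ψ) :=
    (h2.fderiv_right (m := 1) (by norm_num)).differentiable (by simp)
  funext p
  have key : ∀ k l : Fin 3, pderiv k (pderiv l ψ) p =
      fderiv ℝ (fderiv ℝ ψ) p (EuclideanSpace.single k 1) (EuclideanSpace.single l 1) := by
    intro k l
    have : pderiv l ψ = fun q => fderiv ℝ ψ q (EuclideanSpace.single l 1) := rfl
    rw [this]
    unfold pderiv
    rw [fderiv_clm_apply (hd p) (differentiableAt_const _)]
    simp
  rw [key, key]
  have hs : IsSymmSndFDerivAt ℝ ψ p := h2.contDiffAt.isSymmSndFDerivAt (by simp)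
  exact hs _ _

/-- A weak curl is divergence free. -/
lemma curl_mem_HDivZero (E : (curl Ω).domain) : curl Ω E ∈ HDivZero Ω := by
  intro ψ hψ
  have h := curl_mem_graph E
  have hi : ∀ i : Fin 3, testIntegral (pderiv i ψ) i (curl Ω E) =
      testIntegral (pderiv (i + 2) (pderiv i ψ)) (i + 1) (E : L2Field Ω) -
        testIntegral (pderiv (i + 1) (pderiv i ψ)) (i + 2) (E : L2Field Ω) :=
    fun i => h _ (hψ.pderiv i) i
  rw [Fin.sum_univ_three, hi, hi, hi]
  have e1 : (1 : Fin 3) + 2 = 0 := rfl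
  have e2 : (1 : Fin 3) + 1 = 2 := rfl
  have e3 : (2 : Fin 3) + 2 = 1 := rfl
  have e4 : (2 : Fin 3) + 1 = 0 := rfl
  simp only [zero_add, e1, e2, e3, e4]
  rw [pderiv_comm hψ.1 2 0, pderiv_comm hψ.1 2 1, pderiv_comm hψ.1 1 0]
  ring

/-- The operator `A` of the electric problem in `Ω`, an unbounded operator of the Hilbert space
`H(div; 0)`: its domain consists of the `E ∈ H_N(curl) ∩ H(div; 0)` with `curl curl E ∈ L²(Ω)³`,
and `A E = curl curl E`. -/
def electricOperator (Ω : TopologicalSpace.Opens Space) : HDivZero Ω →ₗ.[ℂ] HDivZero Ω where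
  domain :=
    { carrier := {E | (E : L2Field Ω) ∈ HN Ω ∧
        ∃ hE : (E : L2Field Ω) ∈ (curl Ω).domain, curl Ω ⟨E, hE⟩ ∈ (curl Ω).domain}
      add_mem' := by
        rintro E F ⟨hE, hE1, hE2⟩ ⟨hF, hF1, hF2⟩
        refine ⟨add_mem hE hF, add_mem hE1 hF1, ?_⟩
        have : curl Ω ⟨(E + F : HDivZero Ω), add_mem hE1 hF1⟩ =
            curl Ω ⟨E, hE1⟩ + curl Ω ⟨F, hF1⟩ := (curl Ω).map_add ⟨E, hE1⟩ ⟨F, hF1⟩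
        rw [this]
        exact add_mem hE2 hF2
      zero_mem' := by
        refine ⟨zero_mem _, zero_mem _, ?_⟩
        have : curl Ω ⟨(0 : HDivZero Ω), zero_mem _⟩ = 0 := (curl Ω).map_zero
        rw [this]
        exact zero_mem _
      smul_mem' := by
        rintro c E ⟨hE, hE1, hE2⟩
        refine ⟨Submodule.smul_mem _ c hE, Submodule.smul_mem _ c hE1, ?_⟩
        have : curl Ω ⟨(c • E : HDivZero Ω), Submodule.smul_mem _ c hE1⟩ =
            c • curl Ω ⟨E, hE1⟩ := (curl Ω).map_smul c ⟨E, hE1⟩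
        rw [this]
        exact Submodule.smul_mem _ c hE2 }
  toFun :=
    { toFun := fun E => ⟨curl Ω ⟨curl Ω ⟨E.1, E.2.2.1⟩, E.2.2.2⟩, curl_mem_HDivZero _⟩
      map_add' := by
        rintro ⟨E, hE, hE1, hE2⟩ ⟨F, hF, hF1, hF2⟩
        apply Subtype.ext
        refine Eq.trans ?_ ((curl Ω).map_add ⟨_, hE2⟩ ⟨_, hF2⟩)
        exact congrArg (curl Ω) (Subtype.ext ((curl Ω).map_add ⟨E, hE1⟩ ⟨F, hF1⟩))
      map_smul' := by
        rintro c ⟨E, hE, hE1, hE2⟩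
        apply Subtype.ext
        refine Eq.trans ?_ ((curl Ω).map_smul c ⟨_, hE2⟩)
        exact congrArg (curl Ω) (Subtype.ext ((curl Ω).map_smul c ⟨E, hE1⟩)) }

/-! ### Spectral notions for an unbounded operator of a Hilbert space -/

section Spectrum

variable {H : Type*} [NormedAddCommGroup H] [InnerProductSpace ℂ H]

/-- `u` is an eigenvector of `T` for the eigenvalue `μ`. -/
def IsEigenvector (T : H →ₗ.[ℂ] H) (μ : ℂ) (u : T.domain) : Prop :=
  (u : H) ≠ 0 ∧ T u = μ • (u : H)

/-- The point spectrum `σ_p(T)`: the set of the eigenvalues of `T`. -/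
def pointSpectrum (T : H →ₗ.[ℂ] H) : Set ℂ := {μ | ∃ u : T.domain, IsEigenvector T μ u}

/-- The essential spectrum `σ_ess(T)` of a self-adjoint operator `T`: the set of the `μ` which
admit a singular (Weyl) sequence, i.e. unit vectors `u n` of the domain of `T` which converge
weakly to `0` and satisfy `T (u n) - μ (u n) → 0`. -/
def essentialSpectrum (T : H →ₗ.[ℂ] H) : Set ℂ :=
  {μ | ∃ u : ℕ → T.domain, (∀ n, ‖(u n : H)‖ = 1) ∧
    (∀ v : H, Tendsto (fun n => ⟪v, (u n : H)⟫_ℂ) atTop (𝓝 0)) ∧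
    Tendsto (fun n => T (u n) - μ • (u n : H)) atTop (𝓝 0)}

/-- The eigenvalues of `T` embedded in the essential spectrum: `σ_emb(T) = σ_p(T) ∩ σ_ess(T)`. -/
def embeddedSpectrum (T : H →ₗ.[ℂ] H) : Set ℂ := pointSpectrum T ∩ essentialSpectrum T

/-- The discrete spectrum `σ_d(T) = σ_p(T) \ σ_emb(T)`. -/
def discreteSpectrum (T : H →ₗ.[ℂ] H) : Set ℂ := pointSpectrum T \ embeddedSpectrum T

end Spectrum

end Maxwell

end

/-! Why σ_ess(A) = [0, ∞). A multiply connected section S carries a TEM mode: a nonzero planar field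
V with zero divergence, zero curl and zero tangential trace. If a is an axial profile supported in z
> 0, then a(z)(V, 0) is divergence free, satisfies the boundary condition, and has double curl
-a''(z)(V, 0). On such fields A acts as -d²/dz², which has no positive threshold, and wave packets
moving off to infinity form Weyl sequences for every t ≥ 0 (`exists_axial_sequence`,
`Ici_subset_essentialSpectrum`). The other inclusion is nonnegativity, since ⟨A E, E⟩ = ‖curl E‖².

Where V comes from (`exists_transverse_mode`). Let f be smooth with compact support, locally
constant with values 0 and 1 near the complement of S, and equal to 1 near some point of it. V is
the component of ∇f orthogonal to the gradients of test functions of S. The Lipschitz boundary gives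
an open set outside S on which f = 1, and a Poincaré inequality then excludes V = 0.

Where f comes from (`exists_hole_function`). Simple connectedness is a statement about loops and has
to be turned into a hole. A group-valued cocycle on segments records the class of a noncontractible
loop, and the loop is shadowed by a walk on a fine lattice. Closed walks can be shrunk across cells
contained in S (`holonomy_eq_one`), so some walk winds about a cell that is not contained in S
(`exists_winding_ne_zero`). Cells with zero and with nonzero winding number meet only inside S, so
they separate the complement and f exists by Urysohn.

Why eigenfunctions extend (`exists_reflected_eigenvector`). The adjoint of extension by reflection
is folding, which commutes with curl, so Green's formula passes from the half domain to Ω; this uses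
the condition E × ν = 0 on {x = 0}. The divergence equation and the second curl need no boundary
condition: their folded test functions either vanish on {x = 0} or are differentiated only
tangentially, and a cutoff near that plane is harmless (`exists_cutoff`). Eigenvalues are
nonnegative, hence embedded. -/

noncomputable section

namespace Maxwell

/-! ### A group-valued cocycle that detects noncontractible loops -/

section ConvexSets

open unitInterval

section

variable {X : Type*} [TopologicalSpace X] (x₀ : X)

/-- The inner `b.symm` and `b` cancel. In this product the right factor is traversed first, which is
why the later definitions let (x, y) stand for a path from y to x. -/
lemma fromPath_mul {x y z : X} (a : Path x₀ x) (b : Path x₀ y) (c : Path x₀ z) (p : Path y x)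
    (q : Path z y) :
    (FundamentalGroup.fromPath (.mk ((b.trans p).trans a.symm)) : FundamentalGroup X x₀) *
      FundamentalGroup.fromPath (.mk ((c.trans q).trans b.symm)) =
    FundamentalGroup.fromPath (.mk ((c.trans (q.trans p)).trans a.symm)) := by
  rw [FundamentalGroup.mul_def]
  simp only [FundamentalGroup.fromPath, FundamentalGroup.fromArrow, Path.Homotopic.Quotient.mk_trans, Path.Homotopic.Quotient.mk_symm]
  simp only [Path.Homotopic.Quotient.trans_assoc]
  rw [← Path.Homotopic.Quotient.trans_assoc (Path.Homotopic.Quotient.mk b).symm,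
    Path.Homotopic.Quotient.symm_trans, Path.Homotopic.Quotient.refl_trans]

/-- Undoes a conjugation. The equations `hx`, `hy` and the cast are there because the endpoints γ 1
and γ 0 of a loop equal the base point only propositionally. -/
lemma mk_eq_refl_of_conj {x y : X} (hx : x = x₀) (hy : y = x₀) (a : ∀ x : X, Path x₀ x)
    (p : Path x₀ x₀)
    (h : Path.Homotopic.Quotient.mk (((a x).trans (p.cast hx hy)).trans (a y).symm) = .refl x₀) :
    Path.Homotopic.Quotient.mk p = .refl x₀ := by
  subst hx
  subst hy
  simp only [Path.Homotopic.Quotient.mk_trans, Path.Homotopic.Quotient.mk_symm,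
    Path.cast_rfl_rfl] at h
  have h2 : (Path.Homotopic.Quotient.mk (a y)).symm.trans
    ((((Path.Homotopic.Quotient.mk (a y)).trans (.mk p)).trans
      (Path.Homotopic.Quotient.mk (a y)).symm).trans (Path.Homotopic.Quotient.mk (a y))) = .mk p := by
    simp only [Path.Homotopic.Quotient.trans_assoc]
    rw [Path.Homotopic.Quotient.symm_trans, Path.Homotopic.Quotient.trans_refl,
     ← Path.Homotopic.Quotient.trans_assoc,
      Path.Homotopic.Quotient.symm_trans, Path.Homotopic.Quotient.refl_trans]
  rw [← h2, h, Path.Homotopic.Quotient.refl_trans, Path.Homotopic.Quotient.symm_trans]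

end

section Cocycle

variable {E : Type*} [AddCommGroup E] [Module ℝ E] [TopologicalSpace E] [IsTopologicalAddGroup E]
  [ContinuousSMul ℝ E]

lemma homotopic_of_mem_convex {S K : Set E} (hK : Convex ℝ K) (hKS : K ⊆ S) {x y : S}
    (p q : Path x y) (hp : ∀ t, (p t : E) ∈ K) (hq : ∀ t, (q t : E) ∈ K) : p.Homotopic q :=
  ⟨{ toFun := fun st => ⟨(1 - (st.1 : ℝ)) • (p st.2 : E) + (st.1 : ℝ) • (q st.2 : E),
        hKS (hK (hp _) (hq _) (sub_nonneg.2 st.1.2.2) st.1.2.1 (by ring))⟩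
     continuous_toFun := by fun_prop
     map_zero_left := by intro t; ext; simp
     map_one_left := by intro t; ext; simp
     prop' := by
      rintro s t (rfl | rfl)
      · ext; simp [← add_smul]
      · ext; simp [← add_smul] }⟩

/-- The straight path between two points of a convex subset. -/
def segmentPath {S : Set E} (x y : S) (h : segment ℝ (x : E) y ⊆ S) : Path x y where
  toFun t := ⟨AffineMap.lineMap (x : E) (y : E) (t : ℝ), h (by
    rw [segment_eq_image_lineMap]; exact ⟨t, t.2, rfl⟩)⟩
  continuous_toFun := by
    simp only [AffineMap.lineMap_apply_module]
    fun_prop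
  source' := by ext; simp
  target' := by ext; simp

lemma segmentPath_mem {S : Set E} (x y : S) (h : segment ℝ (x : E) y ⊆ S) (t : I) :
    (segmentPath x y h t : E) ∈ segment ℝ (x : E) y := by
  rw [segment_eq_image_lineMap]; exact ⟨t, t.2, rfl⟩

variable {S : Set E} [PathConnectedSpace S] (x₀ : S)

open Classical in
/-- The class in the fundamental group of the loop which runs from the base point to `y`, then
straight to `x`, then back to the base point; it is `1` if the segment leaves `S`. -/
def segmentClass (x y : E) : FundamentalGroup S x₀ :=
  if h : segment ℝ y x ⊆ S then
    FundamentalGroup.fromPath (.mk (((PathConnectedSpace.somePath x₀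
      ⟨y, h (left_mem_segment ℝ y x)⟩).trans (segmentPath _ ⟨x, h (right_mem_segment ℝ y x)⟩ h)).trans
        (PathConnectedSpace.somePath x₀ _).symm))
  else 1

/-- Two paths with the same endpoints in a convex subset of S are homotopic by the straight-line
homotopy, so the segment may be replaced by any path inside K. -/
lemma segmentClass_eq {K : Set E} (hK : Convex ℝ K) (hKS : K ⊆ S) {x y : S} (p : Path y x)
    (hp : ∀ t, (p t : E) ∈ K) : segmentClass x₀ (x : E) y =
      FundamentalGroup.fromPath (.mk (((PathConnectedSpace.somePath x₀ y).trans p).trans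
        (PathConnectedSpace.somePath x₀ x).symm)) := by
  have hx : (x : E) ∈ K := by simpa using hp 1
  have hy : (y : E) ∈ K := by simpa using hp 0
  have h : segment ℝ (y : E) x ⊆ K := hK.segment_subset hy hx
  rw [segmentClass, dif_pos (h.trans hKS)]
  congr 1
  rw [Path.Homotopic.Quotient.eq]
  refine Path.Homotopic.hcomp (Path.Homotopic.hcomp (.refl _) ?_) (.refl _)
  exact homotopic_of_mem_convex hK hKS _ _ (fun t => h (segmentPath_mem _ _ _ _)) hp

/-- The broken path z → y → x stays in K, so it represents the same class as the segment from z to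
x. -/
lemma segmentClass_mul {K : Set E} (hK : Convex ℝ K) (hKS : K ⊆ S) {x y z : E} (hx : x ∈ K)
    (hy : y ∈ K) (hz : z ∈ K) :
    segmentClass x₀ x y * segmentClass x₀ y z = segmentClass x₀ x z := by
  lift x to S using hKS hx
  lift y to S using hKS hy
  lift z to S using hKS hz
  have h1 := hK.segment_subset hy hx
  have h2 := hK.segment_subset hz hy
  rw [segmentClass_eq x₀ hK hKS (segmentPath y x (h1.trans hKS)) fun t => h1 (segmentPath_mem _ _ _ _),
    segmentClass_eq x₀ hK hKS (segmentPath z y (h2.trans hKS)) fun t => h2 (segmentPath_mem _ _ _ _),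
    segmentClass_eq x₀ hK hKS ((segmentPath z y (h2.trans hKS)).trans
      (segmentPath y x (h1.trans hKS))), fromPath_mul]
  intro t
  rw [Path.trans_apply]
  split_ifs
  · exact h2 (segmentPath_mem _ _ _ _)
  · exact h1 (segmentPath_mem _ _ _ _)


end Cocycle

universe u in
-- Packs the homotopy theory into algebra: the cocycle c is trivial around convex pieces of S, Q
-- accumulates it along γ, and Q 1 ≠ 1 expresses noncontractibility. Afterwards only products in G
-- are manipulated.
lemma exists_cocycle_of_not_isSimplyConnected {E : Type u} [AddCommGroup E] [Module ℝ E]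
    [TopologicalSpace E] [IsTopologicalAddGroup E] [ContinuousSMul ℝ E] {S : Set E}
    (hS : IsPathConnected S) (hS' : ¬ IsSimplyConnected S) :
    ∃ (G : Type u) (_ : Group G) (c : E → E → G) (γ : I → E) (Q : I → G),
      Continuous γ ∧ (∀ t, γ t ∈ S) ∧ γ 0 = γ 1 ∧
      (∀ K : Set E, Convex ℝ K → K ⊆ S → ∀ x ∈ K, ∀ y ∈ K, ∀ z ∈ K, c x y * c y z = c x z) ∧
      Q 0 = 1 ∧ Q 1 ≠ 1 ∧
      ∀ K : Set E, Convex ℝ K → K ⊆ S → ∀ s t : I, (∀ r ∈ Set.uIcc s t, γ r ∈ K) →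
        Q t = Q s * c (γ s) (γ t) := by
  have : PathConnectedSpace S := isPathConnected_iff_pathConnectedSpace.1 hS
  rw [IsSimplyConnected, simply_connected_iff_loops_nullhomotopic] at hS'
  push Not at hS'
  obtain ⟨x₀, γ, hγ⟩ := hS' this
  have h01 : γ 0 = γ 1 := by simp
  -- γ is run backwards from t to 0, to match the order of multiplication; Q 1 is then a conjugate
  -- of the class of γ reversed.
  let Q : I → FundamentalGroup S x₀ := fun t => FundamentalGroup.fromPath (.mk
    (((PathConnectedSpace.somePath x₀ (γ t)).trans (γ.subpath t 0)).trans
        (PathConnectedSpace.somePath x₀ (γ 0)).symm))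
  refine ⟨FundamentalGroup S x₀, inferInstance, segmentClass x₀, fun t => γ t, Q, by fun_prop, fun t => (γ t).2, congrArg _ h01,
    fun K hK hKS x hx y hy z hz => segmentClass_mul x₀ hK hKS hx hy hz, ?_, ?_, ?_⟩
  · simp only [Q, Path.subpath_self, FundamentalGroup.one_def]
    simp [Path.Homotopic.Quotient.mk_trans, Path.Homotopic.Quotient.mk_symm,
      Path.Homotopic.Quotient.mk_refl]
  · intro h
    apply hγ
    have h2 := mk_eq_refl_of_conj x₀ γ.target γ.source (PathConnectedSpace.somePath x₀) γ.symm (by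
      rw [← FundamentalGroup.one_def, ← h]
      simp only [Q]
      rw [← Path.symm_subpath, Path.subpath_zero_one]
      rfl)
    rw [← Path.symm_symm γ, ← Path.refl_symm]
    refine Path.Homotopic.symm₂ ?_
    rwa [← Path.Homotopic.Quotient.eq]
  · intro K hK hKS s t h
    simp only [Q]
    rw [segmentClass_eq x₀ hK hKS (γ.subpath t s), fromPath_mul]
    · congr 1
      rw [Path.Homotopic.Quotient.eq]
      refine Path.Homotopic.hcomp (Path.Homotopic.hcomp (.refl _) ?_) (.refl _)
      exact ⟨(Path.Homotopy.subpathTransSubpath γ t s 0).symm⟩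
    · intro r
      have h2 : γ.subpath t s r ∈ Set.range (γ.subpath t s) := ⟨r, rfl⟩
      rw [Path.range_subpath, Set.uIcc_comm] at h2
      obtain ⟨r', hr', h3⟩ := h2
      rw [← h3]
      exact h r' hr'

end ConvexSets

/-! ### Holonomy and winding numbers of closed lattice walks -/

section Lattice

open SimpleGraph

variable {V : Type*} {Γ : SimpleGraph V}

/-- The sum over the steps of a walk. -/
def stepSum {M : Type*} [AddCommMonoid M] (f : V → V → M) {u v : V} (p : Γ.Walk u v) : M :=
  (p.darts.map fun d => f d.fst d.snd).sum

/-- The ordered product over the steps of a walk. -/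
def holonomy {G : Type*} [Group G] (c : V → V → G) {u v : V} (p : Γ.Walk u v) : G :=
  (p.darts.map fun d => c d.fst d.snd).prod

section
variable {M : Type*} [AddCommMonoid M] (f : V → V → M) {u v w : V}

@[simp] lemma stepSum_nil : stepSum f (Walk.nil : Γ.Walk u u) = 0 := rfl

@[simp] lemma stepSum_cons (h : Γ.Adj u v) (p : Γ.Walk v w) :
    stepSum f (Walk.cons h p) = f u v + stepSum f p := by simp [stepSum]

@[simp] lemma stepSum_append (p : Γ.Walk u v) (q : Γ.Walk v w) :
    stepSum f (p.append q) = stepSum f p + stepSum f q := by simp [stepSum]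

@[simp] lemma stepSum_concat (p : Γ.Walk u v) (h : Γ.Adj v w) :
    stepSum f (p.concat h) = stepSum f p + f v w := by simp [stepSum]

lemma stepSum_eq_zero (p : Γ.Walk u v) (h : ∀ d ∈ p.darts, f d.fst d.snd = 0) :
    stepSum f p = 0 := by
  apply List.sum_eq_zero
  simpa using h

lemma stepSum_congr {f g : V → V → M} (p : Γ.Walk u v)
    (h : ∀ d ∈ p.darts, f d.fst d.snd = g d.fst d.snd) : stepSum f p = stepSum g p := by
  unfold stepSum
  rw [List.map_congr_left h]

end

lemma stepSum_potential {M : Type*} [AddCommGroup M] (φ : V → M) {u v : V} (p : Γ.Walk u v) :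
    stepSum (fun a b => φ b - φ a) p = φ v - φ u := by
  induction p with
  | nil => simp
  | cons h p ih => simp [ih]

lemma stepSum_sub {M : Type*} [AddCommGroup M] (f g : V → V → M) {u v : V} (p : Γ.Walk u v) :
    stepSum (fun a b => f a b - g a b) p = stepSum f p - stepSum g p := by
  induction p with
  | nil => simp
  | cons h p ih => simp [ih]; abel

section
variable {G : Type*} [Group G] (c : V → V → G) {u v w : V}

@[simp] lemma holonomy_nil : holonomy c (Walk.nil : Γ.Walk u u) = 1 := rfl

@[simp] lemma holonomy_cons (h : Γ.Adj u v) (p : Γ.Walk v w) :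
    holonomy c (Walk.cons h p) = c u v * holonomy c p := by simp [holonomy]

@[simp] lemma holonomy_append (p : Γ.Walk u v) (q : Γ.Walk v w) :
    holonomy c (p.append q) = holonomy c p * holonomy c q := by simp [holonomy]

@[simp] lemma holonomy_concat (p : Γ.Walk u v) (h : Γ.Adj v w) :
    holonomy c (p.concat h) = holonomy c p * c v w := by simp [holonomy]

end

/-- Adjacency in the square lattice. -/
def LatticeAdj (a b : ℤ × ℤ) : Prop :=
  (a.1 = b.1 ∧ (a.2 = b.2 + 1 ∨ b.2 = a.2 + 1)) ∨ (a.2 = b.2 ∧ (a.1 = b.1 + 1 ∨ b.1 = a.1 + 1))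

/-- The signed number of times that a step crosses, upwards of height `j`, the vertical line
through the middle of the column `[i, i + 1]`. -/
def crossing (i j : ℤ) (a b : ℤ × ℤ) : ℤ :=
  if j < a.2 ∧ a.2 = b.2 then
    (if a.1 = i ∧ b.1 = i + 1 then 1 else if a.1 = i + 1 ∧ b.1 = i then -1 else 0)
  else 0

/-- The winding number of a lattice walk around the cell `[i, i + 1] × [j, j + 1]`. -/
def winding {Γ : SimpleGraph (ℤ × ℤ)} {u v : ℤ × ℤ} (p : Γ.Walk u v) (i j : ℤ) : ℤ :=
  stepSum (crossing i j) p

/-- The weight of a lattice point used to shrink closed walks. -/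
def cornerWeight (M : ℤ) (a : ℤ × ℤ) : ℕ := 1 + (a.1 + M).toNat + (a.2 + M).toNat

/-- If the cocycle `c` is trivial around every cell about which some closed walk winds, then its
holonomy is trivial. -/
theorem holonomy_eq_one {Γ : SimpleGraph (ℤ × ℤ)} (hΓ : ∀ a b, Γ.Adj a b → LatticeAdj a b)
    {G : Type*} [Group G] (c : ℤ × ℤ → ℤ × ℤ → G) (hc : ∀ a b, Γ.Adj a b → c a b * c b a = 1)
    (hcell : ∀ (u : ℤ × ℤ) (p : Γ.Walk u u) (i j : ℤ), winding p i j ≠ 0 →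
      Γ.Adj (i, j + 1) (i, j) ∧ Γ.Adj (i + 1, j) (i, j) ∧
      c (i + 1, j + 1) (i, j + 1) * c (i, j + 1) (i, j) =
        c (i + 1, j + 1) (i + 1, j) * c (i + 1, j) (i, j))
    {u : ℤ × ℤ} (p : Γ.Walk u u) : holonomy c p = 1 := by
  -- The shift by M puts the walk in the first quadrant, where `Int.toNat` does not truncate and
  -- moving towards the lower left lowers `cornerWeight`.
  obtain ⟨M, hM⟩ : ∃ M : ℤ, ∀ a ∈ p.support, 0 ≤ a.1 + M ∧ 0 ≤ a.2 + M := by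
    refine ⟨∑ a ∈ p.support.toFinset, (|a.1| + |a.2|), fun a ha => ?_⟩
    have h := Finset.single_le_sum (f := fun a : ℤ × ℤ => |a.1| + |a.2|) (fun b _ => by positivity)
      (List.mem_toFinset.2 ha)
    have h1 := neg_abs_le a.1
    have h2 := neg_abs_le a.2
    have h3 := abs_nonneg a.1
    have h4 := abs_nonneg a.2
    constructor <;> linarith
  -- Induction on the total weight of the visited vertices. The summand 1 in `cornerWeight` makes
  -- weight 0 force the trivial walk and makes every deletion of steps strict progress.
  suffices H : ∀ n : ℕ, ∀ (u : ℤ × ℤ) (p : Γ.Walk u u),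
      stepSum (fun _ b => cornerWeight M b) p ≤ n →
      (∀ a ∈ p.support, 0 ≤ a.1 + M ∧ 0 ≤ a.2 + M) → holonomy c p = 1 from
    H _ u p le_rfl hM
  clear hM p u
  intro n
  induction n with
  | zero =>
    intro u p hp _
    cases p with
    | nil => rfl
    | cons h p => simp [cornerWeight] at hp
  | succ n ih =>
    intro u p hp hM
    -- v is the rightmost among the highest vertices. The walk may be rotated to start at v, because
    -- rotation only conjugates the holonomy.
    obtain ⟨v, hv, hmax⟩ := Finset.exists_max_image p.support.toFinset
      (fun a => toLex (a.2, a.1)) ⟨u, by simp⟩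
    simp only [List.mem_toFinset, Prod.Lex.toLex_le_toLex] at hv hmax
    obtain ⟨p1, p2, rfl⟩ := Walk.mem_support_iff_exists_append.1 hv
    suffices h : holonomy c (p2.append p1) = 1 by
      rw [holonomy_append] at h ⊢
      exact mul_eq_one_comm.1 h
    have hp' : stepSum (fun _ b => cornerWeight M b) (p2.append p1) ≤ n + 1 := by
      rw [stepSum_append] at hp ⊢; omega
    have hM' : ∀ a ∈ (p2.append p1).support, (0 ≤ a.1 + M ∧ 0 ≤ a.2 + M) ∧
        (a.2 < v.2 ∨ a.2 = v.2 ∧ a.1 ≤ v.1) := by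
      intro a ha
      have : a ∈ (p1.append p2).support := by
        rw [Walk.mem_support_append_iff] at ha ⊢; exact ha.symm
      exact ⟨hM a this, hmax a this⟩
    generalize p2.append p1 = q at hp' hM'
    clear hp hM hmax hv p1 p2
    cases q with
    | nil => rfl
    | @cons _ x _ h q =>
    cases q with
    | nil => exact absurd h (Γ.irrefl)
    | cons h1 q =>
    obtain ⟨y, r, h', hr⟩ := Walk.exists_cons_eq_concat h1 q
    rw [hr] at hp' hM' ⊢
    clear hr q h1
    -- If v is visited again, the walk splits there into two lighter closed walks.
    by_cases hvr : v ∈ r.support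
    · obtain ⟨r1, r2, rfl⟩ := Walk.mem_support_iff_exists_append.1 hvr
      have h1 := ih v (Walk.cons h r1) (by
        simp [cornerWeight] at hp' ⊢; omega) (fun a ha => (hM' a (by
          simp at ha ⊢; tauto)).1)
      have h2 := ih v (r2.concat h') (by
        simp [cornerWeight] at hp' ⊢; omega) (fun a ha => (hM' a (by
          simp [Walk.support_concat] at ha ⊢; tauto)).1)
      simp at h1 h2 ⊢
      rw [mul_assoc, h2, mul_one, h1]
    have hx := hM' x (by simp [Walk.support_concat])
    have hy := hM' y (by simp [Walk.support_concat])
    have hv := hM' v (by simp)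
    have hrM : ∀ a ∈ r.support, (0 ≤ a.1 + M ∧ 0 ≤ a.2 + M) ∧
        (a.2 < v.2 ∨ a.2 = v.2 ∧ a.1 ≤ v.1) := fun a ha => hM' a (by
          simp [Walk.support_concat]; tauto)
    have hLx := hΓ _ _ h
    have hLy := hΓ _ _ h'
    simp only [LatticeAdj] at hLx hLy
    -- Only a step at height j + 1 with endpoint v could contribute, by maximality of v, and the
    -- middle part r avoids v.
    have hw : ∀ (i j : ℤ), v = (i + 1, j + 1) → stepSum (crossing i j) r = 0 := by
      rintro i j hvij
      apply stepSum_eq_zero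
      intro d hd
      have ha := r.dart_fst_mem_support_of_mem_darts hd
      have hb := r.dart_snd_mem_support_of_mem_darts hd
      have ha' := hrM _ ha
      have hb' := hrM _ hb
      have hav : d.fst ≠ v := fun h => hvr (h ▸ ha)
      have hbv : d.snd ≠ v := fun h => hvr (h ▸ hb)
      rw [hvij] at ha' hb' hav hbv
      simp only [ne_eq, Prod.ext_iff] at ha' hb' hav hbv
      unfold crossing
      split_ifs <;> omega
    obtain ⟨i, j⟩ := v
    obtain ⟨i, rfl⟩ : ∃ i', i = i' + 1 := ⟨i - 1, by ring⟩
    obtain ⟨j, rfl⟩ : ∃ j', j = j' + 1 := ⟨j - 1, by ring⟩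
    have hw := hw i j rfl
    obtain ⟨x1, x2⟩ := x
    obtain ⟨y1, y2⟩ := y
    have hx1 : (x1 = i ∧ x2 = j + 1) ∨ (x1 = i + 1 ∧ x2 = j) := by simp at hLx hx; omega
    have hy1 : (y1 = i ∧ y2 = j + 1) ∨ (y1 = i + 1 ∧ y2 = j) := by simp at hLy hy; omega
    have hinv := hc _ _ h
    have hinv' := hc _ _ h'
    -- Both neighbours of v on the walk coincide: the spur into v is deleted and its two factors
    -- cancel.
    have hspur : ∀ z : ℤ × ℤ, z = (x1, x2) → z = (y1, y2) →
        holonomy c (Walk.cons h (r.concat h')) = 1 := by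
      rintro z rfl h2
      obtain ⟨rfl, rfl⟩ := Prod.ext_iff.1 h2
      have h1 := ih _ r (by simp [cornerWeight] at hp' ⊢; omega) fun a ha => (hrM a ha).1
      simp [h1, hinv]
    -- One neighbour is to the left of v and the other below it: the corner v is pushed across the
    -- cell to the opposite corner (i, j), which lowers both coordinates of that vertex by one.
    have hpush : Γ.Adj (i, j) (x1, x2) → Γ.Adj (y1, y2) (i, j) →
        c (i + 1, j + 1) (x1, x2) * c (x1, x2) (i, j) =
          c (i + 1, j + 1) (y1, y2) * c (y1, y2) (i, j) →
        0 ≤ i + M → 0 ≤ j + M → holonomy c (Walk.cons h (r.concat h')) = 1 := by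
      intro hdx hyd hrel hi hj
      have h1 := ih _ (Walk.cons hdx (r.concat hyd)) (by
        simp [cornerWeight] at hp' ⊢; omega) fun a ha => by
          simp [Walk.support_concat] at ha
          rcases ha with rfl | ha | rfl
          · exact ⟨hi, hj⟩
          · exact (hrM a ha).1
          · exact ⟨hi, hj⟩
      have h2 := hc _ _ hdx
      simp only [holonomy_cons, holonomy_concat] at h1 ⊢
      rw [← eq_inv_iff_mul_eq_one] at h2 hinv'
      rw [h2, inv_mul_eq_one, ] at h1
      rw [hinv', ← mul_assoc, mul_inv_eq_one, ← mul_left_inj (c (y1, y2) (i, j)), ← hrel, mul_assoc,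
        h1]
    -- At such a corner exactly one step of the walk is counted, so the winding number about the
    -- cell is ±1 and the cell relation is available.
    have hneg : ∀ (m : ℤ), winding (Walk.cons h (r.concat h')) i j = m → m ≠ 0 →
        Γ.Adj (i, j + 1) (i, j) ∧ Γ.Adj (i + 1, j) (i, j) ∧
        c (i + 1, j + 1) (i, j + 1) * c (i, j + 1) (i, j) =
          c (i + 1, j + 1) (i + 1, j) * c (i + 1, j) (i, j) := by
      intro m hm hm0
      exact hcell _ _ i j (hm ▸ hm0)
    simp only [winding, stepSum_cons, stepSum_concat, hw] at hneg
    rcases hx1 with ⟨rfl, rfl⟩ | ⟨rfl, rfl⟩ <;> rcases hy1 with ⟨rfl, rfl⟩ | ⟨rfl, rfl⟩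
    · exact hspur _ rfl rfl
    · obtain ⟨e1, e2, e3⟩ := hneg (-1) (by simp [crossing]) (by norm_num)
      exact hpush e1.symm e2 e3 hx.1.1 hy.1.2
    · obtain ⟨e1, e2, e3⟩ := hneg 1 (by simp [crossing]) (by norm_num)
      exact hpush e2.symm e1 e3.symm hy.1.1 hx.1.2
    · exact hspur _ rfl rfl

section
variable {Γ : SimpleGraph (ℤ × ℤ)} {u : ℤ × ℤ}

/-- The two counts differ only by steps along the edge shared by the two cells. Hence a jump of the
winding number forces that edge to belong to the graph. -/
lemma adj_of_winding_ne_above (p : Γ.Walk u u) (i j : ℤ)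
    (h : winding p i j ≠ winding p i (j + 1)) : Γ.Adj (i, j + 1) (i + 1, j + 1) := by
  by_contra hadj
  refine h (stepSum_congr p fun d _ => ?_)
  obtain ⟨⟨⟨a1, a2⟩, ⟨b1, b2⟩⟩, hd⟩ := d
  have h1 : ¬ (a1 = i ∧ a2 = j + 1 ∧ b1 = i + 1 ∧ b2 = j + 1) := by
    rintro ⟨rfl, rfl, rfl, rfl⟩; exact hadj hd
  have h2 : ¬ (a1 = i + 1 ∧ a2 = j + 1 ∧ b1 = i ∧ b2 = j + 1) := by
    rintro ⟨rfl, rfl, rfl, rfl⟩; exact hadj hd.symm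
  simp only [crossing]
  split_ifs <;> omega

/-- Away from the shared vertical edge, the difference of the two crossing counts is the coboundary
of the indicator φ of the vertical ray above that edge's lower endpoint; a coboundary sums to zero
along a closed walk. -/
lemma adj_of_winding_ne_right (hΓ : ∀ a b, Γ.Adj a b → LatticeAdj a b) (p : Γ.Walk u u) (i j : ℤ)
    (h : winding p i j ≠ winding p (i + 1) j) : Γ.Adj (i + 1, j) (i + 1, j + 1) := by
  by_contra hadj
  apply h
  rw [← sub_eq_zero]
  unfold winding
  rw [← stepSum_sub]
  let φ : ℤ × ℤ → ℤ := fun a => if a.1 = i + 1 ∧ j < a.2 then 1 else 0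
  rw [stepSum_congr (g := fun a b => φ b - φ a), stepSum_potential, sub_self]
  intro d _
  obtain ⟨⟨⟨a1, a2⟩, ⟨b1, b2⟩⟩, hd⟩ := d
  have hl := hΓ _ _ hd
  have h1 : ¬ (a1 = i + 1 ∧ a2 = j ∧ b1 = i + 1 ∧ b2 = j + 1) := by
    rintro ⟨rfl, rfl, rfl, rfl⟩; exact hadj hd
  have h2 : ¬ (a1 = i + 1 ∧ a2 = j + 1 ∧ b1 = i + 1 ∧ b2 = j) := by
    rintro ⟨rfl, rfl, rfl, rfl⟩; exact hadj hd.symm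
  simp only [LatticeAdj] at hl
  simp only [crossing, φ]
  split_ifs <;> omega

lemma exists_winding_bound (hΓ : ∀ a b, Γ.Adj a b → LatticeAdj a b) (p : Γ.Walk u u) :
    ∃ N : ℤ, ∀ i j, winding p i j ≠ 0 → -N ≤ i ∧ i ≤ N ∧ -N ≤ j ∧ j ≤ N := by
  obtain ⟨N, hN⟩ : ∃ N : ℤ, ∀ a ∈ p.support, -N < a.1 ∧ a.1 < N ∧ -N < a.2 ∧ a.2 < N := by
    refine ⟨1 + ∑ a ∈ p.support.toFinset, (|a.1| + |a.2|), fun a ha => ?_⟩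
    have h := Finset.single_le_sum (f := fun a : ℤ × ℤ => |a.1| + |a.2|) (fun b _ => by positivity)
      (List.mem_toFinset.2 ha)
    have h1 := neg_abs_le a.1
    have h2 := neg_abs_le a.2
    have h3 := le_abs_self a.1
    have h4 := le_abs_self a.2
    have h5 := abs_nonneg a.1
    have h6 := abs_nonneg a.2
    refine ⟨?_, ?_, ?_, ?_⟩ <;> linarith
  refine ⟨N, fun i j h => ?_⟩
  by_contra hcon
  apply h
  -- Below the walk every step lies above height j, so all crossings of the column are counted and
  -- they form the coboundary of a half-plane indicator. In the remaining cases no step is counted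
  -- at all.
  by_cases hj : j < -N
  · let φ : ℤ × ℤ → ℤ := fun a => if i + 1 ≤ a.1 then 1 else 0
    unfold winding
    rw [stepSum_congr (g := fun a b => φ b - φ a), stepSum_potential, sub_self]
    intro d hd
    have ha := hN _ (p.dart_fst_mem_support_of_mem_darts hd)
    obtain ⟨⟨⟨a1, a2⟩, ⟨b1, b2⟩⟩, hadj⟩ := d
    have hl := hΓ _ _ hadj
    simp only [LatticeAdj] at hl ha
    simp only [crossing, φ]
    split_ifs <;> omega
  · apply stepSum_eq_zero
    intro d hd
    have ha := hN _ (p.dart_fst_mem_support_of_mem_darts hd)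
    have hb := hN _ (p.dart_snd_mem_support_of_mem_darts hd)
    simp only [crossing]
    split_ifs <;> omega

end

end Lattice

/-- The plane containing the cross-section of the wave guide. -/
abbrev Plane : Type := EuclideanSpace ℝ (Fin 2)

/-! ### From a noncontractible planar loop to a hole -/

section Geometry

open unitInterval

/-- The point of the lattice of mesh `ε` with given integer coordinates. -/
def latticePoint (ε : ℝ) (a : ℤ × ℤ) : Plane := !₂[ε * a.1, ε * a.2]

/-- The closed axis-parallel box spanned by two points of the lattice of mesh `ε`. -/
def latticeBox (ε : ℝ) (a b : ℤ × ℤ) : Set Plane :=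
  {x | ε * min (a.1 : ℝ) b.1 ≤ x 0 ∧ x 0 ≤ ε * max (a.1 : ℝ) b.1 ∧
    ε * min (a.2 : ℝ) b.2 ≤ x 1 ∧ x 1 ≤ ε * max (a.2 : ℝ) b.2}

lemma latticeBox_comm (ε : ℝ) (a b : ℤ × ℤ) : latticeBox ε a b = latticeBox ε b a := by
  simp [latticeBox, min_comm, max_comm]

lemma convex_latticeBox (ε : ℝ) (a b : ℤ × ℤ) : Convex ℝ (latticeBox ε a b) := by
  have h : ∀ k : Fin 2, IsLinearMap ℝ fun x : Plane => x k := fun k =>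
    ⟨fun x y => rfl, fun c x => rfl⟩
  have e : latticeBox ε a b = ({x | ε * min (a.1 : ℝ) b.1 ≤ x 0} ∩ {x | x 0 ≤ ε * max (a.1 : ℝ) b.1})
      ∩ ({x | ε * min (a.2 : ℝ) b.2 ≤ x 1} ∩ {x | x 1 ≤ ε * max (a.2 : ℝ) b.2}) := by
    ext x; simp [latticeBox, and_assoc]
  rw [e]
  exact ((convex_halfSpace_ge (h 0) _).inter (convex_halfSpace_le (h 0) _)).inter
    ((convex_halfSpace_ge (h 1) _).inter (convex_halfSpace_le (h 1) _))

lemma isClosed_latticeBox (ε : ℝ) (a b : ℤ × ℤ) : IsClosed (latticeBox ε a b) := by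
  have h : ∀ k : Fin 2, Continuous fun x : Plane => x k := fun k => by fun_prop
  exact (isClosed_le continuous_const (h 0)).inter ((isClosed_le (h 0) continuous_const).inter
    ((isClosed_le continuous_const (h 1)).inter (isClosed_le (h 1) continuous_const)))

lemma latticePoint_left_mem {ε : ℝ} (hε : 0 ≤ ε) (a b : ℤ × ℤ) :
    latticePoint ε a ∈ latticeBox ε a b := by
  simp only [latticePoint, latticeBox, Set.mem_ofPred_eq]
  refine ⟨?_, ?_, ?_, ?_⟩ <;> apply mul_le_mul_of_nonneg_left _ hε <;> simp

lemma latticePoint_right_mem {ε : ℝ} (hε : 0 ≤ ε) (a b : ℤ × ℤ) :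
    latticePoint ε b ∈ latticeBox ε a b :=
  latticeBox_comm ε a b ▸ latticePoint_left_mem hε b a

/-- The graph of the lattice edges of mesh `ε` which are contained in `S`. -/
def latticeGraph (ε : ℝ) (S : Set Plane) : SimpleGraph (ℤ × ℤ) where
  Adj a b := LatticeAdj a b ∧ latticeBox ε a b ⊆ S
  symm := ⟨fun a b h => ⟨by have := h.1; simp only [LatticeAdj] at this ⊢; omega,
    latticeBox_comm ε a b ▸ h.2⟩⟩
  loopless := ⟨fun a h => by have := h.1; simp only [LatticeAdj] at this; omega⟩

/-- A closed lattice cell. -/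
abbrev latticeCell (ε : ℝ) (i j : ℤ) : Set Plane := latticeBox ε (i, j) (i + 1, j + 1)

lemma mem_latticeCell {ε : ℝ} {i j : ℤ} {x : Plane} : x ∈ latticeCell ε i j ↔
    ε * i ≤ x 0 ∧ x 0 ≤ ε * (i + 1) ∧ ε * j ≤ x 1 ∧ x 1 ≤ ε * (j + 1) := by
  simp [latticeBox]

lemma latticeBox_subset {ε : ℝ} (hε : 0 ≤ ε) {a b c d : ℤ × ℤ}
    (h : min a.1 b.1 ≤ min c.1 d.1 ∧ max c.1 d.1 ≤ max a.1 b.1 ∧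
      min a.2 b.2 ≤ min c.2 d.2 ∧ max c.2 d.2 ≤ max a.2 b.2) :
    latticeBox ε c d ⊆ latticeBox ε a b := by
  rintro x ⟨h1, h2, h3, h4⟩
  obtain ⟨g1, g2, g3, g4⟩ := h
  refine ⟨?_, ?_, ?_, ?_⟩
  · refine le_trans (mul_le_mul_of_nonneg_left ?_ hε) h1
    exact_mod_cast g1
  · refine le_trans h2 (mul_le_mul_of_nonneg_left ?_ hε)
    rw [← Int.cast_max, ← Int.cast_max]
    exact Int.cast_le.2 g2
  · refine le_trans (mul_le_mul_of_nonneg_left ?_ hε) h3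
    exact_mod_cast g3
  · refine le_trans h4 (mul_le_mul_of_nonneg_left ?_ hε)
    rw [← Int.cast_max, ← Int.cast_max]
    exact Int.cast_le.2 g4

/-- The lattice point at the lower left of a point of the plane. -/
def latticeFloor (ε : ℝ) (x : Plane) : ℤ × ℤ := (⌊x 0 / ε⌋, ⌊x 1 / ε⌋)

lemma mul_floor_div {ε : ℝ} (hε : 0 < ε) (r : ℝ) : ε * ⌊r / ε⌋ ≤ r ∧ r < ε * ⌊r / ε⌋ + ε := by
  have h1 := Int.floor_le (r / ε)
  have h2 := Int.lt_floor_add_one (r / ε)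
  rw [le_div_iff₀ hε] at h1
  rw [div_lt_iff₀ hε] at h2
  constructor <;> linarith

lemma floor_div_sub_le {ε : ℝ} (hε : 0 < ε) {r s : ℝ} (h : |r - s| < ε) :
    ⌊r / ε⌋ ≤ ⌊s / ε⌋ + 1 := by
  rw [← Int.floor_add_one]
  apply Int.floor_le_floor
  rw [div_add_one hε.ne']
  gcongr
  have := (abs_lt.1 h).2
  linarith

/-- A planar open set which is path connected but not simply connected contains a closed lattice
walk which winds around a cell that is not contained in the set. -/
theorem exists_winding_ne_zero {S : Set Plane} (hSo : IsOpen S) (hS : IsPathConnected S)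
    (hS' : ¬ IsSimplyConnected S) :
    ∃ ε : ℝ, 0 < ε ∧ ∃ (u : ℤ × ℤ) (p : (latticeGraph ε S).Walk u u) (i j : ℤ),
      winding p i j ≠ 0 ∧ ¬ latticeCell ε i j ⊆ S := by
  -- Suppose every cell about which some walk winds lies in S. Convexity makes the cocycle trivial
  -- around these cells, so all closed walks have holonomy 1; shadowing the loop by a walk then
  -- gives Q 1 = 1.
  by_contra! hcon
  obtain ⟨G, _, c, γ, Q, hγ, hγS, h01, hc, hQ0, hQ1, hQ⟩ :=
    exists_cocycle_of_not_isSimplyConnected hS hS'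
  obtain ⟨δ, hδ, hδS⟩ := (isCompact_range hγ).exists_thickening_subset_open hSo
    (Set.range_subset_iff.2 hγS)
  -- The factor 4 leaves room: points whose coordinates differ by at most 2ε are at distance at most
  -- 2√2 ε < δ.
  obtain ⟨ε, hε, hεδ⟩ : ∃ ε : ℝ, 0 < ε ∧ δ = 4 * ε := ⟨δ / 4, by positivity, by ring⟩
  obtain ⟨η, hη, hγη⟩ := Metric.uniformContinuous_iff.1
    (CompactSpace.uniformContinuous_of_continuous hγ) ε hε
  have hball : ∀ t, Metric.ball (γ t) δ ⊆ S := fun t =>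
    (Metric.ball_subset_thickening (Set.mem_range_self t) δ).trans hδS
  have hclose : ∀ x y : Plane, |x 0 - y 0| ≤ 2 * ε → |x 1 - y 1| ≤ 2 * ε → x ∈ Metric.ball y δ := by
    intro x y h0 h1
    rw [Metric.mem_ball, EuclideanSpace.dist_eq, Real.sqrt_lt' hδ, Fin.sum_univ_two,
      Real.dist_eq, Real.dist_eq, hεδ]
    nlinarith [abs_nonneg (x 0 - y 0), abs_nonneg (x 1 - y 1), mul_pos hε hε]
  set Γ := latticeGraph ε S with hΓdef
  have hΓ : ∀ a b, Γ.Adj a b → LatticeAdj a b ∧ latticeBox ε a b ⊆ S := fun a b h => h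
  set C : ℤ × ℤ → ℤ × ℤ → G := fun a b =>
    c (latticePoint ε a) (latticePoint ε b) with hCdef
  have hcc : ∀ x ∈ S, c x x = 1 := by
    intro x hx
    have h := hc {x} (convex_singleton x) (by simpa using hx) x rfl x rfl x rfl
    simpa using h
  have hCadj : ∀ a b, Γ.Adj a b → C a b * C b a = 1 := by
    intro a b h
    have h1 := latticePoint_left_mem hε.le a b
    rw [← hcc _ (h.2 h1)]
    exact hc _ (convex_latticeBox ε a b) h.2 _ h1 _ (latticePoint_right_mem hε.le a b) _ h1
  have hhol : ∀ (u : ℤ × ℤ) (p : Γ.Walk u u), holonomy C p = 1 := by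
    intro u p
    refine holonomy_eq_one (fun a b h => (hΓ a b h).1) C hCadj (fun u p i j hw => ?_) p
    have hcell := hcon ε hε u p i j hw
    have hmem : ∀ a : ℤ × ℤ, (i ≤ a.1 ∧ a.1 ≤ i + 1 ∧ j ≤ a.2 ∧ a.2 ≤ j + 1) →
        latticePoint ε a ∈ latticeCell ε i j := by
      rintro a h
      refine latticeBox_subset hε.le ?_ (latticePoint_left_mem hε.le a a)
      simp only
      omega
    refine ⟨⟨?_, (latticeBox_subset hε.le ?_).trans hcell⟩, ⟨?_, (latticeBox_subset hε.le ?_).trans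
      hcell⟩, ?_⟩
    · simp [LatticeAdj]
    · simp only; omega
    · simp [LatticeAdj]
    · simp only; omega
    · simp only [hCdef]
      rw [hc _ (convex_latticeBox _ _ _) hcell _ (hmem _ ?_) _ (hmem _ ?_) _ (hmem _ ?_),
        hc _ (convex_latticeBox _ _ _) hcell _ (hmem _ ?_) _ (hmem _ ?_) _ (hmem _ ?_)] <;>
        simp
  have hstep : ∀ K : Set Plane, Convex ℝ K → K ⊆ S → ∀ a b : ℤ × ℤ, latticeBox ε a b ⊆ K →
      (a = b ∨ LatticeAdj a b) → ∃ q : Γ.Walk a b, holonomy C q = C a b := by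
    rintro K hK hKS a b hab (rfl | h)
    · exact ⟨.nil, by
        rw [holonomy_nil]; exact (hcc _ (hKS (hab (latticePoint_left_mem hε.le _ _)))).symm⟩
    · have hadj : Γ.Adj a b := ⟨h, hab.trans hKS⟩
      exact ⟨.cons hadj .nil, by simp⟩
  -- Lattice points differing by at most one in each coordinate are joined by a horizontal and then
  -- a vertical step, either of which may be trivial.
  have hwalk : ∀ K : Set Plane, Convex ℝ K → K ⊆ S → ∀ a b : ℤ × ℤ, latticeBox ε a b ⊆ K →
      (a.1 ≤ b.1 + 1 ∧ b.1 ≤ a.1 + 1 ∧ a.2 ≤ b.2 + 1 ∧ b.2 ≤ a.2 + 1) →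
      ∃ q : Γ.Walk a b, holonomy C q = C a b := by
    rintro K hK hKS ⟨a1, a2⟩ ⟨b1, b2⟩ hab h
    have s1 : latticeBox ε (a1, a2) (b1, a2) ⊆ latticeBox ε (a1, a2) (b1, b2) :=
      latticeBox_subset hε.le (by simp only; omega)
    have s2 : latticeBox ε (b1, a2) (b1, b2) ⊆ latticeBox ε (a1, a2) (b1, b2) :=
      latticeBox_subset hε.le (by simp only; omega)
    simp only at h
    obtain ⟨q1, h1⟩ := hstep K hK hKS (a1, a2) (b1, a2) (s1.trans hab) (by
      simp [LatticeAdj, Prod.ext_iff]; omega)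
    obtain ⟨q2, h2⟩ := hstep K hK hKS (b1, a2) (b1, b2) (s2.trans hab) (by
      simp [LatticeAdj, Prod.ext_iff]; omega)
    refine ⟨q1.append q2, ?_⟩
    rw [holonomy_append, h1, h2]
    exact hc K hK hKS _ (hab (latticePoint_left_mem hε.le _ _)) _
      (hab (s1 (latticePoint_right_mem hε.le _ _))) _ (hab (latticePoint_right_mem hε.le _ _))
  obtain ⟨n, hn⟩ := exists_nat_one_div_lt hη
  -- A subdivision of mesh 1/(n + 1) < η, so that γ moves by less than ε on each piece; the minimum
  -- with 1 keeps T inside the unit interval.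
  let T : ℕ → I := fun k => ⟨min 1 (k * (1 / ((n : ℝ) + 1))), by positivity, min_le_left _ _⟩
  have hT0 : T 0 = 0 := by ext; simp [T]
  have hT1 : T (n + 1) = 1 := by
    ext
    simp only [T, Nat.cast_add, Nat.cast_one]
    rw [mul_one_div_cancel (by positivity)]
    simp
  have hTd : ∀ k, ∀ r ∈ Set.uIcc (T k) (T (k + 1)), dist r (T k) < η := by
    intro k r hr
    have hle : T k ≤ T (k + 1) := by
      apply Subtype.coe_le_coe.1
      simp only [T]
      gcongr
      simp
    rw [Set.uIcc_of_le hle] at hr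
    have h1 : (T k : ℝ) ≤ r := hr.1
    have h2 : (r : ℝ) ≤ T (k + 1) := hr.2
    have h3 : (T (k + 1) : ℝ) ≤ T k + 1 / ((n : ℝ) + 1) := by
      simp only [T, Nat.cast_add, Nat.cast_one]
      have : (0 : ℝ) ≤ 1 / ((n : ℝ) + 1) := by positivity
      rcases min_cases (1 : ℝ) (k * (1 / ((n : ℝ) + 1))) with h | h <;>
        rcases min_cases (1 : ℝ) ((k + 1) * (1 / ((n : ℝ) + 1))) with h' | h' <;> linarith
    rw [Subtype.dist_eq, Real.dist_eq, abs_of_nonneg (by linarith)]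
    linarith
  have hfl : ∀ t, latticePoint ε (latticeFloor ε (γ t)) ∈ Metric.ball (γ t) δ := by
    intro t
    have h0 := mul_floor_div hε (γ t 0)
    have h1 := mul_floor_div hε (γ t 1)
    apply hclose <;> simp only [latticePoint, latticeFloor] <;> rw [abs_le] <;> constructor <;>
      simp <;> linarith
  -- The walk visits the lower left lattice points of γ (T k). The outer factors join γ to the
  -- lattice; at the end the loop has closed up and they cancel.
  have H : ∀ k : ℕ, ∃ q : Γ.Walk (latticeFloor ε (γ 0)) (latticeFloor ε (γ (T k))),
      Q (T k) = c (γ 0) (latticePoint ε (latticeFloor ε (γ 0))) * holonomy C q *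
        c (latticePoint ε (latticeFloor ε (γ (T k)))) (γ (T k)) := by
    intro k
    induction k with
    | zero =>
      rw [hT0]
      refine ⟨.nil, ?_⟩
      rw [holonomy_nil, mul_one, hc _ (convex_ball _ _) (hball 0) _ (Metric.mem_ball_self hδ) _
        (hfl 0) _ (Metric.mem_ball_self hδ), hQ0, hcc _ (hγS 0)]
    | succ k ih =>
      obtain ⟨q, hq⟩ := ih
      have hd : ∀ r ∈ Set.uIcc (T k) (T (k + 1)), dist (γ r) (γ (T k)) < ε := fun r hr =>
        hγη (hTd k r hr)
      have hd1 := hd _ Set.right_mem_uIcc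
      have hd1 : ∀ i : Fin 2, |γ (T (k + 1)) i - γ (T k) i| < ε := by
        intro i
        refine lt_of_le_of_lt ?_ hd1
        rw [dist_eq_norm]
        exact PiLp.norm_apply_le (γ (T (k + 1)) - γ (T k)) i
      have hd2 : ∀ i : Fin 2, |γ (T k) i - γ (T (k + 1)) i| < ε := fun i => by
        rw [abs_sub_comm]; exact hd1 i
      have hbox : latticeBox ε (latticeFloor ε (γ (T k))) (latticeFloor ε (γ (T (k + 1)))) ⊆
          Metric.ball (γ (T k)) δ := by
        intro x hx
        have a0 := mul_floor_div hε (γ (T k) 0)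
        have a1 := mul_floor_div hε (γ (T k) 1)
        have b0 := mul_floor_div hε (γ (T (k + 1)) 0)
        have b1 := mul_floor_div hε (γ (T (k + 1)) 1)
        have c0 := abs_lt.1 (hd1 0)
        have c1 := abs_lt.1 (hd1 1)
        obtain ⟨x1, x2, x3, x4⟩ := hx
        simp only [latticeFloor, mul_min_of_nonneg _ _ hε.le, mul_max_of_nonneg _ _ hε.le,
          min_le_iff, le_max_iff] at x1 x2 x3 x4
        apply hclose <;> rw [abs_le] <;> constructor
        · rcases x1 with h | h <;> linarith
        · rcases x2 with h | h <;> linarith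
        · rcases x3 with h | h <;> linarith
        · rcases x4 with h | h <;> linarith
      obtain ⟨q', hq'⟩ := hwalk _ (convex_ball (γ (T k)) δ) (hball _) _ _ hbox
        ⟨floor_div_sub_le hε (hd2 0), floor_div_sub_le hε (hd1 0),
          floor_div_sub_le hε (hd2 1), floor_div_sub_le hε (hd1 1)⟩
      refine ⟨q.append q', ?_⟩
      have hγK : ∀ r ∈ Set.uIcc (T k) (T (k + 1)), γ r ∈ Metric.ball (γ (T k)) δ := fun r hr =>
        lt_of_lt_of_le (hd r hr) (by linarith)
      have m1 := hbox (latticePoint_left_mem hε.le _ _)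
      have m2 := hbox (latticePoint_right_mem hε.le _ _)
      have m3 := hγK _ Set.left_mem_uIcc
      have m4 := hγK _ Set.right_mem_uIcc
      have hc' := hc _ (convex_ball (γ (T k)) δ) (hball _)
      rw [hQ _ (convex_ball (γ (T k)) δ) (hball _) _ _ hγK, hq, holonomy_append, hq', mul_assoc,
        hc' _ m1 _ m3 _ m4, mul_assoc, mul_assoc, mul_assoc, hc' _ m1 _ m2 _ m4]
  obtain ⟨q, hq⟩ : ∃ q : Γ.Walk (latticeFloor ε (γ 0)) (latticeFloor ε (γ 0)),
      Q 1 = c (γ 0) (latticePoint ε (latticeFloor ε (γ 0))) * holonomy C q *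
        c (latticePoint ε (latticeFloor ε (γ 0))) (γ 0) := by
    have := H (n + 1)
    rw [hT1] at this
    rwa [← h01] at this
  have e := hc _ (convex_ball (γ 0) δ) (hball 0) _ (Metric.mem_ball_self hδ) _ (hfl 0) _
    (Metric.mem_ball_self hδ)
  rw [hhol, mul_one, e, hcc _ (hγS 0)] at hq
  exact hQ1 hq

/-- Gives closedness of arbitrary unions of cells; the cells of winding number 0 are infinite in
number. -/
lemma locallyFinite_latticeCell {ε : ℝ} (hε : 0 < ε) :
    LocallyFinite fun a : ℤ × ℤ => latticeCell ε a.1 a.2 := by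
  intro x
  refine ⟨Metric.ball x ε, Metric.ball_mem_nhds x hε,
    ((Set.finite_Icc (⌊x 0 / ε⌋ - 2) (⌊x 0 / ε⌋ + 2)).prod
      (Set.finite_Icc (⌊x 1 / ε⌋ - 2) (⌊x 1 / ε⌋ + 2))).subset ?_⟩
  rintro ⟨i, j⟩ ⟨y, hy, hyx⟩
  rw [mem_latticeCell] at hy
  have hd : ∀ k : Fin 2, |y k - x k| < ε := by
    intro k
    refine lt_of_le_of_lt ?_ hyx
    rw [dist_eq_norm]
    exact PiLp.norm_apply_le (y - x) k
  have key : ∀ (k : Fin 2) (m : ℤ), ε * m ≤ y k → y k ≤ ε * (m + 1) →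
      m ∈ Set.Icc (⌊x k / ε⌋ - 2) (⌊x k / ε⌋ + 2) := by
    intro k m h1 h2
    have h3 := mul_floor_div hε (x k)
    have h4 := abs_lt.1 (hd k)
    constructor
    · have : ε * (⌊x k / ε⌋ : ℝ) < ε * ((m + 2 : ℤ) : ℝ) := by push_cast; linarith
      have := lt_of_mul_lt_mul_left this hε.le
      have := Int.cast_lt.1 this
      omega
    · have : ε * (m : ℝ) < ε * ((⌊x k / ε⌋ + 2 : ℤ) : ℝ) := by push_cast; linarith
      have := lt_of_mul_lt_mul_left this hε.le
      have := Int.cast_lt.1 this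
      omega
  exact ⟨key 0 i hy.1 hy.2.1, key 1 j hy.2.2.1 hy.2.2.2⟩

lemma mem_latticeCell_floor {ε : ℝ} (hε : 0 < ε) (x : Plane) :
    x ∈ latticeCell ε (latticeFloor ε x).1 (latticeFloor ε x).2 := by
  have h0 := mul_floor_div hε (x 0)
  have h1 := mul_floor_div hε (x 1)
  rw [mem_latticeCell]
  simp only [latticeFloor]
  refine ⟨h0.1, ?_, h1.1, ?_⟩ <;> linarith

/-- Two cells, about exactly one of which a closed walk in `S` winds, meet only in `S`. -/
lemma mem_of_mem_latticeCell_of_winding {ε : ℝ} (hε : 0 < ε) {S : Set Plane} {u : ℤ × ℤ}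
    (p : (latticeGraph ε S).Walk u u) {i j i' j' : ℤ} {x : Plane} (hx : x ∈ latticeCell ε i j)
    (hx' : x ∈ latticeCell ε i' j') (h : winding p i j ≠ winding p i' j') : x ∈ S := by
  have hΓ : ∀ a b, (latticeGraph ε S).Adj a b → LatticeAdj a b := fun a b h => h.1
  rw [mem_latticeCell] at hx hx'
  have hle : ∀ {m n : ℤ} {r : ℝ}, ε * m ≤ r → r ≤ ε * (n + 1) → m ≤ n + 1 := by
    intro m n r h1 h2
    have : ε * (m : ℝ) ≤ ε * ((n + 1 : ℤ) : ℝ) := by push_cast; linarith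
    exact Int.cast_le.1 (le_of_mul_le_mul_left this hε)
  have hi := hle hx.1 hx'.2.1
  have hi' := hle hx'.1 hx.2.1
  have hj := hle hx.2.2.1 hx'.2.2.2
  have hj' := hle hx'.2.2.1 hx.2.2.2
  have hright : ∀ m n : ℤ, ε * (m + 1 : ℤ) ≤ x 0 → x 0 ≤ ε * (m + 1) → ε * n ≤ x 1 →
      x 1 ≤ ε * (n + 1) → winding p m n ≠ winding p (m + 1) n → x ∈ S := by
    intro m n h1 h2 h3 h4 h5
    refine (adj_of_winding_ne_right hΓ p m n h5).2 ?_
    push_cast at h1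
    simp [latticeBox, *]
  have habove : ∀ m n : ℤ, ε * m ≤ x 0 → x 0 ≤ ε * (m + 1) → ε * (n + 1 : ℤ) ≤ x 1 →
      x 1 ≤ ε * (n + 1) → winding p m n ≠ winding p m (n + 1) → x ∈ S := by
    intro m n h1 h2 h3 h4 h5
    refine (adj_of_winding_ne_above p m n h5).2 ?_
    push_cast at h3
    simp [latticeBox, *]
  -- Pass from (i, j) to (i', j') through (i', j). The winding number changes in one of these two
  -- moves, and x lies on the edge crossed there, which is an edge of the graph and thus lies in S.
  by_cases hcol : winding p i j = winding p i' j
  · rw [hcol] at h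
    rcases lt_trichotomy j j' with hlt | rfl | hlt
    · obtain rfl : j' = j + 1 := by omega
      exact habove i' j hx'.1 hx'.2.1 hx'.2.2.1 hx.2.2.2 h
    · exact absurd rfl h
    · obtain rfl : j = j' + 1 := by omega
      exact habove i' j' hx'.1 hx'.2.1 hx.2.2.1 hx'.2.2.2 h.symm
  · rcases lt_trichotomy i i' with hlt | rfl | hlt
    · obtain rfl : i' = i + 1 := by omega
      exact hright i j hx'.1 hx.2.1 hx.2.2.1 hx.2.2.2 hcol
    · exact absurd rfl hcol
    · obtain rfl : i = i' + 1 := by omega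
      exact hright i' j hx.1 hx'.2.1 hx.2.2.1 hx.2.2.2 (Ne.symm hcol)

/-- A bounded planar open set which is path connected but not simply connected has a hole: there is
a smooth compactly supported function which is locally constant, with values `0` and `1`, near the
complement, and which takes the value `1` there. -/
theorem exists_hole_function {S : Set Plane} (hSo : IsOpen S) (hSb : Bornology.IsBounded S)
    (hS : IsPathConnected S) (hS' : ¬ IsSimplyConnected S) :
    ∃ f : Plane → ℝ, ContDiff ℝ ∞ f ∧ HasCompactSupport f ∧
      (∀ x ∉ S, f =ᶠ[𝓝 x] 0 ∨ f =ᶠ[𝓝 x] 1) ∧ ∃ x ∉ S, f =ᶠ[𝓝 x] 1 := by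
  obtain ⟨ε, hε, u, p, i₀, j₀, hw, hcell⟩ := exists_winding_ne_zero hSo hS hS'
  obtain ⟨N, hN⟩ := exists_winding_bound (fun a b (h : (latticeGraph ε S).Adj a b) => h.1) p
  have hclosed : ∀ P : ℤ × ℤ → Prop, IsClosed (⋃ a : {a // P a}, latticeCell ε a.1.1 a.1.2) :=
    fun P => ((locallyFinite_latticeCell hε).comp_injective
      Subtype.val_injective).isClosed_iUnion fun a => isClosed_latticeBox _ _ _
  have hA := (hclosed fun a => winding p a.1 a.2 ≠ 0).inter hSo.isClosed_compl
  have hB := (hclosed fun a => winding p a.1 a.2 = 0).inter hSo.isClosed_compl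
  set A := (⋃ a : {a : ℤ × ℤ // winding p a.1 a.2 ≠ 0}, latticeCell ε a.1.1 a.1.2)
    with hAdef
  set B := (⋃ a : {a : ℤ × ℤ // winding p a.1 a.2 = 0}, latticeCell ε a.1.1 a.1.2)
    with hBdef
  -- Winding number zero or nonzero splits the complement of S into two disjoint closed parts, to
  -- which the smooth Urysohn lemma applies.
  have hdisj : Disjoint (B ∩ Sᶜ) (A ∩ Sᶜ) := by
    rw [Set.disjoint_left]
    rintro x ⟨hxB, hxS⟩ ⟨hxA, -⟩
    obtain ⟨⟨a, ha⟩, hxa⟩ := Set.mem_iUnion.1 hxA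
    obtain ⟨⟨b, hb⟩, hxb⟩ := Set.mem_iUnion.1 hxB
    exact hxS (mem_of_mem_latticeCell_of_winding hε p hxa hxb (by rw [hb]; exact ha))
  have hcover : ∀ x, x ∈ A ∨ x ∈ B := by
    intro x
    by_cases h : winding p (latticeFloor ε x).1 (latticeFloor ε x).2 = 0
    · exact Or.inr (Set.mem_iUnion.2 ⟨⟨_, h⟩, mem_latticeCell_floor hε x⟩)
    · exact Or.inl (Set.mem_iUnion.2 ⟨⟨_, h⟩, mem_latticeCell_floor hε x⟩)
  have hAb : Bornology.IsBounded A := by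
    refine (Metric.isBounded_closedBall (x := (0 : Plane))
      (r := √((ε * (N + 1)) ^ 2 + (ε * (N + 1)) ^ 2))).subset ?_
    intro x hx
    obtain ⟨⟨a, ha⟩, hxa⟩ := Set.mem_iUnion.1 hx
    obtain ⟨h1, h2, h3, h4⟩ := hN _ _ ha
    rw [mem_latticeCell] at hxa
    rw [mem_closedBall_zero_iff, EuclideanSpace.norm_eq]
    apply Real.sqrt_le_sqrt
    rw [Fin.sum_univ_two, Real.norm_eq_abs, Real.norm_eq_abs, sq_abs, sq_abs]
    have key : ∀ (k : ℤ) (r : ℝ), -N ≤ k → k ≤ N → ε * k ≤ r → r ≤ ε * (k + 1) →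
        r ^ 2 ≤ (ε * (N + 1)) ^ 2 := by
      intro k r g1 g2 g3 g4
      have g1' : -(N : ℝ) ≤ k := by exact_mod_cast g1
      have g2' : (k : ℝ) ≤ N := by exact_mod_cast g2
      apply sq_le_sq'
      · nlinarith
      · nlinarith
    exact add_le_add (key _ _ h1 h2 hxa.1 hxa.2.1) (key _ _ h3 h4 hxa.2.2.1 hxa.2.2.2)
  obtain ⟨f, hf0, hf1, -⟩ := exists_contMDiffMap_zero_one_nhds_of_isClosed (n := ⊤)
    (modelWithCornersSelf ℝ Plane) hB hA hdisj
  rw [eventually_nhdsSet_iff_forall] at hf0 hf1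
  refine ⟨f, f.contMDiff.contDiff, ?_, ?_, ?_⟩
  -- Outside the bounded set S ∪ A every point belongs to B ∩ Sᶜ, where f vanishes.
  · refine HasCompactSupport.of_support_subset_isCompact
      ((hSb.union hAb).isCompact_closure) fun x hx => subset_closure ?_
    by_contra hxx
    rw [Set.mem_union, not_or] at hxx
    exact hx (hf0 x ⟨(hcover x).resolve_left hxx.2, hxx.1⟩).self_of_nhds
  · intro x hx
    rcases hcover x with h | h
    · exact Or.inr (hf1 x ⟨h, hx⟩)
    · exact Or.inl (hf0 x ⟨h, hx⟩)
  · obtain ⟨x, hxc, hxS⟩ := Set.not_subset.1 hcell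
    exact ⟨x, hxS, hf1 x ⟨Set.mem_iUnion.2 ⟨⟨(i₀, j₀), hw⟩, hxc⟩, hxS⟩⟩

end Geometry

/-! ### The divergence-free and curl-free field of the cross-section -/

section TransverseMode

variable {F : Type*} [NormedAddCommGroup F] [InnerProductSpace ℝ F] [CompleteSpace F]

lemma norm_gradient (g : F → ℝ) (x : F) : ‖gradient g x‖ = ‖fderiv ℝ g x‖ := by
  simp [gradient]

lemma inner_gradient (g : F → ℝ) (x v : F) : ⟪gradient g x, v⟫_ℝ = fderiv ℝ g x v := by
  simp [gradient]

lemma gradient_apply {d : ℕ} (g : EuclideanSpace ℝ (Fin d) → ℝ) (x : EuclideanSpace ℝ (Fin d))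
    (k : Fin d) : gradient g x k = fderiv ℝ g x (EuclideanSpace.single k 1) := by
  rw [← inner_gradient, EuclideanSpace.inner_single_right]
  simp

lemma gradient_sub_fun {g h : F → ℝ} (hg : ContDiff ℝ ∞ g) (hh : ContDiff ℝ ∞ h) :
    gradient (g - h) = gradient g - gradient h := by
  funext x
  simp only [gradient, Pi.sub_apply]
  rw [fderiv_sub (hg.differentiable (by simp) x) (hh.differentiable (by simp) x), map_sub]

lemma gradient_add_fun {g h : F → ℝ} (hg : ContDiff ℝ ∞ g) (hh : ContDiff ℝ ∞ h) :
    gradient (g + h) = gradient g + gradient h := by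
  funext x
  simp only [gradient, Pi.add_apply]
  rw [fderiv_add (hg.differentiable (by simp) x) (hh.differentiable (by simp) x), map_add]

lemma gradient_smul_fun (c : ℝ) {g : F → ℝ} (hg : ContDiff ℝ ∞ g) :
    gradient (c • g) = c • gradient g := by
  funext x
  simp only [gradient, Pi.smul_apply]
  rw [fderiv_const_smul (hg.differentiable (by simp) x), map_smul]

lemma continuous_gradient {g : F → ℝ} (hg : ContDiff ℝ ∞ g) : Continuous (gradient g) :=
  (InnerProductSpace.toDual ℝ F).symm.continuous.comp (hg.continuous_fderiv (by simp))

lemma support_gradient_subset (g : F → ℝ) : Function.support (gradient g) ⊆ tsupport g := by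
  intro x hx
  apply support_fderiv_subset ℝ
  intro h
  apply hx
  simp [gradient, h]

lemma tsupport_gradient_subset (g : F → ℝ) : tsupport (gradient g) ⊆ tsupport g :=
  closure_minimal (support_gradient_subset g) (isClosed_tsupport g)

lemma hasCompactSupport_gradient {g : F → ℝ} (hg : HasCompactSupport g) :
    HasCompactSupport (gradient g) :=
  hg.of_isClosed_subset (isClosed_tsupport _) (tsupport_gradient_subset g)

lemma memLp_gradient {g : Plane → ℝ} (hg : ContDiff ℝ ∞ g) (hg' : HasCompactSupport g) :
    MemLp (gradient g) 2 volume :=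
  (continuous_gradient hg).memLp_of_hasCompactSupport (hasCompactSupport_gradient hg')

/-- The gradients of test functions of `S`, as a subspace of `L²`. -/
def testGradients (S : Set Plane) : Submodule ℝ (Lp Plane 2 (volume : Measure Plane)) where
  carrier := {u | ∃ g : Plane → ℝ, ContDiff ℝ ∞ g ∧ HasCompactSupport g ∧ tsupport g ⊆ S ∧
    u =ᵐ[volume] gradient g}
  add_mem' := by
    rintro u v ⟨g, hg1, hg2, hg3, hg⟩ ⟨h, hh1, hh2, hh3, hh⟩
    refine ⟨g + h, hg1.add hh1, hg2.add hh2,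
      (tsupport_add g h).trans (Set.union_subset hg3 hh3), ?_⟩
    rw [gradient_add_fun hg1 hh1]
    exact (Lp.coeFn_add u v).trans (hg.add hh)
  zero_mem' := by
    refine ⟨0, contDiff_const, HasCompactSupport.zero, by simp, ?_⟩
    refine (Lp.coeFn_zero _ _ _).trans (Eventually.of_forall fun x => ?_)
    simp [gradient]
  smul_mem' := by
    rintro c u ⟨g, hg1, hg2, hg3, hg⟩
    refine ⟨c • g, hg1.const_smul c, ?_, (tsupport_smul_subset_right (fun _ => c) g).trans hg3, ?_⟩
    · exact HasCompactSupport.smul_left (f := fun _ => c) hg2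
    rw [gradient_smul_fun c hg1]
    exact (Lp.coeFn_smul c u).trans (hg.const_smul c)

/-- The complement of a domain with Lipschitz boundary has interior points near each of its
points. -/
lemma HasLipschitzBoundary.exists_isOpen_compl {d : ℕ} {S : Set (EuclideanSpace ℝ (Fin d))}
    (hS : HasLipschitzBoundary S) (hSo : IsOpen S) {p : EuclideanSpace ℝ (Fin d)} (hp : p ∉ S)
    {N : Set (EuclideanSpace ℝ (Fin d))} (hN : N ∈ 𝓝 p) :
    ∃ D ⊆ N, IsOpen D ∧ D.Nonempty ∧ D ⊆ Sᶜ := by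
  by_cases hpf : p ∈ frontier S
  · obtain ⟨e, he, K, γ, hγ, U, hU, h⟩ := hS p hpf
    have hγc : Continuous fun q : EuclideanSpace ℝ (Fin d) => γ (q - ⟪e, q⟫_ℝ • e) :=
      hγ.continuous.comp (by fun_prop)
    have hec : Continuous fun q : EuclideanSpace ℝ (Fin d) => ⟪e, q⟫_ℝ := by fun_prop
    refine ⟨interior (N ∩ U) ∩ {q | ⟪e, q⟫_ℝ < γ (q - ⟪e, q⟫_ℝ • e)},
      fun q hq => (interior_subset hq.1).1, isOpen_interior.inter (isOpen_lt hec hγc), ?_, ?_⟩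
    · have hpU := (h p (mem_of_mem_nhds hU)).not.1 hp
      rw [not_lt] at hpU
      -- Moving from p in the direction -e keeps the component orthogonal to e and so drops strictly
      -- below the graph.
      have hcont : Tendsto (fun t : ℝ => p - t • e) (𝓝 0) (𝓝 p) := by
        have : Continuous fun t : ℝ => p - t • e := by fun_prop
        simpa using this.tendsto 0
      have hev := hcont.eventually (mem_interior_iff_mem_nhds.1
        (mem_interior_iff_mem_nhds.2 (interior_mem_nhds.2 (inter_mem hN hU))))
      obtain ⟨t, ht, ht0⟩ := ((hev.filter_mono nhdsWithin_le_nhds).and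
        (self_mem_nhdsWithin (s := Set.Ioi (0 : ℝ)))).exists
      refine ⟨p - t • e, ht, ?_⟩
      have hee : ⟪e, e⟫_ℝ = 1 := by rw [real_inner_self_eq_norm_sq, he]; norm_num
      have h1 : ⟪e, p - t • e⟫_ℝ = ⟪e, p⟫_ℝ - t := by
        rw [inner_sub_right, inner_smul_right, hee, mul_one]
      have h2 : p - t • e - (⟪e, p⟫_ℝ - t) • e = p - ⟪e, p⟫_ℝ • e := by
        rw [sub_smul]; abel
      change ⟪e, p - t • e⟫_ℝ < γ (p - t • e - ⟪e, p - t • e⟫_ℝ • e)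
      rw [h1, h2]
      have : (0 : ℝ) < t := ht0
      linarith
    · rintro q ⟨hq1, hq2⟩ hqS
      exact lt_asymm ((h q (interior_subset hq1).2).1 hqS) hq2
  · have hpc : p ∉ closure S := by
      rw [hSo.frontier_eq] at hpf
      exact fun h => hpf ⟨h, hp⟩
    exact ⟨interior N ∩ (closure S)ᶜ, fun q hq => interior_subset hq.1,
      isOpen_interior.inter isClosed_closure.isOpen_compl,
      ⟨p, mem_interior_iff_mem_nhds.2 hN, hpc⟩, fun q hq hqS => hq.2 (subset_closure hqS)⟩

/-- A function which equals `1` on a hole of `S` is not a limit in the Dirichlet norm of test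
functions of `S`. -/
lemma not_tendsto_gradient_sub {S : Set Plane} (hSb : Bornology.IsBounded S) {f : Plane → ℝ}
    (hf : ContDiff ℝ ∞ f) (hf' : HasCompactSupport f) {D : Set Plane} (hDo : IsOpen D)
    (hDne : D.Nonempty) (hDS : D ⊆ Sᶜ) (hfD : ∀ x ∈ D, f x = 1) (g : ℕ → Plane → ℝ)
    (hg : ∀ m, ContDiff ℝ ∞ (g m)) (hgS : ∀ m, tsupport (g m) ⊆ S) :
    ¬ Tendsto (fun m => eLpNorm (gradient (f - g m)) 2 volume) atTop (𝓝 0) := by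
  intro hlim
  set B : Set Plane := tsupport f ∪ S with hB
  have hBb : Bornology.IsBounded B := hf'.isCompact.isBounded.union hSb
  have hBfin : volume B < ⊤ := hBb.measure_lt_top
  have hsupp : ∀ m, tsupport (f - g m) ⊆ B := fun m =>
    (tsupport_sub f (g m)).trans (Set.union_subset_union_right _ (hgS m))
  -- Poincaré inequality in L¹, with a constant independent of m because all supports lie in the
  -- bounded set B. Combined with Hölder on B it would force the L¹ norm of f - g m to zero, whereas
  -- f - g m = 1 on D.
  obtain ⟨C, hC⟩ : ∃ C : NNReal, ∀ m, eLpNorm (f - g m) 1 volume ≤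
      C * eLpNorm (fderiv ℝ (f - g m)) 1 volume := by
    refine ⟨eLpNormLESNormFDerivOfLeConst ℝ (volume : Measure Plane) B 1 1, fun m => ?_⟩
    have := eLpNorm_le_eLpNorm_fderiv_of_le (μ := (volume : Measure Plane)) (F := ℝ)
      (u := f - g m) (s := B) (p := 1) (q := 1) ((hf.sub (hg m)).of_le (by simp))
      ((subset_tsupport _).trans (hsupp m)) le_rfl (by simp) (by simp) hBb
    simpa using this
  have h1 : ∀ m, eLpNorm (fderiv ℝ (f - g m)) 1 volume ≤
      eLpNorm (gradient (f - g m)) 2 volume * volume B ^ (1 / 2 : ℝ) := by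
    intro m
    have e1 : eLpNorm (fderiv ℝ (f - g m)) 1 volume = eLpNorm (gradient (f - g m)) 1 volume :=
      eLpNorm_congr_norm_ae (Eventually.of_forall fun x => (norm_gradient _ x).symm)
    have hs := (support_gradient_subset (f - g m)).trans (hsupp m)
    have hcont : Continuous (gradient (f - g m)) := continuous_gradient (hf.sub (hg m))
    rw [e1, ← eLpNorm_restrict_eq_of_support_subset hs,
      ← eLpNorm_restrict_eq_of_support_subset (p := 2) hs]
    have := eLpNorm_le_eLpNorm_mul_rpow_measure_univ (μ := volume.restrict B) (p := 1) (q := 2)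
      (by norm_num) hcont.aestronglyMeasurable
    refine this.trans ?_
    rw [Measure.restrict_apply_univ]
    norm_num
  have h2 : ∀ m, volume D ≤ eLpNorm (f - g m) 1 volume := by
    intro m
    calc volume D = eLpNorm (D.indicator fun _ => (1 : ℝ)) 1 volume := by
          rw [eLpNorm_indicator_const hDo.measurableSet (by simp) (by simp)]; simp
      _ ≤ eLpNorm (f - g m) 1 volume := by
          refine eLpNorm_mono fun x => ?_
          by_cases hx : x ∈ D
          · have : g m x = 0 := image_eq_zero_of_notMem_tsupport fun h => hDS hx (hgS m h)
            simp [hx, hfD x hx, this]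
          · simp [hx]
  have h3 : Tendsto (fun m => C * (eLpNorm (gradient (f - g m)) 2 volume *
      volume B ^ (1 / 2 : ℝ))) atTop (𝓝 (C * (0 * volume B ^ (1 / 2 : ℝ)))) := by
    refine ENNReal.Tendsto.const_mul (ENNReal.Tendsto.mul_const hlim (Or.inr ?_)) (Or.inr (by simp))
    exact ENNReal.rpow_ne_top_of_nonneg (by norm_num) hBfin.ne
  rw [zero_mul, mul_zero] at h3
  have h4 : volume D ≤ 0 := ge_of_tendsto' h3 fun m => (h2 m).trans ((hC m).trans (by
    gcongr; exact h1 m))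
  exact (hDo.measure_pos volume hDne).ne' (le_antisymm h4 bot_le)

/-- The transverse mode of a multiply connected cross-section: a nonzero square integrable field
which is divergence free and curl free, with vanishing tangential trace. -/
theorem exists_transverse_mode {S : Set Plane} (hSo : IsOpen S) (hSb : Bornology.IsBounded S)
    (hSl : HasLipschitzBoundary S) (hS : IsPathConnected S) (hS' : ¬ IsSimplyConnected S) :
    ∃ V : Plane → Plane, MemLp V 2 volume ∧ (∀ x ∉ S, V x = 0) ∧ 0 < ∫ x, ‖V x‖ ^ 2 ∧
      (∀ g : Plane → ℝ, ContDiff ℝ ∞ g → HasCompactSupport g → tsupport g ⊆ S →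
        ∫ x, ⟪V x, gradient g x⟫_ℝ = 0) ∧
      ∃ g : ℕ → Plane → ℝ, (∀ m, ContDiff ℝ ∞ (g m) ∧ HasCompactSupport (g m) ∧
        tsupport (gradient (g m)) ⊆ S) ∧
        Tendsto (fun m => eLpNorm (gradient (g m) - V) 2 volume) atTop (𝓝 0) := by
  obtain ⟨f, hf, hf', hloc, p, hpS, hp⟩ := exists_hole_function hSo hSb hS hS'
  obtain ⟨D, hDN, hDo, hDne, hDS⟩ := hSl.exists_isOpen_compl hSo hpS hp
  obtain ⟨F, hF⟩ : ∃ F : Lp Plane 2 (volume : Measure Plane), F =ᵐ[volume] gradient f :=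
    ⟨_, (memLp_gradient hf hf').coeFn_toLp⟩
  set K := (testGradients S).topologicalClosure with hK
  have : CompleteSpace K := (testGradients S).isClosed_topologicalClosure.completeSpace_coe
  -- The mode is z: orthogonality to test gradients says that it is divergence free, and as ∇f minus
  -- a limit of test gradients it is a limit of gradients supported in S, which encodes zero curl
  -- and zero tangential trace.
  obtain ⟨y, hy, z, hz, hyz⟩ := K.exists_add_mem_mem_orthogonal F
  obtain ⟨w, hw, hwy⟩ := mem_closure_iff_seq_limit.1 (show y ∈ closure (testGradients S : Set _) from
    hy)
  choose g hg1 hg2 hg3 hg using hw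
  have hgrad : ∀ m, gradient (f - g m) = gradient f - gradient (g m) := fun m =>
    gradient_sub_fun hf (hg1 m)
  have hlim : Tendsto (fun m => eLpNorm (gradient (f - g m) - (z : Plane → Plane)) 2 volume) atTop (𝓝 0) := by
    have h1 : Tendsto (fun m => F - w m) atTop (𝓝 z) := by
      have := hwy.const_sub F
      rwa [hyz, add_sub_cancel_left, ← hyz] at this
    rw [Lp.tendsto_Lp_iff_tendsto_eLpNorm'] at h1
    refine h1.congr fun m => eLpNorm_congr_ae ?_
    filter_upwards [Lp.coeFn_sub F (w m), hF, hg m] with x a1 a2 a3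
    rw [Pi.sub_apply, Pi.sub_apply, a1, hgrad, Pi.sub_apply, Pi.sub_apply, a2, a3]
  -- f itself need not vanish outside S, but it is locally constant near the complement.
  have hsuppf : tsupport (gradient f) ⊆ S := by
    intro x hx
    by_contra hxS
    have h0 : gradient f =ᶠ[𝓝 x] 0 := by
      rcases hloc x hxS with h | h
      · filter_upwards [h.fderiv (𝕜 := ℝ)] with y hy
        simp [gradient, hy]
      · filter_upwards [h.fderiv (𝕜 := ℝ)] with y hy
        simp [gradient, hy]
    exact notMem_tsupport_iff_eventuallyEq.2 h0 hx
  have hsupp : ∀ m, tsupport (gradient (f - g m)) ⊆ S := fun m => by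
    rw [hgrad]
    exact (tsupport_sub _ _).trans (Set.union_subset hsuppf ((tsupport_gradient_subset _).trans
      (hg3 m)))
  -- The approximating gradients vanish off S, hence so does z almost everywhere; the indicator
  -- below makes this hold everywhere.
  have hz0 : ∀ᵐ x ∂(volume : Measure Plane), x ∈ Sᶜ → z x = 0 := by
    rw [← ae_restrict_iff' hSo.measurableSet.compl]
    have h1 : eLpNorm z 2 (volume.restrict Sᶜ) = 0 := by
      refine le_antisymm (ge_of_tendsto' hlim fun m => ?_) bot_le
      calc eLpNorm z 2 (volume.restrict Sᶜ)
          = eLpNorm (gradient (f - g m) - (z : Plane → Plane)) 2 (volume.restrict Sᶜ) := by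
            refine eLpNorm_congr_norm_ae ?_
            filter_upwards [ae_restrict_mem hSo.measurableSet.compl] with x hx
            have : gradient (f - g m) x = 0 :=
              image_eq_zero_of_notMem_tsupport fun h => hx (hsupp m h)
            simp [this]
        _ ≤ _ := eLpNorm_mono_measure _ Measure.restrict_le_self
    rw [eLpNorm_eq_zero_iff (Lp.aestronglyMeasurable z).restrict (by norm_num)] at h1
    exact h1
  have hVz : S.indicator z =ᵐ[volume] z := by
    filter_upwards [hz0] with x hx
    by_cases hxS : x ∈ S
    · simp [hxS]
    · simp [hxS, hx hxS]
  refine ⟨S.indicator z, (memLp_congr_ae hVz).2 (Lp.memLp z), fun x hx => by simp [hx], ?_, ?_,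
    fun m => f - g m, fun m => ⟨hf.sub (hg1 m), hf'.sub (hg2 m), hsupp m⟩, ?_⟩
  · have hznorm : ∫ x, ‖S.indicator z x‖ ^ 2 = ‖z‖ ^ 2 := by
      rw [← real_inner_self_eq_norm_sq, L2.inner_def]
      refine integral_congr_ae ?_
      filter_upwards [hVz] with x hx
      rw [hx, real_inner_self_eq_norm_sq]
    rw [hznorm]
    have hzne : z ≠ 0 := by
      rintro rfl
      refine not_tendsto_gradient_sub hSb hf hf' hDo hDne hDS (fun x hx => hDN hx) g hg1 hg3 ?_
      refine hlim.congr fun m => eLpNorm_congr_ae ?_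
      filter_upwards [Lp.coeFn_zero Plane 2 (volume : Measure Plane)] with x hx
      rw [Pi.sub_apply, hx, Pi.zero_apply, sub_zero]
    positivity
  · intro h hh1 hh2 hh3
    have hL := memLp_gradient hh1 hh2
    have hmem : hL.toLp _ ∈ K := (testGradients S).le_topologicalClosure
      ⟨h, hh1, hh2, hh3, hL.coeFn_toLp⟩
    rw [← (K.mem_orthogonal' z).1 hz _ hmem, L2.inner_def]
    refine integral_congr_ae ?_
    filter_upwards [hVz, hL.coeFn_toLp] with x a1 a2
    rw [a1, a2]
  · refine hlim.congr fun m => eLpNorm_congr_ae ?_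
    filter_upwards [hVz] with x hx
    simp [hx]

end TransverseMode

/-! ### Fields with real components and weak descriptions of the operator domain -/

section RealFields

variable {Ω : TopologicalSpace.Opens Space}

lemma memLp_realField {w : Fin 3 → Space → ℝ} {μ : Measure Space} (hw : ∀ i, MemLp (w i) 2 μ) :
    MemLp (fun p => (WithLp.toLp 2 fun i => (w i p : ℂ) : CVec)) 2 μ := by
  exact MemLp.of_eval_piLp fun i => Complex.ofRealCLM.comp_memLp' (hw i)

/-- The square integrable field with given real components. -/
def realField (w : Fin 3 → Space → ℝ) (hw : ∀ i, MemLp (w i) 2 (volume.restrict (Ω : Set Space))) :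
    L2Field Ω :=
  (memLp_realField hw).toLp _

lemma coeFn_realField {w : Fin 3 → Space → ℝ}
    (hw : ∀ i, MemLp (w i) 2 (volume.restrict (Ω : Set Space))) :
    ∀ᵐ p ∂(volume.restrict (Ω : Set Space)), ∀ i, realField w hw p i = (w i p : ℂ) := by
  filter_upwards [(memLp_realField hw).coeFn_toLp] with p hp i
  rw [realField, hp]

lemma testIntegral_realField (ψ : Space → ℝ) (i : Fin 3) {w : Fin 3 → Space → ℝ}
    (hw : ∀ i, MemLp (w i) 2 (volume.restrict (Ω : Set Space))) :
    testIntegral ψ i (realField w hw) = ((∫ p in (Ω : Set Space), ψ p * w i p : ℝ) : ℂ) := by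
  rw [testIntegral, ← integral_complex_ofReal]
  refine integral_congr_ae ?_
  filter_upwards [coeFn_realField hw] with p hp
  simp [hp]

lemma integrable_smul_coord {ψ : Space → ℝ} (hψ : MemLp ψ 2 (volume.restrict (Ω : Set Space)))
    (E : L2Field Ω) (i : Fin 3) :
    Integrable (fun p => ψ p • E p i) (volume.restrict (Ω : Set Space)) :=
  memLp_one_iff_integrable.1 ((memLp_coord E i).smul hψ)

lemma inner_realField {w : Fin 3 → Space → ℝ}
    (hw : ∀ i, MemLp (w i) 2 (volume.restrict (Ω : Set Space))) (E : L2Field Ω) :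
    ⟪realField w hw, E⟫_ℂ = ∑ i, testIntegral (w i) i E := by
  simp only [testIntegral]
  rw [L2.inner_def, ← integral_finsetSum _ fun i _ => integrable_smul_coord (hw i) E i]
  refine integral_congr_ae ?_
  filter_upwards [coeFn_realField hw] with p hp
  rw [PiLp.inner_apply]
  refine Finset.sum_congr rfl fun i _ => ?_
  simp [hp, mul_comm]

lemma inner_realField_realField {w v : Fin 3 → Space → ℝ}
    (hw : ∀ i, MemLp (w i) 2 (volume.restrict (Ω : Set Space)))
    (hv : ∀ i, MemLp (v i) 2 (volume.restrict (Ω : Set Space))) :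
    ⟪realField w hw, realField v hv⟫_ℂ =
      ((∑ i, ∫ p in (Ω : Set Space), w i p * v i p : ℝ) : ℂ) := by
  rw [inner_realField]
  simp only [testIntegral_realField]
  push_cast
  rfl

lemma realField_add {w v : Fin 3 → Space → ℝ}
    (hw : ∀ i, MemLp (w i) 2 (volume.restrict (Ω : Set Space)))
    (hv : ∀ i, MemLp (v i) 2 (volume.restrict (Ω : Set Space)))
    (hwv : ∀ i, MemLp (w i + v i) 2 (volume.restrict (Ω : Set Space))) :
    realField (fun i => w i + v i) hwv = realField w hw + realField v hv := by
  apply Lp.ext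
  filter_upwards [coeFn_realField hw, coeFn_realField hv, coeFn_realField hwv,
    Lp.coeFn_add (realField w hw) (realField v hv)] with p h1 h2 h3 h4
  ext i
  rw [h3, h4]
  change ((w i p + v i p : ℝ) : ℂ) = realField w hw p i + realField v hv p i
  rw [h1, h2]
  push_cast
  rfl

lemma realField_smul (c : ℝ) {w : Fin 3 → Space → ℝ}
    (hw : ∀ i, MemLp (w i) 2 (volume.restrict (Ω : Set Space)))
    (hcw : ∀ i, MemLp (c • w i) 2 (volume.restrict (Ω : Set Space))) :
    realField (fun i => c • w i) hcw = (c : ℂ) • realField w hw := by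
  apply Lp.ext
  filter_upwards [coeFn_realField hw, coeFn_realField hcw,
    Lp.coeFn_smul (c : ℂ) (realField w hw)] with p h1 h2 h3
  ext i
  rw [h2, h3]
  change ((c * w i p : ℝ) : ℂ) = c * realField w hw p i
  rw [h1]
  push_cast
  rfl

lemma IsTestFunction.memLp {ψ : Space → ℝ} (h : IsTestFunction Ω ψ) (μ : Measure Space)
    [IsFiniteMeasureOnCompacts μ] : MemLp ψ 2 μ :=
  h.1.continuous.memLp_of_hasCompactSupport h.2.1

lemma IsTestFunction.eq_zero {ψ : Space → ℝ} (h : IsTestFunction Ω ψ) {p : Space} (hp : p ∉ Ω) :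
    ψ p = 0 :=
  image_eq_zero_of_notMem_tsupport fun hc => hp (h.2.2 hc)

lemma IsTestFunction.zero : IsTestFunction Ω (0 : Space → ℝ) :=
  ⟨contDiff_const, HasCompactSupport.zero, by simp⟩

lemma IsTestFunction.neg {ψ : Space → ℝ} (h : IsTestFunction Ω ψ) : IsTestFunction Ω (-ψ) :=
  ⟨h.1.neg, h.2.1.neg, by rw [tsupport_neg]; exact h.2.2⟩

lemma IsTestFunction.add {ψ φ : Space → ℝ} (h : IsTestFunction Ω ψ) (h' : IsTestFunction Ω φ) :
    IsTestFunction Ω (ψ + φ) :=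
  ⟨h.1.add h'.1, h.2.1.add h'.2.1, (tsupport_add ψ φ).trans (Set.union_subset h.2.2 h'.2.2)⟩

lemma IsTestFunction.sub {ψ φ : Space → ℝ} (h : IsTestFunction Ω ψ) (h' : IsTestFunction Ω φ) :
    IsTestFunction Ω (ψ - φ) := sub_eq_add_neg ψ φ ▸ h.add h'.neg

lemma pderiv_zero (i : Fin 3) : pderiv i (0 : Space → ℝ) = 0 := by
  funext p
  simp [pderiv]

/-- Integration by parts against a test function. -/
lemma IsTestFunction.integral_mul_pderiv {φ ψ : Space → ℝ} (hφ : IsTestFunction Ω φ)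
    (hψ : ContDiff ℝ ∞ ψ) (j : Fin 3) :
    ∫ p in (Ω : Set Space), φ p * Maxwell.pderiv j ψ p =
      -∫ p in (Ω : Set Space), Maxwell.pderiv j φ p * ψ p := by
  rw [setIntegral_eq_integral_of_forall_compl_eq_zero fun p hp => by rw [hφ.eq_zero hp, zero_mul],
    setIntegral_eq_integral_of_forall_compl_eq_zero
      fun p hp => by rw [(hφ.pderiv j).eq_zero hp, zero_mul]]
  have hψ' : Continuous (Maxwell.pderiv j ψ) := by
    have := hψ.continuous_fderiv (by simp)
    unfold Maxwell.pderiv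
    fun_prop
  refine integral_mul_fderiv_eq_neg_fderiv_mul_of_integrable ?_ ?_ ?_
    (fun p _ => hφ.1.differentiable (by simp) p) (fun p _ => hψ.differentiable (by simp) p)
  · exact ((hφ.pderiv j).1.continuous.mul hψ.continuous).integrable_of_hasCompactSupport
      (hφ.pderiv j).2.1.mul_right
  · exact (hφ.1.continuous.mul hψ').integrable_of_hasCompactSupport hφ.2.1.mul_right
  · exact (hφ.1.continuous.mul hψ.continuous).integrable_of_hasCompactSupport hφ.2.1.mul_right

lemma integrable_test_mul {ψ f : Space → ℝ} (hψ : MemLp ψ 2 (volume.restrict (Ω : Set Space)))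
    (hf : MemLp f 2 (volume.restrict (Ω : Set Space))) :
    Integrable (fun p => ψ p * f p) (volume.restrict (Ω : Set Space)) :=
  memLp_one_iff_integrable.1 (hf.mul' hψ)

lemma realField_mem_weakCurlGraph_iff {w c : Fin 3 → Space → ℝ}
    (hw : ∀ i, MemLp (w i) 2 (volume.restrict (Ω : Set Space)))
    (hc : ∀ i, MemLp (c i) 2 (volume.restrict (Ω : Set Space))) :
    (realField w hw, realField c hc) ∈ weakCurlGraph Ω ↔
      ∀ ψ : Space → ℝ, IsTestFunction Ω ψ → ∀ i : Fin 3, ∫ p in (Ω : Set Space), ψ p * c i p =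
        ∫ p in (Ω : Set Space), pderiv (i + 2) ψ p * w (i + 1) p -
          pderiv (i + 1) ψ p * w (i + 2) p := by
  refine forall₂_congr fun ψ hψ => forall_congr' fun i => ?_
  rw [testIntegral_realField, testIntegral_realField, testIntegral_realField,
    integral_sub (integrable_test_mul ((hψ.pderiv _).memLp _) (hw _))
      (integrable_test_mul ((hψ.pderiv _).memLp _) (hw _))]
  norm_cast

/-- The weak curl of a test field is its classical curl. -/
lemma testField_mem_weakCurlGraph {w : Fin 3 → Space → ℝ} (hw : ∀ i, IsTestFunction Ω (w i)) :
    (realField w fun i => (hw i).memLp _, realField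
      (fun i => pderiv (i + 1) (w (i + 2)) - pderiv (i + 2) (w (i + 1)))
        fun _ => (((hw _).pderiv _).sub ((hw _).pderiv _)).memLp _) ∈ weakCurlGraph Ω := by
  rw [realField_mem_weakCurlGraph_iff]
  intro ψ hψ i
  have h1 := hψ.integral_mul_pderiv (hw (i + 2)).1 (i + 1)
  have h2 := hψ.integral_mul_pderiv (hw (i + 1)).1 (i + 2)
  have i0 := fun (j k : Fin 3) => integrable_test_mul (hψ.memLp (volume.restrict (Ω : Set Space)))
    (((hw j).pderiv k).memLp _)
  have i1 := fun (j k : Fin 3) => integrable_test_mul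
    ((hψ.pderiv k).memLp (volume.restrict (Ω : Set Space))) ((hw j).memLp _)
  simp only [Pi.sub_apply, mul_sub]
  rw [integral_sub (i0 _ _) (i0 _ _), integral_sub (i1 _ _) (i1 _ _), h1, h2]
  ring

lemma testIntegral_zero_left (i : Fin 3) (E : L2Field Ω) : testIntegral (0 : Space → ℝ) i E = 0 := by
  simp [testIntegral]

lemma testIntegral_neg_left (ψ : Space → ℝ) (i : Fin 3) (E : L2Field Ω) :
    testIntegral (-ψ) i E = -testIntegral ψ i E := by
  simp [testIntegral, integral_neg]

lemma mem_domain_of_mem_graph {E C : L2Field Ω} (hg : (E, C) ∈ weakCurlGraph Ω) :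
    ∃ hE : E ∈ (curl Ω).domain, curl Ω ⟨E, hE⟩ = C := by
  have hdom : E ∈ (curl Ω).domain := by
    rw [LinearPMap.mem_domain_iff]
    exact ⟨C, by rw [graph_curl]; exact hg⟩
  have h1 := curl_mem_graph ⟨E, hdom⟩
  have h2 := weakCurlGraph_unique _ (sub_mem h1 hg) (sub_self _)
  exact ⟨hdom, sub_eq_zero.1 h2⟩

/-- A pair of fields which satisfies Green's formula against all of `H(curl; Ω)` consists of an
element of `H_N(curl)` and its curl. -/
lemma mem_HN_of_forall_inner {E C : L2Field Ω}
    (h : ∀ P ∈ weakCurlGraph Ω, ⟪P.2, E⟫_ℂ = ⟪P.1, C⟫_ℂ) :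
    (E, C) ∈ weakCurlGraph Ω ∧ E ∈ HN Ω := by
  have hg : (E, C) ∈ weakCurlGraph Ω := by
    intro ψ hψ i
    -- Green's formula against the smooth field ψ e_i is exactly the distributional identity for the
    -- i-th component of the curl.
    have hw : ∀ k, IsTestFunction Ω ((Pi.single i ψ : Fin 3 → Space → ℝ) k) := by
      intro k
      by_cases hk : k = i
      · subst hk; simpa using hψ
      · simpa [hk] using IsTestFunction.zero
    have h1 := h _ (testField_mem_weakCurlGraph hw)
    have h2 : ∑ k, testIntegral ((Pi.single i ψ : Fin 3 → Space → ℝ) k) k C =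
        testIntegral ψ i C := by
      rw [Finset.sum_eq_single i]
      · rw [Pi.single_eq_same]
      · intro k _ hk
        rw [Pi.single_eq_of_ne hk, testIntegral_zero_left]
      · simp
    rw [inner_realField, inner_realField, h2] at h1
    rw [← h1, Fin.sum_univ_three]
    fin_cases i <;> simp [pderiv_zero, testIntegral_neg_left, testIntegral_zero_left] <;> ring
  obtain ⟨hdom, hC⟩ := mem_domain_of_mem_graph hg
  exact ⟨hg, hdom, fun Φ => by rw [hC]; exact h _ (curl_mem_graph Φ)⟩

/-- Membership in the domain of the electric operator, in terms of the weak curl. -/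
lemma mem_domain_electricOperator {E C D : L2Field Ω} (hE : E ∈ HDivZero Ω)
    (h : ∀ P ∈ weakCurlGraph Ω, ⟪P.2, E⟫_ℂ = ⟪P.1, C⟫_ℂ) (hC : (C, D) ∈ weakCurlGraph Ω) :
    ∃ u : (electricOperator Ω).domain, ((u : HDivZero Ω) : L2Field Ω) = E ∧
      (electricOperator Ω u : L2Field Ω) = D := by
  obtain ⟨hg, hN⟩ := mem_HN_of_forall_inner h
  obtain ⟨h1, rfl⟩ := mem_domain_of_mem_graph hg
  obtain ⟨h2, rfl⟩ := mem_domain_of_mem_graph hC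
  exact ⟨⟨⟨E, hE⟩, hN, h1, h2⟩, rfl, rfl⟩

/-- Conversely, an element of the domain comes with its curl and its double curl. -/
lemma exists_curl_of_mem_domain (u : (electricOperator Ω).domain) :
    ∃ C : L2Field Ω, (∀ P ∈ weakCurlGraph Ω, ⟪P.2, ((u : HDivZero Ω) : L2Field Ω)⟫_ℂ = ⟪P.1, C⟫_ℂ) ∧
      (((u : HDivZero Ω) : L2Field Ω), C) ∈ weakCurlGraph Ω ∧
      (C, (electricOperator Ω u : L2Field Ω)) ∈ weakCurlGraph Ω := by
  obtain ⟨E, ⟨hE, hN⟩, h1, h2⟩ := u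
  refine ⟨curl Ω ⟨E, h1⟩, fun P hP => ?_, curl_mem_graph ⟨E.1, h1⟩, curl_mem_graph ⟨_, h2⟩⟩
  obtain ⟨h3, h4⟩ := mem_domain_of_mem_graph (E := P.1) (C := P.2) hP
  rw [← h4]
  exact hN ⟨P.1, h3⟩

end RealFields

/-! ### Spectra of operators with nonnegative form -/

section Nonnegative

variable {H : Type*} [NormedAddCommGroup H] [InnerProductSpace ℂ H]

/-- The quadratic form of an unbounded operator is real and nonnegative. -/
def HasNonnegForm (T : H →ₗ.[ℂ] H) : Prop :=
  ∀ u : T.domain, ∃ t : ℝ, 0 ≤ t ∧ ⟪T u, (u : H)⟫_ℂ = (t : ℂ)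

/-- Along a Weyl sequence of unit vectors, ⟨T u_n, u_n⟩ is a nonnegative real number within ‖(T - μ)
u_n‖ of the conjugate of μ, and the half-line is closed. The conjugate appears because the inner
product is conjugate linear in its first argument. -/
lemma HasNonnegForm.essentialSpectrum_subset {T : H →ₗ.[ℂ] H} (hT : HasNonnegForm T) :
    essentialSpectrum T ⊆ (fun t : ℝ => (t : ℂ)) '' Set.Ici 0 := by
  rintro μ ⟨u, hu1, -, hu⟩
  choose t ht0 ht using fun n => hT (u n)
  have hlim : Tendsto (fun n => ((t n : ℝ) : ℂ)) atTop (𝓝 ((starRingEnd ℂ) μ)) := by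
    rw [tendsto_iff_norm_sub_tendsto_zero]
    refine squeeze_zero (fun _ => norm_nonneg _) (fun n => ?_) (tendsto_zero_iff_norm_tendsto_zero.1 hu)
    have h1 : ((t n : ℝ) : ℂ) - (starRingEnd ℂ) μ = ⟪T (u n) - μ • (u n : H), (u n : H)⟫_ℂ := by
      rw [inner_sub_left, ht, inner_smul_left, inner_self_eq_norm_sq_to_K, hu1]
      simp
    rw [h1]
    refine (norm_inner_le_norm _ _).trans ?_
    rw [hu1, mul_one]
  obtain ⟨s, hs, hs'⟩ := (Complex.isometry_ofReal.isClosedEmbedding.isClosedMap _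
    isClosed_Ici).mem_of_tendsto hlim (Eventually.of_forall fun n => ⟨t n, ht0 n, rfl⟩)
  refine ⟨s, hs, ?_⟩
  simpa using congrArg (starRingEnd ℂ) hs'

/-- An eigenvalue is the Rayleigh quotient of its eigenvector. -/
lemma HasNonnegForm.pointSpectrum_subset {T : H →ₗ.[ℂ] H} (hT : HasNonnegForm T) :
    pointSpectrum T ⊆ (fun t : ℝ => (t : ℂ)) '' Set.Ici 0 := by
  rintro μ ⟨u, hu0, hu⟩
  obtain ⟨t, ht0, ht⟩ := hT u
  rw [hu, inner_smul_left, inner_self_eq_norm_sq_to_K] at ht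
  have hn : (0 : ℝ) < ‖(u : H)‖ ^ 2 := by positivity
  refine ⟨t / ‖(u : H)‖ ^ 2, div_nonneg ht0 hn.le, ?_⟩
  have h1 : ((starRingEnd ℂ) μ) = ((t / ‖(u : H)‖ ^ 2 : ℝ) : ℂ) := by
    push_cast
    rw [eq_div_iff (by exact_mod_cast hn.ne'), ← ht]
    simp
  simpa using (congrArg (starRingEnd ℂ) h1).symm

/-- The electric operator is nonnegative: `⟨A E, E⟩ = ‖curl E‖²`. -/
lemma hasNonnegForm_electricOperator (Ω : TopologicalSpace.Opens Space) :
    HasNonnegForm (electricOperator Ω) := by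
  intro u
  obtain ⟨C, h, -, hC⟩ := exists_curl_of_mem_domain u
  refine ⟨‖C‖ ^ 2, by positivity, ?_⟩
  rw [Submodule.coe_inner, h _ hC, inner_self_eq_norm_sq_to_K]
  simp

end Nonnegative

/-! ### Products of axial and transverse functions -/

section Tensor

/-- The projection `(x, y, z) ↦ (x, y)`. -/
def planeProj : Space →L[ℝ] Plane :=
  LinearMap.toContinuousLinearMap
    { toFun := fun p => !₂[p 0, p 1]
      map_add' := fun p q => by ext k; fin_cases k <;> simp
      map_smul' := fun c p => by ext k; fin_cases k <;> simp }

/-- The inclusion `(x, y) ↦ (x, y, 0)`. -/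
def planeIncl : Plane →L[ℝ] Space :=
  LinearMap.toContinuousLinearMap
    { toFun := fun x => !₂[x 0, x 1, 0]
      map_add' := fun p q => by ext k; fin_cases k <;> simp
      map_smul' := fun c p => by ext k; fin_cases k <;> simp }

/-- The unit vector of the axis of the wave guide. -/
def axis : Space := EuclideanSpace.single 2 1

@[simp] lemma planeProj_zero (p : Space) : planeProj p 0 = p 0 := rfl
@[simp] lemma planeProj_one (p : Space) : planeProj p 1 = p 1 := rfl
lemma planeProj_eq (p : Space) : planeProj p = !₂[p 0, p 1] := rfl
@[simp] lemma planeIncl_zero (x : Plane) : planeIncl x 0 = x 0 := rfl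
@[simp] lemma planeIncl_one (x : Plane) : planeIncl x 1 = x 1 := rfl
@[simp] lemma planeIncl_two (x : Plane) : planeIncl x 2 = 0 := rfl
@[simp] lemma axis_zero : axis 0 = 0 := by simp [axis]
@[simp] lemma axis_one : axis 1 = 0 := by simp [axis]
@[simp] lemma axis_two : axis 2 = 1 := by simp [axis]

/-- The splitting of space into the plane of the cross-section and the axis. -/
def splitEquiv : Space ≃ᵐ Plane × ℝ where
  toFun p := (planeProj p, p 2)
  invFun q := planeIncl q.1 + q.2 • axis
  left_inv p := by ext k; fin_cases k <;> simp
  right_inv q := by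
    refine Prod.ext ?_ (by simp)
    ext k; fin_cases k <;> simp
  measurable_toFun := Continuous.measurable (by simp only [Equiv.coe_fn_mk]; fun_prop)
  measurable_invFun := Continuous.measurable (by simp only [Equiv.coe_fn_symm_mk]; fun_prop)

lemma splitEquiv_apply (p : Space) : splitEquiv p = (planeProj p, p 2) := rfl

lemma measurePreserving_splitEquiv : MeasurePreserving splitEquiv volume volume := by
  have h1 := PiLp.volume_preserving_ofLp (Fin 3)
  have h2 := volume_preserving_piFinSuccAbove (fun _ : Fin 3 => ℝ) 2
  have h3 : MeasurePreserving (Prod.swap : ℝ × (Fin 2 → ℝ) → (Fin 2 → ℝ) × ℝ) volume volume :=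
    Measure.measurePreserving_swap
  have h4 : MeasurePreserving (Prod.map (WithLp.toLp 2) id : (Fin 2 → ℝ) × ℝ → Plane × ℝ)
      volume volume := (PiLp.volume_preserving_toLp (Fin 2)).prod (MeasurePreserving.id volume)
  have e : (splitEquiv : Space → Plane × ℝ) = Prod.map (WithLp.toLp 2) id ∘ Prod.swap ∘
      MeasurableEquiv.piFinSuccAbove (fun _ : Fin 3 => ℝ) 2 ∘ WithLp.ofLp := by
    funext p
    refine Prod.ext ?_ rfl
    ext k
    fin_cases k <;> rfl
  rw [e]
  exact h4.comp (h3.comp (h2.comp h1))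

lemma integral_eq_integral_split (F : Space → ℝ) :
    ∫ p, F p = ∫ q : Plane × ℝ, F (planeIncl q.1 + q.2 • axis) :=
  ((measurePreserving_splitEquiv.symm _).integral_comp' F).symm

lemma integrable_split {F : Space → ℝ} (hF : Integrable F) :
    Integrable (fun q : Plane × ℝ => F (planeIncl q.1 + q.2 • axis)) (volume.prod volume) :=
  (measurePreserving_splitEquiv.symm _).integrable_comp_of_integrable hF

/-- The function `(x, y, z) ↦ a z * v (x, y)`. -/
def tensor (a : ℝ → ℝ) (v : Plane → ℝ) (p : Space) : ℝ := a (p 2) * v (planeProj p)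

lemma tensor_split (a : ℝ → ℝ) (v : Plane → ℝ) (x : Plane) (z : ℝ) :
    tensor a v (planeIncl x + z • axis) = a z * v x := by
  have h : planeProj (planeIncl x + z • axis) = x := by ext k; fin_cases k <;> simp
  simp [tensor, h]

lemma tensor_mul_tensor (a b : ℝ → ℝ) (v w : Plane → ℝ) (p : Space) :
    tensor a v p * tensor b w p = tensor (a * b) (v * w) p := by
  simp only [tensor, Pi.mul_apply]; ring

lemma tensor_add_left (a b : ℝ → ℝ) (v : Plane → ℝ) :
    tensor (a + b) v = tensor a v + tensor b v := by
  funext p; simp [tensor, add_mul]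

lemma tensor_smul_left (c : ℝ) (a : ℝ → ℝ) (v : Plane → ℝ) :
    tensor (c • a) v = c • tensor a v := by
  funext p; simp [tensor, mul_assoc]

lemma tensor_sub_right (a : ℝ → ℝ) (v w : Plane → ℝ) :
    tensor a (v - w) = tensor a v - tensor a w := by
  funext p; simp [tensor, mul_sub]

lemma integral_tensor (a : ℝ → ℝ) (v : Plane → ℝ) :
    ∫ p, tensor a v p = (∫ z, a z) * ∫ x, v x := by
  rw [integral_eq_integral_split]
  simp only [tensor_split]
  rw [mul_comm, ← integral_prod_mul]
  exact integral_congr_ae (Eventually.of_forall fun q => mul_comm _ _)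

lemma memLp_tensor {a : ℝ → ℝ} {v : Plane → ℝ} (ha : MemLp a 2) (hv : MemLp v 2) :
    MemLp (tensor a v) 2 := by
  have h : MemLp (fun q : Plane × ℝ => v q.1 * a q.2) 2 (volume.prod volume) := by
    have hm : AEStronglyMeasurable (fun q : Plane × ℝ => v q.1 * a q.2) (volume.prod volume) :=
      hv.1.comp_fst.mul ha.1.comp_snd
    rw [memLp_two_iff_integrable_sq hm]
    simp only [mul_pow]
    exact ((memLp_two_iff_integrable_sq hv.1).1 hv).mul_prod ((memLp_two_iff_integrable_sq ha.1).1 ha)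
  refine (h.comp_measurePreserving measurePreserving_splitEquiv).ae_eq (Eventually.of_forall fun p => ?_)
  simp [tensor, splitEquiv_apply, mul_comm]

lemma contDiff_tensor {a : ℝ → ℝ} {v : Plane → ℝ} (ha : ContDiff ℝ ∞ a) (hv : ContDiff ℝ ∞ v) :
    ContDiff ℝ ∞ (tensor a v) :=
  (ha.comp (contDiff_euclidean.1 contDiff_id 2)).mul (hv.comp planeProj.contDiff)

lemma hasFDerivAt_tensor {a : ℝ → ℝ} {v : Plane → ℝ} (ha : ContDiff ℝ ∞ a) (hv : ContDiff ℝ ∞ v)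
    (p : Space) : HasFDerivAt (tensor a v)
      (a (p 2) • (fderiv ℝ v (planeProj p) ∘L planeProj) +
        v (planeProj p) • (deriv a (p 2) • (EuclideanSpace.proj 2 : Space →L[ℝ] ℝ))) p := by
  have h1 : HasFDerivAt (fun p : Space => a (p 2))
      (deriv a (p 2) • (EuclideanSpace.proj 2 : Space →L[ℝ] ℝ)) p :=
    ((ha.differentiable (by simp) (p 2)).hasDerivAt).comp_hasFDerivAt p
      (EuclideanSpace.proj 2 : Space →L[ℝ] ℝ).hasFDerivAt
  have h2 : HasFDerivAt (fun p : Space => v (planeProj p)) (fderiv ℝ v (planeProj p) ∘L planeProj) p :=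
    (hv.differentiable (by simp) (planeProj p)).hasFDerivAt.comp p planeProj.hasFDerivAt
  exact h1.mul h2

lemma planeProj_single_castSucc (k : Fin 2) :
    planeProj (EuclideanSpace.single k.castSucc (1 : ℝ)) = EuclideanSpace.single k 1 := by
  ext j; fin_cases k <;> fin_cases j <;> simp [planeProj_eq]

lemma planeIncl_single (k : Fin 2) :
    planeIncl (EuclideanSpace.single k (1 : ℝ)) = EuclideanSpace.single k.castSucc 1 := by
  ext j; fin_cases k <;> fin_cases j <;> simp [planeIncl]

lemma pderiv_castSucc_tensor {a : ℝ → ℝ} {v : Plane → ℝ} (ha : ContDiff ℝ ∞ a)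
    (hv : ContDiff ℝ ∞ v) (k : Fin 2) :
    pderiv k.castSucc (tensor a v) = tensor a fun x => gradient v x k := by
  funext p
  rw [pderiv, (hasFDerivAt_tensor ha hv p).fderiv]
  simp only [tensor, gradient_apply, ← planeProj_single_castSucc]
  fin_cases k <;> simp

lemma pderiv_two_tensor {a : ℝ → ℝ} {v : Plane → ℝ} (ha : ContDiff ℝ ∞ a)
    (hv : ContDiff ℝ ∞ v) : pderiv 2 (tensor a v) = tensor (deriv a) v := by
  funext p
  rw [pderiv, (hasFDerivAt_tensor ha hv p).fderiv]
  have h : planeProj (EuclideanSpace.single 2 (1 : ℝ)) = 0 := by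
    ext j; fin_cases j <;> simp [planeProj_eq]
  simp [tensor, h, mul_comm]

end Tensor

/-! ### Continuity of test integrals in L² -/

section TestIntegral

variable {Ω : TopologicalSpace.Opens Space}

/-- Cauchy–Schwarz: the test integral is the inner product with the field ψ e_i. -/
lemma norm_testIntegral_le {ψ : Space → ℝ} (hψ : MemLp ψ 2 (volume.restrict (Ω : Set Space)))
    (i : Fin 3) (E : L2Field Ω) :
    ‖testIntegral ψ i E‖ ≤ √(∫ p in (Ω : Set Space), ψ p ^ 2) * ‖E‖ := by
  have hw : ∀ k, MemLp ((Pi.single i ψ : Fin 3 → Space → ℝ) k) 2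
      (volume.restrict (Ω : Set Space)) := by
    intro k
    by_cases hk : k = i
    · subst hk; simpa using hψ
    · simp [hk]
  have h1 : ⟪realField _ hw, E⟫_ℂ = testIntegral ψ i E := by
    rw [inner_realField, Finset.sum_eq_single i]
    · rw [Pi.single_eq_same]
    · intro k _ hk
      rw [Pi.single_eq_of_ne hk, testIntegral_zero_left]
    · simp
  have h2 : ‖realField _ hw‖ ^ 2 = ∫ p in (Ω : Set Space), ψ p ^ 2 := by
    have h3 := inner_realField_realField hw hw
    rw [Finset.sum_eq_single i, inner_self_eq_norm_sq_to_K] at h3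
    · simp only [Pi.single_eq_same, ← sq] at h3
      apply Complex.ofReal_injective
      rw [← h3]
      simp
    · intro k _ hk
      simp [Pi.single_eq_of_ne hk]
    · simp
  rw [← h1, ← h2, Real.sqrt_sq (norm_nonneg _)]
  exact norm_inner_le_norm _ _

lemma testIntegral_sub_left {ψ φ : Space → ℝ} (hψ : MemLp ψ 2 (volume.restrict (Ω : Set Space)))
    (hφ : MemLp φ 2 (volume.restrict (Ω : Set Space))) (i : Fin 3) (E : L2Field Ω) :
    testIntegral (ψ - φ) i E = testIntegral ψ i E - testIntegral φ i E := by
  simp only [testIntegral]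
  rw [← integral_sub (integrable_smul_coord hψ E i) (integrable_smul_coord hφ E i)]
  simp [sub_mul]

/-- Lets identities proved for the smooth gradients ∇g_m pass to their L² limit V. -/
lemma tendsto_testIntegral_tensor {a : ℝ → ℝ} (ha : MemLp a 2) {v : Plane → ℝ} (hv : MemLp v 2)
    {w : ℕ → Plane → ℝ} (hw : ∀ m, MemLp (w m) 2)
    (hlim : Tendsto (fun m => ∫ x, (w m x - v x) ^ 2) atTop (𝓝 0)) (i : Fin 3) (E : L2Field Ω) :
    Tendsto (fun m => testIntegral (tensor a (w m)) i E) atTop (𝓝 (testIntegral (tensor a v) i E)) := by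
  rw [tendsto_iff_norm_sub_tendsto_zero]
  have hbound : ∀ m, ‖testIntegral (tensor a (w m)) i E - testIntegral (tensor a v) i E‖ ≤
      √((∫ z, a z ^ 2) * ∫ x, (w m x - v x) ^ 2) * ‖E‖ := by
    intro m
    have hm := memLp_tensor ha ((hw m).sub hv)
    rw [← testIntegral_sub_left ((memLp_tensor ha (hw m)).restrict _)
      ((memLp_tensor ha hv).restrict _),
      ← tensor_sub_right]
    refine (norm_testIntegral_le (hm.restrict _) i E).trans ?_
    gcongr
    calc ∫ p in (Ω : Set Space), tensor a (w m - v) p ^ 2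
        ≤ ∫ p, tensor a (w m - v) p ^ 2 :=
          setIntegral_le_integral ((memLp_two_iff_integrable_sq hm.1).1 hm)
            (Eventually.of_forall fun p => sq_nonneg _)
      _ = _ := by
          simp only [sq, tensor_mul_tensor]
          rw [integral_tensor]
          rfl
  refine squeeze_zero (fun _ => norm_nonneg _) hbound ?_
  have : Tendsto (fun m => √((∫ z, a z ^ 2) * ∫ x, (w m x - v x) ^ 2) * ‖E‖) atTop
      (𝓝 (√((∫ z, a z ^ 2) * 0) * ‖E‖)) :=
    ((Real.continuous_sqrt.tendsto _).comp (hlim.const_mul _)).mul_const _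
  simpa using this

end TestIntegral

/-! ### Guided modes a(z)(V, 0) and their curls -/

section GuidedModes

/-- A smooth function with compact support in `(0, ∞)`. -/
structure IsAxialProfile (a : ℝ → ℝ) : Prop where
  contDiff : ContDiff ℝ ∞ a
  hasCompactSupport : HasCompactSupport a
  tsupport_subset : tsupport a ⊆ Set.Ioi 0

namespace IsAxialProfile

variable {a b : ℝ → ℝ}

lemma deriv (ha : IsAxialProfile a) : IsAxialProfile (deriv a) where
  contDiff := ((contDiff_infty_iff_deriv (𝕜 := ℝ)).1 ha.contDiff).2
  hasCompactSupport := ha.hasCompactSupport.deriv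
  tsupport_subset := (closure_minimal support_deriv_subset (isClosed_tsupport a)).trans
    ha.tsupport_subset

lemma add (ha : IsAxialProfile a) (hb : IsAxialProfile b) : IsAxialProfile (a + b) where
  contDiff := ha.contDiff.add hb.contDiff
  hasCompactSupport := ha.hasCompactSupport.add hb.hasCompactSupport
  tsupport_subset := (tsupport_add a b).trans (Set.union_subset ha.tsupport_subset hb.tsupport_subset)

lemma smul (c : ℝ) (ha : IsAxialProfile a) : IsAxialProfile (c • a) where
  contDiff := ha.contDiff.const_smul c
  hasCompactSupport := HasCompactSupport.smul_left (f := fun _ => c) ha.hasCompactSupport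
  tsupport_subset := (tsupport_smul_subset_right (fun _ => c) a).trans ha.tsupport_subset

lemma memLp (ha : IsAxialProfile a) : MemLp a 2 :=
  ha.contDiff.continuous.memLp_of_hasCompactSupport ha.hasCompactSupport

lemma eq_zero (ha : IsAxialProfile a) {z : ℝ} (hz : z ≤ 0) : a z = 0 :=
  image_eq_zero_of_notMem_tsupport fun h => not_lt.2 hz (ha.tsupport_subset h)

end IsAxialProfile

section GuidedMode

variable {Ω : TopologicalSpace.Opens Space} {S : Set Plane} {a b : ℝ → ℝ} {v : Plane → ℝ}

lemma tensor_eq_zero (hcyl : ∀ p : Space, 0 < p 2 → (p ∈ Ω ↔ planeProj p ∈ S))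
    (ha : IsAxialProfile a) (hv : ∀ x ∉ S, v x = 0) {p : Space} (hp : p ∉ Ω) : tensor a v p = 0 := by
  rw [tensor]
  rcases le_or_gt (p 2) 0 with h | h
  · rw [ha.eq_zero h, zero_mul]
  · rw [hv _ ((hcyl p h).not.1 hp), mul_zero]

/-- Since a is supported in (0, ∞), the product lives in the cylindrical part, and the shape of the
resonator plays no role. -/
lemma isTestFunction_tensor (hcyl : ∀ p : Space, 0 < p 2 → (p ∈ Ω ↔ planeProj p ∈ S))
    (ha : IsAxialProfile a) (hv : ContDiff ℝ ∞ v) (hv' : HasCompactSupport v)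
    (hvS : tsupport v ⊆ S) : IsTestFunction Ω (tensor a v) := by
  have hc2 : Continuous fun p : Space => p 2 := by fun_prop
  have hclosed : IsClosed {p : Space | p 2 ∈ tsupport a ∧ planeProj p ∈ tsupport v} :=
    ((isClosed_tsupport a).preimage hc2).inter ((isClosed_tsupport v).preimage planeProj.continuous)
  have hsub : tsupport (tensor a v) ⊆ {p : Space | p 2 ∈ tsupport a ∧ planeProj p ∈ tsupport v} := by
    refine closure_minimal (fun p hp => ⟨?_, ?_⟩) hclosed
    · exact subset_tsupport _ (left_ne_zero_of_mul hp)
    · exact subset_tsupport _ (right_ne_zero_of_mul hp)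
  refine ⟨contDiff_tensor ha.contDiff hv, ?_, fun p hp => ?_⟩
  · have hK : IsCompact ((fun q : Plane × ℝ => planeIncl q.1 + q.2 • axis) ''
        (tsupport v ×ˢ tsupport a)) :=
      (hv'.isCompact.prod ha.hasCompactSupport.isCompact).image (by fun_prop)
    refine hK.of_isClosed_subset (isClosed_tsupport _) (hsub.trans ?_)
    rintro p ⟨h1, h2⟩
    exact ⟨(planeProj p, p 2), ⟨h2, h1⟩, splitEquiv.symm_apply_apply p⟩
  · obtain ⟨h1, h2⟩ := hsub hp
    exact (hcyl p (ha.tsupport_subset h1)).2 (hvS h2)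

/-- The restriction of a test function of the wave guide to a cross-section. -/
lemma slice_test (hcyl : ∀ p : Space, 0 < p 2 → (p ∈ Ω ↔ planeProj p ∈ S)) {ψ : Space → ℝ}
    (hψ : IsTestFunction Ω ψ) {z : ℝ} (hz : 0 < z) :
    ContDiff ℝ ∞ (fun x : Plane => ψ (planeIncl x + z • axis)) ∧
      HasCompactSupport (fun x : Plane => ψ (planeIncl x + z • axis)) ∧
      tsupport (fun x : Plane => ψ (planeIncl x + z • axis)) ⊆ S := by
  have hc : Continuous fun x : Plane => planeIncl x + z • axis := by fun_prop
  have hproj : ∀ x : Plane, planeProj (planeIncl x + z • axis) = x := by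
    intro x; ext k; fin_cases k <;> simp
  have hsub : tsupport (fun x : Plane => ψ (planeIncl x + z • axis)) ⊆
      (fun x : Plane => planeIncl x + z • axis) ⁻¹' tsupport ψ :=
    closure_minimal (fun x hx => subset_tsupport ψ hx) ((isClosed_tsupport ψ).preimage hc)
  refine ⟨hψ.1.comp (planeIncl.contDiff.add contDiff_const), ?_, fun x hx => ?_⟩
  · refine (hψ.2.1.isCompact.image planeProj.continuous).of_isClosed_subset (isClosed_tsupport _)
      fun x hx => ⟨_, hsub hx, hproj x⟩
  · have h := hψ.2.2 (hsub hx)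
    have := (hcyl _ (by simpa using hz)).1 h
    rwa [hproj] at this

lemma gradient_slice {ψ : Space → ℝ} (hψ : ContDiff ℝ ∞ ψ) (z : ℝ) (x : Plane) (k : Fin 2) :
    gradient (fun x : Plane => ψ (planeIncl x + z • axis)) x k =
      pderiv k.castSucc ψ (planeIncl x + z • axis) := by
  have h1 : HasFDerivAt (fun x : Plane => planeIncl x + z • axis) planeIncl x :=
    planeIncl.hasFDerivAt.add_const _
  have h2 := (hψ.differentiable (by simp) (planeIncl x + z • axis)).hasFDerivAt.comp x h1
  rw [gradient_apply, pderiv, ← planeIncl_single]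
  exact congrArg (fun L : Plane →L[ℝ] ℝ => L (EuclideanSpace.single k 1)) h2.fderiv

/-- The guided mode is divergence free. -/
lemma integral_div_tensor (hcyl : ∀ p : Space, 0 < p 2 → (p ∈ Ω ↔ planeProj p ∈ S))
    (ha : IsAxialProfile a) {V : Plane → Plane} (hV : MemLp V 2)
    (hdiv : ∀ g : Plane → ℝ, ContDiff ℝ ∞ g → HasCompactSupport g → tsupport g ⊆ S →
        ∫ x, ⟪V x, gradient g x⟫_ℝ = 0) {ψ : Space → ℝ} (hψ : IsTestFunction Ω ψ) :
    ∫ p in (Ω : Set Space), (pderiv 0 ψ p * tensor a (fun x => V x 0) p +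
      pderiv 1 ψ p * tensor a (fun x => V x 1) p) = 0 := by
  have hVk : ∀ k : Fin 2, MemLp (fun x => V x k) 2 := fun k => hV.eval_piLp k
  have hint : ∀ (j : Fin 3) (k : Fin 2),
      Integrable (fun p => pderiv j ψ p * tensor a (fun x => V x k) p) := fun j k =>
    memLp_one_iff_integrable.1 ((memLp_tensor ha.memLp (hVk k)).mul' ((hψ.pderiv j).memLp _))
  rw [setIntegral_eq_integral_of_forall_compl_eq_zero fun p hp => by
    rw [(hψ.pderiv 0).eq_zero hp, (hψ.pderiv 1).eq_zero hp, zero_mul, zero_mul, add_zero],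
    integral_eq_integral_split]
  have hint' := integrable_split ((hint 0 0).add (hint 1 1))
  simp only [Pi.add_apply] at hint'
  -- The plane is integrated first: at fixed z > 0 the slice of ψ is a test function of S, and for z
  -- ≤ 0 the factor a z vanishes.
  rw [Measure.volume_eq_prod, integral_prod_symm _ hint']
  refine integral_eq_zero_of_ae (Eventually.of_forall fun z => ?_)
  simp only [tensor_split, Pi.zero_apply]
  rcases le_or_gt z 0 with hz | hz
  · simp [ha.eq_zero hz]
  · obtain ⟨h1, h2, h3⟩ := slice_test hcyl hψ hz
    have h4 := hdiv _ h1 h2 h3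
    rw [← mul_zero (a z), ← h4, ← integral_const_mul]
    refine integral_congr_ae (Eventually.of_forall fun x => ?_)
    simp only [PiLp.inner_apply, Fin.sum_univ_two, gradient_slice hψ.1]
    simp only [RCLike.inner_apply, conj_trivial]
    change pderiv 0 ψ _ * _ + pderiv 1 ψ _ * _ = a z * (pderiv 0 ψ _ * _ + pderiv 1 ψ _ * _)
    ring

/-- Integration by parts along the axis. -/
lemma integral_deriv_tensor (ha : IsAxialProfile a) (hv : MemLp v 2) {ψ : Space → ℝ}
    (hψ : IsTestFunction Ω ψ) :
    ∫ p in (Ω : Set Space), ψ p * tensor (deriv a) v p =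
      -∫ p in (Ω : Set Space), pderiv 2 ψ p * tensor a v p := by
  have hint1 : Integrable (fun p => ψ p * tensor (deriv a) v p) :=
    memLp_one_iff_integrable.1 ((memLp_tensor ha.deriv.memLp hv).mul' (hψ.memLp _))
  have hint2 : Integrable (fun p => pderiv 2 ψ p * tensor a v p) :=
    memLp_one_iff_integrable.1 ((memLp_tensor ha.memLp hv).mul' ((hψ.pderiv 2).memLp _))
  rw [eq_neg_iff_add_eq_zero,
    setIntegral_eq_integral_of_forall_compl_eq_zero fun p hp => by rw [hψ.eq_zero hp, zero_mul],
    setIntegral_eq_integral_of_forall_compl_eq_zero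
      fun p hp => by rw [(hψ.pderiv 2).eq_zero hp, zero_mul],
    ← integral_add hint1 hint2, integral_eq_integral_split]
  have hint' := integrable_split (hint1.add hint2)
  simp only [Pi.add_apply] at hint'
  -- The axis is integrated first: v x is then a constant factor, and no regularity of v is needed.
  rw [Measure.volume_eq_prod, integral_prod _ hint']
  refine integral_eq_zero_of_ae (Eventually.of_forall fun x => ?_)
  simp only [tensor_split, Pi.zero_apply]
  have hline : ∀ z, HasDerivAt (fun z : ℝ => ψ (planeIncl x + z • axis))
      (pderiv 2 ψ (planeIncl x + z • axis)) z := by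
    intro z
    have h1 : HasDerivAt (fun z : ℝ => planeIncl x + z • axis) axis z := by
      simpa using ((hasDerivAt_id z).smul_const axis).const_add (planeIncl x)
    exact (hψ.1.differentiable (by simp) _).hasFDerivAt.comp_hasDerivAt z h1
  have hd : ∀ z, HasDerivAt (fun z => ψ (planeIncl x + z • axis) * a z)
      (pderiv 2 ψ (planeIncl x + z • axis) * a z + ψ (planeIncl x + z • axis) * deriv a z) z :=
    fun z => (hline z).mul (ha.contDiff.differentiable (by simp) z).hasDerivAt
  have hc : Continuous fun z : ℝ => planeIncl x + z • axis := by fun_prop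
  have hψc := hψ.1.continuous.comp hc
  have hψc' := (hψ.pderiv 2).1.continuous.comp hc
  have e := integral_eq_zero_of_hasDerivAt_of_integrable hd
    (((hψc'.mul ha.contDiff.continuous).integrable_of_hasCompactSupport
      ha.hasCompactSupport.mul_left).add ((hψc.mul ha.deriv.contDiff.continuous
        ).integrable_of_hasCompactSupport ha.deriv.hasCompactSupport.mul_left))
    ((hψc.mul ha.contDiff.continuous).integrable_of_hasCompactSupport
      ha.hasCompactSupport.mul_left)
  rw [← zero_mul (v x), ← e, ← integral_mul_const]
  exact integral_congr_ae (Eventually.of_forall fun z => by ring)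

/-- The components of the guided mode `a z * (V (x, y), 0)`. -/
def modeField (V : Plane → Plane) (a : ℝ → ℝ) : Fin 3 → Space → ℝ :=
  ![tensor a fun x => V x 0, tensor a fun x => V x 1, 0]

/-- The components of `a z * (-V_y, V_x, 0)`. -/
def modeCurl (V : Plane → Plane) (a : ℝ → ℝ) : Fin 3 → Space → ℝ :=
  ![-tensor a fun x => V x 1, tensor a fun x => V x 0, 0]

lemma memLp_modeField {V : Plane → Plane} (hV : MemLp V 2) (ha : IsAxialProfile a) (i : Fin 3) :
    MemLp (modeField V a i) 2 (volume.restrict (Ω : Set Space)) := by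
  have h := fun k => (memLp_tensor ha.memLp (hV.eval_piLp k)).restrict (Ω : Set Space)
  fin_cases i
  · exact h 0
  · exact h 1
  · exact MemLp.zero

lemma memLp_modeCurl {V : Plane → Plane} (hV : MemLp V 2) (ha : IsAxialProfile a) (i : Fin 3) :
    MemLp (modeCurl V a i) 2 (volume.restrict (Ω : Set Space)) := by
  have h := fun k => (memLp_tensor ha.memLp (hV.eval_piLp k)).restrict (Ω : Set Space)
  fin_cases i
  · exact (h 1).neg
  · exact h 0
  · exact MemLp.zero

lemma realField_modeField_mem_HDivZero
    (hcyl : ∀ p : Space, 0 < p 2 → (p ∈ Ω ↔ planeProj p ∈ S))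
    (ha : IsAxialProfile a) {V : Plane → Plane} (hV : MemLp V 2)
    (hdiv : ∀ g : Plane → ℝ, ContDiff ℝ ∞ g → HasCompactSupport g → tsupport g ⊆ S →
        ∫ x, ⟪V x, gradient g x⟫_ℝ = 0) :
    (realField (modeField V a) (memLp_modeField hV ha) : L2Field Ω) ∈ HDivZero Ω := by
  intro ψ hψ
  simp only [testIntegral_realField]
  have h : ∫ p in (Ω : Set Space), (pderiv 0 ψ p * modeField V a 0 p +
      pderiv 1 ψ p * modeField V a 1 p) = 0 := integral_div_tensor hcyl ha hV hdiv hψ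
  have hint : ∀ i, Integrable (fun p => pderiv i ψ p * modeField V a i p)
      (volume.restrict (Ω : Set Space)) := fun i =>
    integrable_test_mul ((hψ.pderiv i).memLp _) (memLp_modeField hV ha i)
  rw [integral_add (hint 0) (hint 1)] at h
  rw [Fin.sum_univ_three]
  have h2 : ∫ p in (Ω : Set Space), pderiv 2 ψ p * modeField V a 2 p = 0 := by simp [modeField]
  rw [h2]
  norm_cast
  rw [add_zero]
  exact h

/-- The second curl of the guided mode. -/
lemma modeCurl_mem_weakCurlGraph
    (hcyl : ∀ p : Space, 0 < p 2 → (p ∈ Ω ↔ planeProj p ∈ S))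
    (ha : IsAxialProfile a) {V : Plane → Plane} (hV : MemLp V 2)
    (hdiv : ∀ g : Plane → ℝ, ContDiff ℝ ∞ g → HasCompactSupport g → tsupport g ⊆ S →
        ∫ x, ⟪V x, gradient g x⟫_ℝ = 0) :
    ((realField (modeCurl V a) (memLp_modeCurl hV ha) : L2Field Ω),
      realField (modeField V (-deriv a)) (memLp_modeField hV (by
        simpa using ha.deriv.smul (-1)))) ∈ weakCurlGraph Ω := by
  rw [realField_mem_weakCurlGraph_iff]
  intro ψ hψ i
  have hVk : ∀ k : Fin 2, MemLp (fun x => V x k) 2 := fun k => hV.eval_piLp k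
  have hneg : ∀ v : Plane → ℝ, tensor (-deriv a) v = -tensor (deriv a) v := fun v => by
    funext p; simp [tensor]
  fin_cases i
  · have h := integral_deriv_tensor ha (hVk 0) hψ
    simp [modeField, modeCurl, hneg, integral_neg, h]
  · have h := integral_deriv_tensor ha (hVk 1) hψ
    simp [modeField, modeCurl, hneg, integral_neg, h]
  -- The third component of the curl of a(z)(-V_y, V_x, 0) is a times the planar divergence of V;
  -- the other two are axial derivatives.
  · have h := integral_div_tensor hcyl ha hV hdiv hψ
    simp [modeField, modeCurl]
    rw [eq_comm, ← neg_eq_zero, ← integral_neg, ← h]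
    refine integral_congr_ae (Eventually.of_forall fun p => ?_)
    ring

/-- Green's formula for the guided mode. -/
lemma inner_modeField (hcyl : ∀ p : Space, 0 < p 2 → (p ∈ Ω ↔ planeProj p ∈ S))
    (ha : IsAxialProfile a) {V : Plane → Plane} (hV : MemLp V 2) {g : ℕ → Plane → ℝ}
    (hg : ∀ m, ContDiff ℝ ∞ (g m) ∧ HasCompactSupport (g m) ∧ tsupport (gradient (g m)) ⊆ S)
    (hlim : Tendsto (fun m => eLpNorm (gradient (g m) - V) 2 volume) atTop (𝓝 0))
    {P : L2Field Ω × L2Field Ω} (hP : P ∈ weakCurlGraph Ω) :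
    ⟪P.2, realField (modeField V a) (memLp_modeField hV ha)⟫_ℂ =
      ⟪P.1, realField (modeCurl V (deriv a)) (memLp_modeCurl hV ha.deriv)⟫_ℂ := by
  have hVk : ∀ k : Fin 2, MemLp (fun x => V x k) 2 := fun k => hV.eval_piLp k
  have hgL : ∀ m, MemLp (gradient (g m)) 2 := fun m => memLp_gradient (hg m).1 (hg m).2.1
  have hgk : ∀ m, ∀ k : Fin 2, MemLp (fun x => gradient (g m) x k) 2 := fun m k =>
    (hgL m).eval_piLp k
  have hlim2 : Tendsto (fun m => ∫ x, ‖gradient (g m) x - V x‖ ^ 2) atTop (𝓝 0) := by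
    have h1 : ∀ m, ∫ x, ‖gradient (g m) x - V x‖ ^ 2 =
        (eLpNorm (gradient (g m) - V) 2 volume).toReal ^ 2 := by
      intro m
      have hm := (hgL m).sub hV
      rw [hm.eLpNorm_eq_integral_rpow_norm (by norm_num) (by norm_num), ENNReal.toReal_ofReal (by
        positivity)]
      simp only [ENNReal.toReal_ofNat, Real.rpow_ofNat, Pi.sub_apply]
      rw [← Real.rpow_natCast, ← Real.rpow_mul (by positivity)]
      norm_num
    simp only [h1]
    have h2 := (ENNReal.tendsto_toReal (by simp : (0 : ENNReal) ≠ ⊤)).comp hlim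
    simpa using h2.pow 2
  have hlimk : ∀ k : Fin 2, Tendsto (fun m => ∫ x, (gradient (g m) x k - V x k) ^ 2) atTop (𝓝 0) := by
    intro k
    refine squeeze_zero (fun m => integral_nonneg fun x => sq_nonneg _) (fun m => ?_) hlim2
    refine integral_mono_of_nonneg (Eventually.of_forall fun x => sq_nonneg _) ?_
      (Eventually.of_forall fun x => ?_)
    · have := (memLp_two_iff_integrable_sq_norm ((hgL m).sub hV).1).1 ((hgL m).sub hV)
      exact this
    · have := PiLp.norm_apply_le (gradient (g m) x - V x) k
      simp only
      rw [← sq_abs]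
      gcongr
      exact this
  -- The components of a ∇g_m are test functions of Ω although g_m need not vanish outside S: only
  -- the gradient of g_m is supported in S. This makes the boundary condition hold in the limit.
  have htest : ∀ m, ∀ k : Fin 2, IsTestFunction Ω (tensor a fun x => gradient (g m) x k) := by
    intro m k
    obtain ⟨h1, h2, h3⟩ := hg m
    have hsub : tsupport (fun x => gradient (g m) x k) ⊆ tsupport (gradient (g m)) := by
      refine closure_mono fun x hx => ?_
      intro h0
      exact hx (by simp [h0])
    refine isTestFunction_tensor hcyl ha ?_ ((hasCompactSupport_gradient h2).of_isClosed_subset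
      (isClosed_tsupport _) hsub) (hsub.trans h3)
    simp only [gradient_apply]
    exact (h1.fderiv_right (m := ∞) (by simp)).clm_apply contDiff_const
  -- The mixed transverse derivatives of a g_m, both paired with the third component of P.1, cancel:
  -- the transverse field ∇g_m has no planar curl. Only the terms with the derivative of a survive.
  have hP' : ∀ m, testIntegral (tensor a fun x => gradient (g m) x 0) 0 P.2 +
      testIntegral (tensor a fun x => gradient (g m) x 1) 1 P.2 =
      testIntegral (tensor (deriv a) fun x => gradient (g m) x 0) 1 P.1 -
      testIntegral (tensor (deriv a) fun x => gradient (g m) x 1) 0 P.1 := by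
    intro m
    have hG : ContDiff ℝ ∞ (tensor a (g m)) := contDiff_tensor ha.contDiff (hg m).1
    have e0 : pderiv 0 (tensor a (g m)) = tensor a fun x => gradient (g m) x 0 :=
      pderiv_castSucc_tensor ha.contDiff (hg m).1 0
    have e1 : pderiv 1 (tensor a (g m)) = tensor a fun x => gradient (g m) x 1 :=
      pderiv_castSucc_tensor ha.contDiff (hg m).1 1
    have e0' : pderiv 0 (tensor (deriv a) (g m)) = tensor (deriv a) fun x => gradient (g m) x 0 :=
      pderiv_castSucc_tensor ha.deriv.contDiff (hg m).1 0
    have e1' : pderiv 1 (tensor (deriv a) (g m)) = tensor (deriv a) fun x => gradient (g m) x 1 :=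
      pderiv_castSucc_tensor ha.deriv.contDiff (hg m).1 1
    have h0 := hP _ (htest m 0) 0
    have h1 := hP _ (htest m 1) 1
    rw [← e0] at h0 ⊢
    rw [← e1] at h1 ⊢
    have i1 : (1 : Fin 3) + 1 = 2 := rfl
    have i2 : (1 : Fin 3) + 2 = 0 := rfl
    rw [zero_add, zero_add] at h0
    rw [i1, i2] at h1
    rw [h0, h1, pderiv_comm hG 2 0, pderiv_comm hG 2 1, pderiv_comm hG 1 0,
      pderiv_two_tensor ha.contDiff (hg m).1, e0', e1']
    ring
  have hT := fun (b : ℝ → ℝ) (hb : IsAxialProfile b) (k : Fin 2) =>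
    tendsto_testIntegral_tensor (Ω := Ω) hb.memLp (hVk k) (fun m => hgk m k) (hlimk k)
  have hlimit := tendsto_nhds_unique (((hT a ha 0 0 P.2).add (hT a ha 1 1 P.2)).congr hP')
    ((hT _ ha.deriv 0 1 P.1).sub (hT _ ha.deriv 1 0 P.1))
  -- The real fields are moved into the first slot, where `inner_realField` applies.
  rw [← inner_conj_symm, ← inner_conj_symm P.1]
  congr 1
  rw [inner_realField, inner_realField, Fin.sum_univ_three, Fin.sum_univ_three]
  have z0 : ∀ (i : Fin 3) (E : L2Field Ω), testIntegral 0 i E = 0 := testIntegral_zero_left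
  simp only [modeField, modeCurl, Matrix.cons_val_zero, Matrix.cons_val_one, Matrix.cons_val,
    testIntegral_neg_left, z0, add_zero]
  rw [hlimit]
  ring

/-- Inner products of guided modes. -/
lemma inner_modeField_modeField (hcyl : ∀ p : Space, 0 < p 2 → (p ∈ Ω ↔ planeProj p ∈ S))
    (ha : IsAxialProfile a) (hb : IsAxialProfile b) {V : Plane → Plane} (hV : MemLp V 2)
    (hVS : ∀ x ∉ S, V x = 0) :
    ⟪(realField (modeField V a) (memLp_modeField hV ha) : L2Field Ω),
      realField (modeField V b) (memLp_modeField hV hb)⟫_ℂ =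
    (((∫ z, a z * b z) * ∫ x, ‖V x‖ ^ 2 : ℝ) : ℂ) := by
  rw [inner_realField_realField]
  congr 1
  have hVk : ∀ k : Fin 2, MemLp (fun x => V x k) 2 := fun k => hV.eval_piLp k
  have hk : ∀ k : Fin 2, ∫ p in (Ω : Set Space), tensor a (fun x => V x k) p *
      tensor b (fun x => V x k) p = (∫ z, a z * b z) * ∫ x, V x k ^ 2 := by
    intro k
    rw [setIntegral_eq_integral_of_forall_compl_eq_zero fun p hp => by
      rw [tensor_eq_zero hcyl ha (fun x hx => by simp [hVS x hx]) hp, zero_mul]]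
    simp only [tensor_mul_tensor]
    rw [integral_tensor]
    simp [sq]
  have hnorm : ∫ x, ‖V x‖ ^ 2 = (∫ x, V x 0 ^ 2) + ∫ x, V x 1 ^ 2 := by
    rw [← integral_add ((memLp_two_iff_integrable_sq (hVk 0).1).1 (hVk 0))
      ((memLp_two_iff_integrable_sq (hVk 1).1).1 (hVk 1))]
    refine integral_congr_ae (Eventually.of_forall fun x => ?_)
    simp [EuclideanSpace.norm_sq_eq, Fin.sum_univ_two]
  rw [Fin.sum_univ_three, hnorm, mul_add, ← hk 0, ← hk 1]
  simp [modeField]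

end GuidedMode

end GuidedModes

/-- Bessel's inequality: the squared coefficients are summable. -/
lemma tendsto_inner_of_orthonormal {H : Type*} [NormedAddCommGroup H] [InnerProductSpace ℂ H]
    {u : ℕ → H} (hu : Orthonormal ℂ u) (v : H) :
    Tendsto (fun n => ⟪v, u n⟫_ℂ) atTop (𝓝 0) := by
  have h1 := (hu.inner_products_summable (x := v)).tendsto_atTop_zero
  rw [tendsto_zero_iff_norm_tendsto_zero]
  have h2 : Tendsto (fun n => √(‖⟪u n, v⟫_ℂ‖ ^ 2)) atTop (𝓝 √0) :=
    (Real.continuous_sqrt.tendsto 0).comp h1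
  rw [Real.sqrt_zero] at h2
  refine h2.congr fun n => ?_
  rw [Real.sqrt_sq (norm_nonneg _), norm_inner_symm]

/-! ### Wave packets on the half-line -/

section AxialSequence

/-- A wave packet `χ ((z - N) / L) * cos (k * z + φ)`. -/
def wavePacket (χ : ℝ → ℝ) (k φ N L : ℝ) (z : ℝ) : ℝ := χ ((z - N) / L) * Real.cos (k * z + φ)

variable {χ : ℝ → ℝ} (hχ : ContDiff ℝ ∞ χ) (hχs : tsupport χ ⊆ Metric.closedBall 0 (1 / 2))

include hχ in
lemma contDiff_wavePacket (k φ N L : ℝ) : ContDiff ℝ ∞ (wavePacket χ k φ N L) := by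
  unfold wavePacket
  refine (hχ.comp ?_).mul (Real.contDiff_cos.comp ?_) <;> fun_prop

include hχs in
lemma tsupport_wavePacket_subset (k φ N : ℝ) {L : ℝ} (hL : 0 < L) :
    tsupport (wavePacket χ k φ N L) ⊆ Set.Icc (N - L / 2) (N + L / 2) := by
  refine closure_minimal (fun z hz => ?_) isClosed_Icc
  have h := hχs (subset_tsupport χ (left_ne_zero_of_mul hz))
  rw [mem_closedBall_zero_iff, Real.norm_eq_abs, abs_le, le_div_iff₀ hL, div_le_iff₀ hL] at h
  constructor <;> linarith [h.1, h.2]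

include hχ in
-- The cosine is an exact solution of w'' + k² w = 0, so each remaining term differentiates χ and
-- carries a factor 1/L.
lemma deriv_deriv_wavePacket (k φ N : ℝ) {L : ℝ} (z : ℝ) :
    deriv (deriv (wavePacket χ k φ N L)) z + k ^ 2 * wavePacket χ k φ N L z =
      deriv (deriv χ) ((z - N) / L) / L / L * Real.cos (k * z + φ) -
        2 * k * (deriv χ ((z - N) / L) / L) * Real.sin (k * z + φ) := by
  have hχ1 : ContDiff ℝ ∞ (deriv χ) := ((contDiff_infty_iff_deriv (𝕜 := ℝ)).1 hχ).2
  have hlin : ∀ z, HasDerivAt (fun z : ℝ => (z - N) / L) (1 / L) z := fun z =>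
    ((hasDerivAt_id z).sub_const N).div_const L
  have hb : ∀ {f : ℝ → ℝ}, ContDiff ℝ ∞ f → ∀ z, HasDerivAt (fun z => f ((z - N) / L))
      (deriv f ((z - N) / L) / L) z := by
    intro f hf z
    have := (hf.differentiable (by simp) ((z - N) / L)).hasDerivAt.comp z (hlin z)
    rwa [mul_one_div] at this
  have harg : ∀ z, HasDerivAt (fun z : ℝ => k * z + φ) k z := fun z => by
    simpa using ((hasDerivAt_id z).const_mul k).add_const φ
  have h1 : deriv (wavePacket χ k φ N L) = fun z => deriv χ ((z - N) / L) / L *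
      Real.cos (k * z + φ) + χ ((z - N) / L) * (-Real.sin (k * z + φ) * k) :=
    funext fun z => ((hb hχ z).mul (harg z).cos).deriv
  have h2 := (((hb hχ1 z).div_const L).mul (harg z).cos).add
    ((hb hχ z).mul ((harg z).sin.neg.mul_const k))
  rw [h1]
  refine (congrArg (· + k ^ 2 * wavePacket χ k φ N L z) h2.deriv).trans ?_
  simp only [wavePacket, Pi.neg_apply]
  ring

/-- The phases 0 and -π/2 give cosine and sine, whose squares add up to 1. Hence one of the two real
packets has at least half of the total mass, uniformly in k, and no oscillating integral has to be
estimated. -/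
lemma integral_wavePacket_sq_add (hχc : HasCompactSupport χ) (hχ : Continuous χ) (k N : ℝ) {L : ℝ} (hL : 0 < L) :
    (∫ z, wavePacket χ k 0 N L z ^ 2) + ∫ z, wavePacket χ k (-(Real.pi / 2)) N L z ^ 2 =
      L * ∫ z, χ z ^ 2 := by
  have hcs : ∀ φ, Integrable fun z => wavePacket χ k φ N L z ^ 2 := by
    intro φ
    refine Continuous.integrable_of_hasCompactSupport ?_ ?_
    · unfold wavePacket; fun_prop
    · have h1 : HasCompactSupport fun z : ℝ => χ ((z - N) / L) := by
        have := hχc.comp_homeomorph ((Homeomorph.subRight N).trans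
          (Homeomorph.mulRight₀ L⁻¹ (inv_ne_zero hL.ne')))
        simpa [Function.comp_def, div_eq_mul_inv] using this
      have h2 : HasCompactSupport (wavePacket χ k φ N L) := h1.mul_right
      exact h2.comp_left (g := fun x : ℝ => x ^ 2) (by simp)
  rw [← integral_add (hcs _) (hcs _)]
  have h1 : ∀ z, wavePacket χ k 0 N L z ^ 2 + wavePacket χ k (-(Real.pi / 2)) N L z ^ 2 =
      χ ((z - N) / L) ^ 2 := by
    intro z
    simp only [wavePacket]
    rw [← sub_eq_add_neg, Real.cos_sub_pi_div_two, add_zero]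
    linear_combination χ ((z - N) / L) ^ 2 * Real.sin_sq_add_cos_sq (k * z)
  simp only [h1]
  rw [integral_sub_right_eq_self (fun z => χ (z / L) ^ 2) N,
    Measure.integral_comp_div (fun z => χ z ^ 2) L, abs_of_pos hL, smul_eq_mul]

/-- Quasimodes of `-d²/dz²` on the half line, with disjoint supports, for every `k² ≥ 0`. -/
lemma exists_axial_sequence (k : ℝ) {κ : ℝ} (hκ : 0 < κ) :
    ∃ a : ℕ → ℝ → ℝ, (∀ n, IsAxialProfile (a n)) ∧ (∀ n, ∫ z, a n z * a n z = κ) ∧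
      (∀ n m, n ≠ m → ∫ z, a n z * a m z = 0) ∧
      Tendsto (fun n => ∫ z, (deriv (deriv (a n)) z + k ^ 2 * a n z) ^ 2) atTop (𝓝 0) := by
  obtain ⟨χ, hχ, hχs, hχc, hsupp0⟩ : ∃ χ : ℝ → ℝ, ContDiff ℝ ∞ χ ∧
      tsupport χ ⊆ Metric.closedBall 0 (1 / 2) ∧ HasCompactSupport χ ∧
      Function.support χ = Metric.ball 0 (1 / 2) := by
    let f : ContDiffBump (0 : ℝ) := ⟨1 / 4, 1 / 2, by norm_num, by norm_num⟩
    exact ⟨f, f.contDiff, f.tsupport_eq.le, f.hasCompactSupport, f.support_eq⟩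
  have hχ1 : ContDiff ℝ ∞ (deriv χ) := ((contDiff_infty_iff_deriv (𝕜 := ℝ)).1 hχ).2
  have hχ2 : ContDiff ℝ ∞ (deriv (deriv χ)) := ((contDiff_infty_iff_deriv (𝕜 := ℝ)).1 hχ1).2
  obtain ⟨M1, hM1⟩ := hχc.deriv.exists_bound_of_continuous hχ1.continuous
  obtain ⟨M2, hM2⟩ := hχc.deriv.deriv.exists_bound_of_continuous hχ2.continuous
  set c₀ := ∫ z, χ z ^ 2 with hc₀
  have hc₀pos : 0 < c₀ := by
    have hcs : HasCompactSupport fun z => χ z ^ 2 :=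
      hχc.comp_left (g := fun x : ℝ => x ^ 2) (zero_pow two_ne_zero)
    have hint : Integrable fun z => χ z ^ 2 :=
      (hχ.continuous.pow 2).integrable_of_hasCompactSupport hcs
    rw [hc₀, integral_pos_iff_support_of_nonneg (fun z => sq_nonneg _) hint]
    have hs : Function.support (fun z => χ z ^ 2) = Metric.ball 0 (1 / 2) := by
      rw [← hsupp0]
      ext z
      simp
    rw [hs]
    exact Metric.measure_ball_pos _ _ (by norm_num)
  set M := M2 + 2 * |k| * M1 with hM
  have hM1' : 0 ≤ M1 := (norm_nonneg _).trans (hM1 0)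
  have hM2' : 0 ≤ M2 := (norm_nonneg _).trans (hM2 0)
  -- Packets of width L = n + 1 centred at L²: the supports lie in z > 0, are pairwise disjoint, and
  -- grow without bound.
  let L : ℕ → ℝ := fun n => n + 1
  have hL : ∀ n, 1 ≤ L n := fun n => by simp [L]
  have hL0 : ∀ n, 0 < L n := fun n => by linarith [hL n]
  have hchoice : ∀ n, ∃ φ, L n * c₀ / 2 ≤ ∫ z, wavePacket χ k φ (L n ^ 2) (L n) z ^ 2 := by
    intro n
    have h := integral_wavePacket_sq_add hχc hχ.continuous k (L n ^ 2) (hL0 n)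
    by_contra! hcon
    have h1 := hcon 0
    have h2 := hcon (-(Real.pi / 2))
    linarith
  choose φ hφ using hchoice
  set w : ℕ → ℝ → ℝ := fun n => wavePacket χ k (φ n) (L n ^ 2) (L n) with hw
  set I : ℕ → ℝ := fun n => ∫ z, w n z ^ 2 with hI
  have hIpos : ∀ n, 0 < I n := fun n => lt_of_lt_of_le (by have := hL0 n; positivity) (hφ n)
  have hsupp : ∀ n, tsupport (w n) ⊆ Set.Icc (L n ^ 2 - L n / 2) (L n ^ 2 + L n / 2) := fun n =>
    tsupport_wavePacket_subset hχs _ _ _ (hL0 n)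
  have hprof : ∀ n, IsAxialProfile (w n) := fun n => by
    refine ⟨contDiff_wavePacket hχ _ _ _ _, isCompact_Icc.of_isClosed_subset (isClosed_tsupport _)
      (hsupp n), fun z hz => ?_⟩
    have h1 := (hsupp n hz).1
    have h2 := hL n
    rw [Set.mem_Ioi]
    nlinarith
  have hdisj : ∀ n m, n < m → ∀ z, w n z * w m z = 0 := by
    intro n m hnm z
    by_contra h
    have h1 := hsupp n (subset_tsupport _ (left_ne_zero_of_mul h))
    have h2 := hsupp m (subset_tsupport _ (right_ne_zero_of_mul h))
    have h3 : L n + 1 ≤ L m := by simp only [L]; exact_mod_cast Nat.succ_le_succ hnm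
    have h4 := hL0 n
    nlinarith [h1.2, h2.1]
  -- The residual is at most M/L on an interval of length L. Dividing by the mass, which is at least
  -- L c₀/2, leaves an error of order L⁻², weakened below to L⁻¹.
  have herr : ∀ n, ∫ z, (deriv (deriv (w n)) z + k ^ 2 * w n z) ^ 2 ≤ L n * (M / L n) ^ 2 := by
    intro n
    have hbound : ∀ z, (deriv (deriv (w n)) z + k ^ 2 * w n z) ^ 2 ≤
        (Set.Icc (L n ^ 2 - L n / 2) (L n ^ 2 + L n / 2)).indicator (fun _ => (M / L n) ^ 2) z := by
      intro z
      by_cases hz : z ∈ Set.Icc (L n ^ 2 - L n / 2) (L n ^ 2 + L n / 2)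
      · rw [Set.indicator_of_mem hz, ← sq_abs]
        gcongr
        rw [hw, deriv_deriv_wavePacket hχ]
        have b1 := hM1 ((z - L n ^ 2) / L n)
        have b2 := hM2 ((z - L n ^ 2) / L n)
        rw [Real.norm_eq_abs] at b1 b2
        refine (abs_sub _ _).trans ?_
        rw [abs_mul, abs_mul, abs_mul, abs_div, abs_div, abs_div, abs_mul, abs_of_pos (hL0 n), abs_two]
        have c1 := Real.abs_cos_le_one (k * z + φ n)
        have c2 := Real.abs_sin_le_one (k * z + φ n)
        calc _ ≤ M2 / L n / 1 * 1 + 2 * |k| * (M1 / L n) * 1 := by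
              have := hL n
              have := hL0 n
              gcongr
          _ = M / L n := by rw [hM]; ring
      · rw [Set.indicator_of_notMem hz]
        have h0 : z ∉ tsupport (w n) := fun h => hz (hsupp n h)
        have h1 : w n z = 0 := image_eq_zero_of_notMem_tsupport h0
        have h2 : deriv (deriv (w n)) z = 0 := by
          by_contra h
          exact h0 (closure_minimal support_deriv_subset (isClosed_tsupport _)
            (support_deriv_subset h))
        simp [h1, h2]
    calc _ ≤ ∫ z, (Set.Icc (L n ^ 2 - L n / 2) (L n ^ 2 + L n / 2)).indicator
          (fun _ => (M / L n) ^ 2) z := by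
          refine integral_mono_of_nonneg (Eventually.of_forall fun z => sq_nonneg _) ?_
            (Eventually.of_forall hbound)
          exact (integrable_indicator_iff measurableSet_Icc).2 (by simp)
      _ = L n * (M / L n) ^ 2 := by
          rw [integral_indicator measurableSet_Icc, setIntegral_const, smul_eq_mul,
            Real.volume_real_Icc_of_le (by linarith [hL0 n])]
          ring
  refine ⟨fun n => √(κ / I n) • w n, fun n => (hprof n).smul _, fun n => ?_, fun n m hnm => ?_, ?_⟩
  · have h1 : ∀ z, (√(κ / I n) • w n) z * (√(κ / I n) • w n) z = κ / I n * w n z ^ 2 := by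
      intro z
      simp only [Pi.smul_apply, smul_eq_mul]
      have := Real.mul_self_sqrt (div_nonneg hκ.le (hIpos n).le)
      linear_combination w n z ^ 2 * this
    simp only [h1]
    rw [integral_const_mul]
    exact div_mul_cancel₀ _ (hIpos n).ne'
  · refine integral_eq_zero_of_ae (Eventually.of_forall fun z => ?_)
    simp only [Pi.smul_apply, smul_eq_mul, Pi.zero_apply]
    have : w n z * w m z = 0 := by
      rcases lt_or_gt_of_ne hnm with h | h
      · exact hdisj n m h z
      · rw [mul_comm]; exact hdisj m n h z
    linear_combination √(κ / I n) * √(κ / I m) * this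
  · have hle : ∀ n, ∫ z, (deriv (deriv (√(κ / I n) • w n)) z + k ^ 2 * (√(κ / I n) • w n) z) ^ 2 ≤
        (2 * κ * M ^ 2 / c₀) * (1 / ((n : ℝ) + 1)) := by
      intro n
      have hd : deriv (deriv (√(κ / I n) • w n)) = √(κ / I n) • deriv (deriv (w n)) := by
        have e1 : deriv (√(κ / I n) • w n) = √(κ / I n) • deriv (w n) := funext fun z =>
          deriv_const_smul _ ((hprof n).contDiff.differentiable (by simp) z)
        rw [e1]
        exact funext fun z => deriv_const_smul _ ((hprof n).deriv.contDiff.differentiable (by simp) z)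
      have h1 : ∀ z, (deriv (deriv (√(κ / I n) • w n)) z + k ^ 2 * (√(κ / I n) • w n) z) ^ 2 =
          κ / I n * (deriv (deriv (w n)) z + k ^ 2 * w n z) ^ 2 := by
        intro z
        rw [hd]
        simp only [Pi.smul_apply, smul_eq_mul]
        have := Real.mul_self_sqrt (div_nonneg hκ.le (hIpos n).le)
        linear_combination (deriv (deriv (w n)) z + k ^ 2 * w n z) ^ 2 * this
      simp only [h1]
      rw [integral_const_mul]
      have hLn := hL0 n
      have hLn1 := hL n
      calc κ / I n * ∫ z, (deriv (deriv (w n)) z + k ^ 2 * w n z) ^ 2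
          ≤ κ / (L n * c₀ / 2) * (L n * (M / L n) ^ 2) := by
            gcongr
            · exact hφ n
            · exact herr n
        _ = (2 * κ * M ^ 2 / c₀) * (1 / (L n) ^ 2) := by field_simp
        _ ≤ (2 * κ * M ^ 2 / c₀) * (1 / (L n)) := by
            gcongr
            nlinarith
    refine squeeze_zero (fun n => integral_nonneg fun z => sq_nonneg _) hle ?_
    have hz := (tendsto_one_div_add_atTop_nhds_zero_nat (𝕜 := ℝ)).const_mul (2 * κ * M ^ 2 / c₀)
    rwa [mul_zero] at hz

end AxialSequence

/-! ### Weyl sequences of guided modes -/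

/-- The essential spectrum of a wave guide with a transverse mode is `[0, ∞)`. -/
theorem Ici_subset_essentialSpectrum {Ω : TopologicalSpace.Opens Space} {S : Set Plane}
    (hcyl : ∀ p : Space, 0 < p 2 → (p ∈ Ω ↔ planeProj p ∈ S)) {V : Plane → Plane} (hV : MemLp V 2)
    (hVS : ∀ x ∉ S, V x = 0) (hVpos : 0 < ∫ x, ‖V x‖ ^ 2)
    (hdiv : ∀ g : Plane → ℝ, ContDiff ℝ ∞ g → HasCompactSupport g → tsupport g ⊆ S →
        ∫ x, ⟪V x, gradient g x⟫_ℝ = 0) {g : ℕ → Plane → ℝ}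
    (hg : ∀ m, ContDiff ℝ ∞ (g m) ∧ HasCompactSupport (g m) ∧ tsupport (gradient (g m)) ⊆ S)
    (hlim : Tendsto (fun m => eLpNorm (gradient (g m) - V) 2 volume) atTop (𝓝 0)) :
    (fun t : ℝ => (t : ℂ)) '' Set.Ici 0 ⊆ essentialSpectrum (electricOperator Ω) := by
  rintro _ ⟨t, ht, rfl⟩
  -- The wave number √t gives energy t, and the axial mass (∫ ‖V‖²)⁻¹ makes the modes unit vectors.
  obtain ⟨a, ha, hnorm, horth, herr⟩ := exists_axial_sequence (√t) (inv_pos.2 hVpos)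
  rw [Real.sq_sqrt ht] at herr
  have hb : ∀ n, IsAxialProfile (-deriv (deriv (a n))) := fun n => by
    simpa using (ha n).deriv.deriv.smul (-1)
  have hdom : ∀ n, ∃ u : (electricOperator Ω).domain,
      ((u : HDivZero Ω) : L2Field Ω) = realField (modeField V (a n)) (memLp_modeField hV (ha n)) ∧
      (electricOperator Ω u : L2Field Ω) =
        realField (modeField V (-deriv (deriv (a n)))) (memLp_modeField hV (hb n)) := fun n =>
    mem_domain_electricOperator (realField_modeField_mem_HDivZero hcyl (ha n) hV hdiv)
      (fun P hP => inner_modeField hcyl (ha n) hV hg hlim hP)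
      (modeCurl_mem_weakCurlGraph hcyl (ha n).deriv hV hdiv)
  choose u hu hTu using hdom
  have hortho : Orthonormal ℂ fun n => ((u n : HDivZero Ω)) := by
    rw [orthonormal_iff_ite]
    intro n m
    rw [Submodule.coe_inner, hu, hu, inner_modeField_modeField hcyl (ha n) (ha m) hV hVS]
    split_ifs with h
    · subst h
      rw [hnorm, inv_mul_cancel₀ hVpos.ne']
      simp
    · rw [horth n m h, zero_mul]
      simp
  refine ⟨u, hortho.1, fun v => ?_, ?_⟩
  · exact tendsto_inner_of_orthonormal hortho v
  -- The residual is again a guided mode, with profile c = -a'' - t a, so its norm factors into the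
  -- axial residual and the norm of V.
  · set c : ℕ → ℝ → ℝ := fun n => -deriv (deriv (a n)) + (-t) • a n with hc
    have hcp : ∀ n, IsAxialProfile (c n) := fun n => (hb n).add ((ha n).smul (-t))
    have hdiff : ∀ n, ((electricOperator Ω (u n) - (t : ℂ) • (u n : HDivZero Ω) : HDivZero Ω) :
        L2Field Ω) = realField (modeField V (c n)) (memLp_modeField hV (hcp n)) := by
      intro n
      have e1 : ((electricOperator Ω (u n) - (t : ℂ) • (u n : HDivZero Ω) : HDivZero Ω) :
          L2Field Ω) = (electricOperator Ω (u n) : L2Field Ω) -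
            (t : ℂ) • ((u n : HDivZero Ω) : L2Field Ω) := rfl
      have hm : ∀ i, MemLp ((-t) • modeField V (a n) i) 2 (volume.restrict (Ω : Set Space)) :=
        fun i => (memLp_modeField hV (ha n) i).const_smul _
      have e2 := realField_smul (Ω := Ω) (-t) (memLp_modeField hV (ha n)) hm
      have e3 : ∀ i, modeField V (c n) i = modeField V (-deriv (deriv (a n))) i +
          (-t) • modeField V (a n) i := by
        intro i
        fin_cases i
        · change tensor (-deriv (deriv (a n)) + (-t) • a n) (fun x => V x 0) =
            tensor (-deriv (deriv (a n))) (fun x => V x 0) + (-t) • tensor (a n) (fun x => V x 0)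
          rw [tensor_add_left, tensor_smul_left]
        · change tensor (-deriv (deriv (a n)) + (-t) • a n) (fun x => V x 1) =
            tensor (-deriv (deriv (a n))) (fun x => V x 1) + (-t) • tensor (a n) (fun x => V x 1)
          rw [tensor_add_left, tensor_smul_left]
        · simp [modeField]
      have e4 := realField_add (Ω := Ω) (memLp_modeField hV (hb n)) hm
        fun i => (memLp_modeField hV (hb n) i).add (hm i)
      have e5 : (realField (modeField V (c n)) (memLp_modeField hV (hcp n)) : L2Field Ω) =
          realField _ (fun i => (memLp_modeField hV (hb n) i).add (hm i)) := by
        congr 1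
        exact funext e3
      rw [e1, hu, hTu, e5, e4, e2]
      push_cast
      rw [neg_smul, sub_eq_add_neg]
    rw [tendsto_zero_iff_norm_tendsto_zero]
    have hn : ∀ n, ‖electricOperator Ω (u n) - (t : ℂ) • (u n : HDivZero Ω)‖ =
        √((∫ z, (deriv (deriv (a n)) z + t * a n z) ^ 2) * ∫ x, ‖V x‖ ^ 2) := by
      intro n
      rw [Submodule.coe_norm, hdiff]
      have h1 := inner_modeField_modeField (Ω := Ω) hcyl (hcp n) (hcp n) hV hVS
      rw [inner_self_eq_norm_sq_to_K] at h1
      have h2 : ‖(realField (modeField V (c n)) (memLp_modeField hV (hcp n)) : L2Field Ω)‖ ^ 2 =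
          (∫ z, c n z * c n z) * ∫ x, ‖V x‖ ^ 2 := by
        apply Complex.ofReal_injective
        rw [← h1]
        simp
      rw [← Real.sqrt_sq (norm_nonneg _), h2]
      congr 2
      refine integral_congr_ae (Eventually.of_forall fun z => ?_)
      simp only [hc, Pi.add_apply, Pi.neg_apply, Pi.smul_apply, smul_eq_mul]
      ring
    simp only [hn]
    have h3 := (Real.continuous_sqrt.tendsto _).comp (herr.mul_const (∫ x, ‖V x‖ ^ 2))
    rw [zero_mul, Real.sqrt_zero] at h3
    exact h3

/-! ### Extension and folding under the reflection -/

section Reflection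

/-- The eigenvalues of the reflection in the coordinate directions. -/
def mirrorSign : Fin 3 → ℝ := ![-1, 1, 1]

lemma reflectX_apply (p : Space) (i : Fin 3) : reflectX p i = mirrorSign i * p i := by
  fin_cases i <;> simp [reflectX, mirrorSign]

lemma mirrorSign_mul_self (i : Fin 3) : mirrorSign i * mirrorSign i = 1 := by
  fin_cases i <;> simp [mirrorSign]

/-- The three signs multiply to -1 because a reflection reverses orientation. For this reason curl
exchanges the two symmetry types `mirrorSign` and `-mirrorSign`. -/
lemma mirrorSign_mul_mirrorSign (i : Fin 3) :
    mirrorSign i * mirrorSign (i + 1) = -mirrorSign (i + 2) := by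
  fin_cases i <;> simp [mirrorSign]

lemma reflectX_reflectX (p : Space) : reflectX (reflectX p) = p := by
  ext i
  rw [reflectX_apply, reflectX_apply, ← mul_assoc, mirrorSign_mul_self, one_mul]

/-- The reflection in the plane `{x = 0}` as a linear isometry. -/
def reflection : Space ≃ₗᵢ[ℝ] Space where
  toLinearEquiv := LinearEquiv.ofInvolutive
    { toFun := reflectX
      map_add' := fun p q => by ext i; simp only [reflectX_apply, PiLp.add_apply]; ring
      map_smul' := fun c p => by
        ext i
        simp only [reflectX_apply, PiLp.smul_apply, smul_eq_mul, RingHom.id_apply]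
        ring }
    reflectX_reflectX
  norm_map' := fun p => by
    change ‖reflectX p‖ = ‖p‖
    simp only [EuclideanSpace.norm_eq, Fin.sum_univ_three, reflectX_apply]
    simp [mirrorSign]

lemma measurePreserving_reflectX : MeasurePreserving reflectX :=
  reflection.measurePreserving

lemma measurableEmbedding_reflectX : MeasurableEmbedding reflectX :=
  reflection.toHomeomorph.measurableEmbedding

lemma pderiv_comp_reflectX {ψ : Space → ℝ} (j : Fin 3) :
    pderiv j (ψ ∘ reflectX) = mirrorSign j • (pderiv j ψ ∘ reflectX) := by
  funext p
  have h1 := reflection.toContinuousLinearEquiv.comp_right_fderiv (f := ψ) (x := p)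
  have h2 : reflectX (EuclideanSpace.single j 1) = mirrorSign j • EuclideanSpace.single j 1 := by
    ext i
    rw [reflectX_apply, PiLp.smul_apply, smul_eq_mul]
    by_cases h : i = j
    · rw [h]
    · simp [h]
  change fderiv ℝ (ψ ∘ reflection.toContinuousLinearEquiv) p _ = _
  rw [h1]
  change fderiv ℝ ψ (reflectX p) (reflectX _) = _
  rw [h2, map_smul]
  rfl

variable {Ω : TopologicalSpace.Opens Space}

lemma IsTestFunction.comp_reflectX (hsymm : ∀ p ∈ Ω, reflectX p ∈ Ω) {ψ : Space → ℝ}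
    (hψ : IsTestFunction Ω ψ) : IsTestFunction Ω (ψ ∘ reflectX) := by
  refine ⟨hψ.1.comp reflection.contDiff, hψ.2.1.comp_homeomorph reflection.toHomeomorph, ?_⟩
  have h := tsupport_comp_eq_preimage ψ reflection.toHomeomorph
  intro p hp
  have hp' : reflectX p ∈ tsupport ψ := (Set.ext_iff.1 h p).1 hp
  rw [← reflectX_reflectX p]
  exact hsymm _ (hψ.2.2 hp')

lemma IsTestFunction.const_smul {ψ : Space → ℝ} (h : IsTestFunction Ω ψ) (c : ℝ) :
    IsTestFunction Ω (c • ψ) :=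
  ⟨h.1.const_smul c, h.2.1.smul_left (f := fun _ => c),
    (closure_mono (Function.support_const_smul_subset c ψ)).trans h.2.2⟩

lemma IsTestFunction.mono {U : TopologicalSpace.Opens Space} (hU : U ≤ Ω) {ψ : Space → ℝ}
    (h : IsTestFunction U ψ) : IsTestFunction Ω ψ := ⟨h.1, h.2.1, h.2.2.trans hU⟩

lemma halfGuide_le : halfGuide Ω ≤ Ω := fun _ hp => hp.1

lemma volume_setOf_apply_zero_eq_zero : (volume : Measure Space) {p | p 0 = 0} = 0 := by
  have h := Measure.addHaar_submodule (volume : Measure Space)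
    (LinearMap.ker (EuclideanSpace.proj (0 : Fin 3) : Space →L[ℝ] ℝ).toLinearMap) (fun h => ?_)
  · exact h
  · have : EuclideanSpace.single (0 : Fin 3) (1 : ℝ) ∈ (⊤ : Submodule ℝ Space) := trivial
    rw [← h, LinearMap.mem_ker] at this
    simp at this

/-- The integral over a symmetric domain in terms of the half domain. -/
lemma setIntegral_eq_halfGuide (hsymm : ∀ p ∈ Ω, reflectX p ∈ Ω) {f : Space → ℂ}
    (hf : IntegrableOn f (Ω : Set Space)) :
    ∫ p in (Ω : Set Space), f p = ∫ p in (halfGuide Ω : Set Space), (f p + f (reflectX p)) := by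
  have hpre : reflectX ⁻¹' (halfGuide Ω : Set Space) = {p | p ∈ Ω ∧ p 0 < 0} := by
    ext p
    have h0 : reflectX p 0 = -p 0 := by simp [reflectX]
    change reflectX p ∈ Ω ∧ 0 < reflectX p 0 ↔ _
    rw [h0, neg_pos]
    exact and_congr_left fun _ => ⟨fun h => reflectX_reflectX p ▸ hsymm _ h, hsymm p⟩
  have hm := (halfGuide Ω).isOpen.measurableSet
  have hm' := measurePreserving_reflectX.measurable hm
  have h1 := measurePreserving_reflectX.setIntegral_preimage_emb measurableEmbedding_reflectX
    (fun p => f (reflectX p)) (halfGuide Ω : Set Space)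
  simp only [reflectX_reflectX] at h1
  have hsub : reflectX ⁻¹' (halfGuide Ω : Set Space) ⊆ (Ω : Set Space) := by
    rw [hpre]; exact fun p hp => hp.1
  have hi1 : IntegrableOn f (halfGuide Ω : Set Space) := hf.mono_set halfGuide_le
  have hi2 : IntegrableOn (fun p => f (reflectX p)) (halfGuide Ω : Set Space) := by
    rw [← measurePreserving_reflectX.integrableOn_comp_preimage measurableEmbedding_reflectX]
    simp only [Function.comp_def, reflectX_reflectX]
    exact hf.mono_set hsub
  rw [integral_add hi1 hi2, ← h1, ← setIntegral_union _ hm' hi1 (hf.mono_set hsub)]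
  · refine setIntegral_congr_set ?_
    have hz : ∀ᵐ p : Space, p 0 ≠ 0 := measure_eq_zero_iff_ae_notMem.1 volume_setOf_apply_zero_eq_zero
    filter_upwards [hz] with p hp
    rw [hpre]
    refine propext ⟨fun h => ?_, ?_⟩
    · rcases lt_or_gt_of_ne hp with h0 | h0
      · exact Or.inr ⟨h, h0⟩
      · exact Or.inl ⟨h, h0⟩
    · rintro (h | h) <;> exact h.1
  · rw [hpre]
    exact Set.disjoint_left.2 fun p h h' => absurd (h.2.trans h'.2) (lt_irrefl _)

/-- Extension of a function given on `{x > 0}` by reflection, with a factor `c`. -/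
def mirrorExtension (c : ℝ) (f : Space → ℂ) (p : Space) : ℂ :=
  if 0 < p 0 then f p else c • f (reflectX p)

lemma mirrorExtension_of_pos (c : ℝ) (f : Space → ℂ) {p : Space} (hp : 0 < p 0) :
    mirrorExtension c f p = f p := if_pos hp

lemma mirrorExtension_reflectX (c : ℝ) (f : Space → ℂ) {p : Space} (hp : 0 < p 0) :
    mirrorExtension c f (reflectX p) = c • f p := by
  have h0 : ¬ 0 < reflectX p 0 := by simp [reflectX, hp.le]
  rw [mirrorExtension, if_neg h0, reflectX_reflectX]

lemma memLp_mirrorExtension (hsymm : ∀ p ∈ Ω, reflectX p ∈ Ω) (c : ℝ) {f : Space → ℂ}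
    (hf : MemLp f 2 (volume.restrict (halfGuide Ω : Set Space))) :
    MemLp (mirrorExtension c f) 2 (volume.restrict (Ω : Set Space)) := by
  have hm := (halfGuide Ω).isOpen.measurableSet
  have h1 : MemLp ((halfGuide Ω : Set Space).indicator f) 2 := (memLp_indicator_iff_restrict hm).2 hf
  have h2 := (h1.comp_measurePreserving measurePreserving_reflectX).const_smul c
  refine (memLp_congr_ae ?_).1 ((h1.add h2).restrict (Ω : Set Space))
  have hz : ∀ᵐ p : Space, p 0 ≠ 0 :=
    measure_eq_zero_iff_ae_notMem.1 volume_setOf_apply_zero_eq_zero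
  filter_upwards [ae_restrict_mem Ω.isOpen.measurableSet, ae_restrict_of_ae hz] with p hp hp0
  have h0 : reflectX p 0 = -p 0 := by simp [reflectX]
  rcases lt_or_gt_of_ne hp0 with h | h
  · have e1 : p ∉ (halfGuide Ω : Set Space) := fun h' => h'.2.not_gt h
    have e2 : reflectX p ∈ (halfGuide Ω : Set Space) := ⟨hsymm p hp, by rw [h0]; linarith⟩
    simp [mirrorExtension, e1, e2, h.not_gt]
  · have e1 : p ∈ (halfGuide Ω : Set Space) := ⟨hp, h⟩
    have e2 : reflectX p ∉ (halfGuide Ω : Set Space) := fun h' => by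
      have := h'.2
      rw [h0] at this
      linarith
    simp [mirrorExtension, e1, e2, h]

/-- The extension of a field by reflection, with the factor `c i` for the `i`-th component. -/
def mirrorField (hsymm : ∀ p ∈ Ω, reflectX p ∈ Ω) (c : Fin 3 → ℝ) (F : L2Field (halfGuide Ω)) :
    L2Field Ω :=
  (MemLp.of_eval_piLp (f := fun p => (WithLp.toLp 2 fun i =>
    mirrorExtension (c i) (fun p => F p i) p : CVec))
    fun i => memLp_mirrorExtension hsymm (c i) (memLp_coord F i)).toLp _

lemma coeFn_mirrorField (hsymm : ∀ p ∈ Ω, reflectX p ∈ Ω) (c : Fin 3 → ℝ)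
    (F : L2Field (halfGuide Ω)) :
    mirrorField hsymm c F =ᵐ[volume.restrict (Ω : Set Space)]
      fun p => WithLp.toLp 2 fun i => mirrorExtension (c i) (fun p => F p i) p :=
  MemLp.coeFn_toLp _

lemma memLp_comp_reflectX (hsymm : ∀ p ∈ Ω, reflectX p ∈ Ω) {E : Type*} [NormedAddCommGroup E]
    {f : Space → E} (hf : MemLp f 2 (volume.restrict (Ω : Set Space))) :
    MemLp (f ∘ reflectX) 2 (volume.restrict (Ω : Set Space)) := by
  have hpre : reflectX ⁻¹' (Ω : Set Space) = Ω := by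
    ext p
    exact ⟨fun h => reflectX_reflectX p ▸ hsymm _ h, hsymm p⟩
  have h := measurePreserving_reflectX.restrict_preimage Ω.isOpen.measurableSet
  rw [hpre] at h
  exact hf.comp_measurePreserving h

lemma memLp_fold (hsymm : ∀ p ∈ Ω, reflectX p ∈ Ω) (c : ℝ) {f : Space → ℂ}
    (hf : MemLp f 2 (volume.restrict (Ω : Set Space))) :
    MemLp (f + c • (f ∘ reflectX)) 2 (volume.restrict (halfGuide Ω : Set Space)) :=
  (hf.add ((memLp_comp_reflectX hsymm hf).const_smul c)).mono_measure
    (Measure.restrict_mono halfGuide_le le_rfl)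

/-- The field `F_i(p) + c_i F_i(R p)` on the half domain, where `R` is the reflection. -/
def foldField (hsymm : ∀ p ∈ Ω, reflectX p ∈ Ω) (c : Fin 3 → ℝ) (F : L2Field Ω) :
    L2Field (halfGuide Ω) :=
  (MemLp.of_eval_piLp (f := fun p => (WithLp.toLp 2 fun i =>
    F p i + c i • F (reflectX p) i : CVec))
    fun i => memLp_fold hsymm (c i) (memLp_coord F i)).toLp _

lemma coeFn_foldField (hsymm : ∀ p ∈ Ω, reflectX p ∈ Ω) (c : Fin 3 → ℝ) (F : L2Field Ω) :
    foldField hsymm c F =ᵐ[volume.restrict (halfGuide Ω : Set Space)]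
      fun p => WithLp.toLp 2 fun i => F p i + c i • F (reflectX p) i :=
  MemLp.coeFn_toLp _

lemma integral_mul_mirrorExtension (hsymm : ∀ p ∈ Ω, reflectX p ∈ Ω) (c : ℝ) {g f : Space → ℂ}
    (hg : MemLp g 2 (volume.restrict (Ω : Set Space)))
    (hf : MemLp f 2 (volume.restrict (halfGuide Ω : Set Space))) :
    ∫ p in (Ω : Set Space), g p * mirrorExtension c f p =
      ∫ p in (halfGuide Ω : Set Space), (g p + c • g (reflectX p)) * f p := by
  rw [setIntegral_eq_halfGuide hsymm
    (memLp_one_iff_integrable.1 ((memLp_mirrorExtension hsymm c hf).mul' hg))]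
  refine setIntegral_congr_fun (halfGuide Ω).isOpen.measurableSet fun p hp => ?_
  simp only [mirrorExtension_of_pos c f hp.2, mirrorExtension_reflectX c f hp.2, Complex.real_smul]
  ring

/-- A change of variables moves the reflection onto the test function. The folded function need not
vanish on {x = 0}, so it is not a test function of the half domain; `exists_cutoff` repairs this. -/
lemma testIntegral_mirrorField (hsymm : ∀ p ∈ Ω, reflectX p ∈ Ω) (c : Fin 3 → ℝ)
    (F : L2Field (halfGuide Ω)) {ψ : Space → ℝ}
    (hψ : MemLp ψ 2 (volume.restrict (Ω : Set Space))) (i : Fin 3) :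
    testIntegral ψ i (mirrorField hsymm c F) =
      testIntegral (ψ + c i • (ψ ∘ reflectX)) i F := by
  have h := integral_mul_mirrorExtension hsymm (c i) (g := fun p => (ψ p : ℂ))
    (Complex.ofRealCLM.comp_memLp' hψ) (memLp_coord F i)
  refine (Eq.trans ?_ h).trans ?_
  · refine integral_congr_ae ?_
    filter_upwards [coeFn_mirrorField hsymm c F] with p hp
    rw [hp, Complex.real_smul]
  · refine integral_congr_ae (Eventually.of_forall fun p => ?_)
    simp

lemma testIntegral_foldField (hsymm : ∀ p ∈ Ω, reflectX p ∈ Ω) (c : Fin 3 → ℝ)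
    (F : L2Field Ω) {ψ : Space → ℝ} (hψ : IsTestFunction (halfGuide Ω) ψ) (i : Fin 3) :
    testIntegral ψ i (foldField hsymm c F) =
      testIntegral (ψ + c i • (ψ ∘ reflectX)) i F := by
  have h := integral_mul_mirrorExtension hsymm (c i) (f := fun p => (ψ p : ℂ))
    (memLp_coord F i) (Complex.ofRealCLM.comp_memLp' (hψ.memLp _))
  refine Eq.trans ?_ (h.symm.trans ?_)
  · refine integral_congr_ae ?_
    filter_upwards [coeFn_foldField hsymm c F] with p hp
    rw [hp, Complex.real_smul, mul_comm]
  · have hz : ∀ᵐ p : Space, p 0 ≠ 0 :=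
      measure_eq_zero_iff_ae_notMem.1 volume_setOf_apply_zero_eq_zero
    refine integral_congr_ae ?_
    filter_upwards [ae_restrict_of_ae hz] with p hp0
    have h0 : reflectX p 0 = -p 0 := by simp [reflectX]
    rw [mul_comm, Complex.real_smul]
    congr 1
    rcases lt_or_gt_of_ne hp0 with h | h
    · have e1 : ψ p = 0 := hψ.eq_zero fun h' => h'.2.not_gt h
      simp [mirrorExtension, h.not_gt, e1]
    · have e2 : ψ (reflectX p) = 0 := hψ.eq_zero fun h' => by
        have := h'.2
        rw [h0] at this
        linarith
      simp [mirrorExtension, h, e2]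

/-- Folding is the adjoint of extension. This carries Green's formula from the half domain to Ω. -/
lemma inner_mirrorField (hsymm : ∀ p ∈ Ω, reflectX p ∈ Ω) (c : Fin 3 → ℝ)
    (F : L2Field (halfGuide Ω)) (Φ : L2Field Ω) :
    ⟪Φ, mirrorField hsymm c F⟫_ℂ = ⟪foldField hsymm c Φ, F⟫_ℂ := by
  have hg : ∀ i, MemLp (fun p => (starRingEnd ℂ) (Φ p i)) 2 (volume.restrict (Ω : Set Space)) :=
    fun i => (memLp_coord Φ i).star
  have h := fun i => integral_mul_mirrorExtension hsymm (c i) (hg i) (memLp_coord F i)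
  rw [L2.inner_def, L2.inner_def]
  have h1 : ∫ p in (Ω : Set Space), ⟪Φ p, mirrorField hsymm c F p⟫_ℂ =
      ∑ i, ∫ p in (Ω : Set Space), (starRingEnd ℂ) (Φ p i) *
        mirrorExtension (c i) (fun p => F p i) p := by
    rw [← integral_finsetSum _ fun i _ => memLp_one_iff_integrable.1
      ((memLp_mirrorExtension hsymm (c i) (memLp_coord F i)).mul' (hg i))]
    refine integral_congr_ae ?_
    filter_upwards [coeFn_mirrorField hsymm c F] with p hp
    rw [hp, PiLp.inner_apply]
    exact Finset.sum_congr rfl fun i _ => mul_comm _ _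
  have h2 : ∫ p in (halfGuide Ω : Set Space), ⟪foldField hsymm c Φ p, F p⟫_ℂ =
      ∑ i, ∫ p in (halfGuide Ω : Set Space),
        ((starRingEnd ℂ) (Φ p i) + c i • (starRingEnd ℂ) (Φ (reflectX p) i)) * F p i := by
    refine Eq.trans ?_ (integral_finsetSum _ fun i _ => memLp_one_iff_integrable.1
      ((memLp_coord F i).mul' (memLp_fold hsymm (c i) (hg i))))
    refine integral_congr_ae ?_
    filter_upwards [coeFn_foldField hsymm c Φ] with p hp
    rw [hp, PiLp.inner_apply]
    refine Finset.sum_congr rfl fun i _ => ?_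
    rw [RCLike.inner_apply, map_add, Complex.real_smul, Complex.real_smul, map_mul,
      Complex.conj_ofReal, mul_comm]
  rw [h1, h2]
  exact Finset.sum_congr rfl fun i _ => h i

/-- The normal derivative reverses the parity of the folded function; tangential derivatives keep
it. -/
lemma pderiv_add_smul_comp_reflectX {ψ : Space → ℝ} (hψ : ContDiff ℝ ∞ ψ) (c : ℝ) (j : Fin 3) :
    pderiv j (ψ + c • (ψ ∘ reflectX)) = pderiv j ψ + (c * mirrorSign j) • (pderiv j ψ ∘ reflectX) := by
  have hd : Differentiable ℝ ψ := hψ.differentiable (by simp)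
  have hd' : Differentiable ℝ (ψ ∘ reflectX) := hd.comp reflection.differentiable
  rw [mul_smul, ← pderiv_comp_reflectX]
  funext p
  simp only [pderiv, Pi.add_apply, Pi.smul_apply]
  rw [fderiv_add (hd p) ((hd' p).const_smul c), fderiv_const_smul (hd' p)]
  rfl

/-- Folding with opposite symmetries commutes with the curl. -/
lemma foldField_mem_weakCurlGraph (hsymm : ∀ p ∈ Ω, reflectX p ∈ Ω) {P : L2Field Ω × L2Field Ω}
    (hP : P ∈ weakCurlGraph Ω) :
    (foldField hsymm mirrorSign P.1, foldField hsymm (-mirrorSign) P.2) ∈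
      weakCurlGraph (halfGuide Ω) := by
  intro ψ hψ i
  have hψ' := hψ.mono halfGuide_le
  -- The weak curl equation on Ω is tested with the part of ψ of the matching parity; the sign
  -- relations turn its derivatives into the folded derivatives.
  have h := hP _ (hψ'.add ((hψ'.comp_reflectX hsymm).const_smul (-mirrorSign i))) i
  rw [testIntegral_foldField _ _ _ hψ, testIntegral_foldField _ _ _ (hψ.pderiv _),
    testIntegral_foldField _ _ _ (hψ.pderiv _)]
  have e1 : mirrorSign i * mirrorSign (i + 2) = -mirrorSign (i + 1) := by
    fin_cases i <;> simp [mirrorSign]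
  rw [pderiv_add_smul_comp_reflectX hψ.1, pderiv_add_smul_comp_reflectX hψ.1, neg_mul, neg_mul, e1,
    mirrorSign_mul_mirrorSign, neg_neg, neg_neg] at h
  exact h

end Reflection

/-! ### Passing weak equations across the symmetry plane -/

section Cutoff

variable {Ω : TopologicalSpace.Opens Space}

lemma tendsto_testIntegral_of_dominated (E : L2Field Ω) (i : Fin 3) {f : ℕ → Space → ℝ}
    {θ g : Space → ℝ} (hf : ∀ n, Continuous (f n)) (hg : MemLp g 2 (volume.restrict (Ω : Set Space)))
    (hfg : ∀ n, ∀ p ∈ Ω, |f n p| ≤ g p)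
    (hlim : ∀ p ∈ Ω, Tendsto (fun n => f n p) atTop (𝓝 (θ p))) :
    Tendsto (fun n => testIntegral (f n) i E) atTop (𝓝 (testIntegral θ i E)) := by
  have hm := Ω.isOpen.measurableSet
  refine tendsto_integral_of_dominated_convergence (fun p => ‖g p • E p i‖) (fun n => ?_)
    (integrable_smul_coord hg E i).norm (fun n => ?_) ?_
  · exact (hf n).aestronglyMeasurable.smul (memLp_coord E i).1
  · filter_upwards [ae_restrict_mem hm] with p hp
    rw [norm_smul, norm_smul]
    gcongr
    exact (hfg n p hp).trans (le_abs_self _)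
  · filter_upwards [ae_restrict_mem hm] with p hp
    exact (hlim p hp).smul_const _

/-- A test function on the whole domain is approximated by test functions on the half domain; the
convergence includes the tangential derivatives and, if the function vanishes on `{x = 0}`,
the normal derivative. -/
lemma exists_cutoff {θ : Space → ℝ} (hθ : IsTestFunction Ω θ) :
    ∃ ψ : ℕ → Space → ℝ, (∀ n, IsTestFunction (halfGuide Ω) (ψ n)) ∧
      (∀ i (E : L2Field (halfGuide Ω)),
        Tendsto (fun n => testIntegral (ψ n) i E) atTop (𝓝 (testIntegral θ i E))) ∧
      ∀ j, (j ≠ 0 ∨ ∀ p, p 0 = 0 → θ p = 0) → ∀ i (E : L2Field (halfGuide Ω)),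
        Tendsto (fun n => testIntegral (pderiv j (ψ n)) i E) atTop
          (𝓝 (testIntegral (pderiv j θ) i E)) := by
  set h := Real.smoothTransition with hh
  have hc : ContDiff ℝ ∞ h := Real.smoothTransition.contDiff
  have hc' : ContDiff ℝ ∞ (deriv h) := ((contDiff_infty_iff_deriv (𝕜 := ℝ)).1 hc).2
  have hd0 : ∀ x, x ∉ Set.Icc (0 : ℝ) 1 → deriv h x = 0 := by
    intro x hx
    rw [Set.mem_Icc, not_and_or, not_le, not_le] at hx
    rcases hx with hx | hx
    · have : h =ᶠ[𝓝 x] fun _ => 0 := by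
        filter_upwards [Iio_mem_nhds hx] with y hy
        exact Real.smoothTransition.zero_of_nonpos (le_of_lt hy)
      rw [this.deriv_eq, deriv_const]
    · have : h =ᶠ[𝓝 x] fun _ => 1 := by
        filter_upwards [Ioi_mem_nhds hx] with y hy
        exact Real.smoothTransition.one_of_one_le (le_of_lt hy)
      rw [this.deriv_eq, deriv_const]
  obtain ⟨M, hM⟩ := isCompact_Icc.exists_bound_of_continuousOn (s := Set.Icc (0 : ℝ) 1)
    hc'.continuous.continuousOn
  have hM0 : 0 ≤ M := (norm_nonneg _).trans (hM 0 (by simp))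
  have hab : ∀ x, |h x| ≤ 1 := fun x => by
    rw [abs_of_nonneg (Real.smoothTransition.nonneg x)]
    exact Real.smoothTransition.le_one x
  -- η n vanishes for x ≤ 1/(n + 1) and equals 1 for x ≥ 2/(n + 1), so it depends only on the normal
  -- variable and tends to 1 pointwise on the half domain.
  let η : ℕ → Space → ℝ := fun n p => h ((n + 1 : ℝ) * p 0 - 1)
  have hηc : ∀ n, ContDiff ℝ ∞ (η n) := fun n => hc.comp (by fun_prop)
  have hη1 : ∀ p ∈ halfGuide Ω, ∀ᶠ n : ℕ in atTop, 1 < (n + 1 : ℝ) * p 0 - 1 := by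
    intro p hp
    have ht : Tendsto (fun n : ℕ => ((n : ℝ) + 1) * p 0) atTop atTop :=
      (tendsto_atTop_add_const_right _ _ tendsto_natCast_atTop_atTop).atTop_mul_const hp.2
    filter_upwards [ht.eventually_gt_atTop 2] with n hn
    linarith
  have hηd : ∀ n j p, pderiv j (η n) p =
      (n + 1 : ℝ) * deriv h ((n + 1 : ℝ) * p 0 - 1) * (EuclideanSpace.single j (1 : ℝ) : Space) 0 := by
    intro n j p
    have h1 : HasFDerivAt (fun p : Space => (n + 1 : ℝ) * p 0 - 1)
        ((n + 1 : ℝ) • (EuclideanSpace.proj (0 : Fin 3) : Space →L[ℝ] ℝ)) p :=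
      ((EuclideanSpace.proj (0 : Fin 3) : Space →L[ℝ] ℝ).hasFDerivAt.const_mul _).sub_const _
    have h2 := (hc.differentiable (by simp) ((n + 1 : ℝ) * p 0 - 1)).hasDerivAt.comp_hasFDerivAt p h1
    change fderiv ℝ (h ∘ fun p : Space => (n + 1 : ℝ) * p 0 - 1) p _ = _
    rw [h2.fderiv]
    change _ * ((n + 1 : ℝ) * (EuclideanSpace.single j (1 : ℝ) : Space) 0) = _
    ring
  have hprod : ∀ n j p, pderiv j (η n * θ) p =
      η n p * pderiv j θ p + pderiv j (η n) p * θ p := by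
    intro n j p
    simp only [pderiv]
    rw [fderiv_mul ((hηc n).differentiable (by simp) p) (hθ.1.differentiable (by simp) p)]
    simp
    ring
  have htest : ∀ n, IsTestFunction (halfGuide Ω) (η n * θ) := by
    intro n
    refine ⟨(hηc n).mul hθ.1, hθ.2.1.mul_left, ?_⟩
    have hs : tsupport (η n * θ) ⊆ tsupport θ ∩ {p | 1 ≤ (n + 1 : ℝ) * p 0} := by
      refine closure_minimal (fun p hp => ⟨subset_tsupport _ (right_ne_zero_of_mul hp), ?_⟩)
        ((isClosed_tsupport _).inter (isClosed_le continuous_const (by fun_prop)))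
      by_contra hcon
      exact left_ne_zero_of_mul hp (Real.smoothTransition.zero_of_nonpos (by
        rw [Set.mem_ofPred_eq, not_le] at hcon
        linarith))
    intro p hp
    refine ⟨hθ.2.2 (hs hp).1, ?_⟩
    have h1 : 1 ≤ (n + 1 : ℝ) * p 0 := (hs hp).2
    by_contra hcon
    have : (n + 1 : ℝ) * p 0 ≤ 0 := mul_nonpos_of_nonneg_of_nonpos (by positivity) (not_lt.1 hcon)
    linarith
  have hbase : ∀ φ, IsTestFunction Ω φ → ∀ i (E : L2Field (halfGuide Ω)),
      Tendsto (fun n => testIntegral (η n * φ) i E) atTop (𝓝 (testIntegral φ i E)) := by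
    intro φ hφ i E
    refine tendsto_testIntegral_of_dominated E i (g := fun p => ‖φ p‖)
      (fun n => (hηc n).continuous.mul hφ.1.continuous) (hφ.memLp _).norm (fun n p _ => ?_) ?_
    · rw [Pi.mul_apply, abs_mul]
      exact mul_le_of_le_one_left (abs_nonneg _) (hab _)
    · intro p hp
      refine tendsto_const_nhds.congr' ?_
      filter_upwards [hη1 p hp] with n hn
      rw [Pi.mul_apply, show η n p = 1 from Real.smoothTransition.one_of_one_le hn.le, one_mul]
  refine ⟨fun n => η n * θ, htest, hbase θ hθ, fun j hj i E => ?_⟩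
  by_cases hj0 : j = 0
  · subst hj0
    have hθ0 : ∀ p : Space, p 0 = 0 → θ p = 0 := hj.resolve_left (by simp)
    -- The danger is the term (n + 1) h' θ. Where h' ≠ 0 one has x ≤ 2/(n + 1), and |θ| ≤ K x there,
    -- so it is bounded by 2 M K and dominated convergence applies.
    obtain ⟨K, hK⟩ := (hθ.1.of_le (by simp)).lipschitzWith_of_hasCompactSupport hθ.2.1
      (n := 1) (by simp)
    have hle : ∀ p : Space, |θ p| ≤ K * |p 0| := by
      intro p
      have h1 := hK.dist_le_mul p (p - EuclideanSpace.single 0 (p 0))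
      rw [hθ0 (p - EuclideanSpace.single 0 (p 0)) (by simp), Real.dist_eq, sub_zero] at h1
      simpa using h1
    set g : Space → ℝ := fun p => ‖pderiv 0 θ p‖ + (tsupport θ).indicator (fun _ => M * K * 2) p
    have hg : MemLp g 2 (volume.restrict (halfGuide Ω : Set Space)) := by
      refine ((hθ.pderiv 0).memLp _).norm.add (MemLp.restrict _ ?_)
      exact memLp_indicator_const 2 (isClosed_tsupport θ).measurableSet _
        (Or.inr hθ.2.1.measure_lt_top.ne)
    refine tendsto_testIntegral_of_dominated E i (g := g)
      (fun n => ((htest n).pderiv 0).1.continuous) hg (fun n p hp => ?_) fun p hp => ?_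
    · rw [hprod, hηd]
      simp only [PiLp.single_apply, if_true, mul_one]
      refine (abs_add_le _ _).trans (add_le_add ?_ ?_)
      · rw [abs_mul]
        exact mul_le_of_le_one_left (abs_nonneg _) (hab _)
      · by_cases hpθ : p ∈ tsupport θ
        · rw [Set.indicator_of_mem hpθ]
          by_cases hx : (n + 1 : ℝ) * p 0 - 1 ∈ Set.Icc (0 : ℝ) 1
          · have hn : (0 : ℝ) < n + 1 := by positivity
            have hp0 : 0 < p 0 := hp.2
            rw [abs_mul, abs_mul, abs_of_pos hn]
            have h1 := hle p
            rw [abs_of_pos hp0] at h1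
            calc (n + 1 : ℝ) * |deriv h ((n + 1 : ℝ) * p 0 - 1)| * |θ p|
                ≤ (n + 1 : ℝ) * M * (K * p 0) := by
                  gcongr
                  exact hM _ hx
              _ = M * K * ((n + 1 : ℝ) * p 0) := by ring
              _ ≤ M * K * 2 := by
                  gcongr
                  linarith [hx.2]
          · rw [hd0 _ hx]
            simp only [mul_zero, zero_mul, abs_zero]
            positivity
        · rw [image_eq_zero_of_notMem_tsupport hpθ, Set.indicator_of_notMem hpθ]
          simp
    · refine tendsto_const_nhds.congr' ?_
      filter_upwards [hη1 p hp] with n hn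
      rw [hprod, hηd, hd0 _ fun hx => absurd hx.2 (not_le.2 hn),
        show η n p = 1 from Real.smoothTransition.one_of_one_le hn.le]
      simp
  · have he : ∀ n, pderiv j (η n * θ) = η n * pderiv j θ := by
      intro n
      funext p
      rw [hprod, hηd]
      simp [Ne.symm hj0]
    simp only [he]
    exact hbase _ (hθ.pderiv j) i E

/-- The x-component of a curl contains only tangential derivatives, so it may be tested with any θ;
the other components need θ = 0 on {x = 0}. The fields themselves satisfy no boundary condition. -/
lemma testIntegral_curl_of_vanishing {P : L2Field (halfGuide Ω) × L2Field (halfGuide Ω)}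
    (hP : P ∈ weakCurlGraph (halfGuide Ω)) {θ : Space → ℝ} (hθ : IsTestFunction Ω θ) (i : Fin 3)
    (h : i = 0 ∨ ∀ p, p 0 = 0 → θ p = 0) :
    testIntegral θ i P.2 =
      testIntegral (pderiv (i + 2) θ) (i + 1) P.1 - testIntegral (pderiv (i + 1) θ) (i + 2) P.1 := by
  obtain ⟨ψ, hψ, h1, h2⟩ := exists_cutoff hθ
  have hj : ∀ k : Fin 3, k ≠ 0 → i + k ≠ 0 ∨ ∀ p : Space, p 0 = 0 → θ p = 0 := by
    rintro k hk
    rcases h with rfl | h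
    · exact Or.inl (by rwa [zero_add])
    · exact Or.inr h
  refine tendsto_nhds_unique (h1 i P.2) ?_
  simp only [fun n => hP (ψ n) (hψ n) i]
  exact (h2 _ (hj 2 (by decide)) _ _).sub (h2 _ (hj 1 (by decide)) _ _)

lemma testIntegral_div_of_vanishing {E : L2Field (halfGuide Ω)} (hE : E ∈ HDivZero (halfGuide Ω))
    {θ : Space → ℝ} (hθ : IsTestFunction Ω θ) (h : ∀ p, p 0 = 0 → θ p = 0) :
    ∑ i : Fin 3, testIntegral (pderiv i θ) i E = 0 := by
  obtain ⟨ψ, hψ, -, h2⟩ := exists_cutoff hθ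
  refine tendsto_nhds_unique (tendsto_finsetSum _ fun i _ => h2 i (Or.inr h) i E) ?_
  simp only [fun n => hE (ψ n) (hψ n)]
  exact tendsto_const_nhds

lemma add_smul_comp_reflectX_vanishing (ψ : Space → ℝ) (p : Space) (hp : p 0 = 0) :
    (ψ + (-1 : ℝ) • (ψ ∘ reflectX)) p = 0 := by
  have : reflectX p = p := by
    ext i
    fin_cases i <;> simp [reflectX, hp]
  simp [this]

/-- For this symmetry the folded test function is ψ - ψ∘R, with R the reflection. It vanishes on {x
= 0}, so no condition on the normal trace of E is needed. -/
lemma mirrorField_mem_HDivZero (hsymm : ∀ p ∈ Ω, reflectX p ∈ Ω) {E : L2Field (halfGuide Ω)}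
    (hE : E ∈ HDivZero (halfGuide Ω)) : mirrorField hsymm (-mirrorSign) E ∈ HDivZero Ω := by
  intro ψ hψ
  have h := testIntegral_div_of_vanishing hE
    (hψ.add ((hψ.comp_reflectX hsymm).const_smul (-1))) (add_smul_comp_reflectX_vanishing ψ)
  simp only [fun i => pderiv_add_smul_comp_reflectX hψ.1 (-1) i, neg_one_mul] at h
  simp only [fun i => testIntegral_mirrorField hsymm (-mirrorSign) E ((hψ.pderiv i).memLp _) i]
  exact h

/-- Extension with opposite symmetries commutes with the curl. -/
lemma mirrorField_mem_weakCurlGraph (hsymm : ∀ p ∈ Ω, reflectX p ∈ Ω)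
    {P : L2Field (halfGuide Ω) × L2Field (halfGuide Ω)} (hP : P ∈ weakCurlGraph (halfGuide Ω)) :
    (mirrorField hsymm mirrorSign P.1, mirrorField hsymm (-mirrorSign) P.2) ∈ weakCurlGraph Ω := by
  intro ψ hψ i
  -- For i ≠ 0 the folded test function is odd in x and vanishes on the plane; for i = 0 it is even,
  -- but only tangential derivatives occur.
  have hv : i = 0 ∨ ∀ p : Space, p 0 = 0 → (ψ + (-mirrorSign i) • (ψ ∘ reflectX)) p = 0 := by
    by_cases hi : i = 0
    · exact Or.inl hi
    · right
      have : mirrorSign i = 1 := by fin_cases i <;> simp_all [mirrorSign]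
      rw [this]
      exact add_smul_comp_reflectX_vanishing ψ
  have h := testIntegral_curl_of_vanishing hP
    (hψ.add ((hψ.comp_reflectX hsymm).const_smul (-mirrorSign i))) i hv
  have e1 : mirrorSign i * mirrorSign (i + 2) = -mirrorSign (i + 1) := by
    fin_cases i <;> simp [mirrorSign]
  rw [pderiv_add_smul_comp_reflectX hψ.1, pderiv_add_smul_comp_reflectX hψ.1, neg_mul, neg_mul, e1,
    mirrorSign_mul_mirrorSign, neg_neg, neg_neg] at h
  rw [testIntegral_mirrorField _ _ _ (hψ.memLp _), testIntegral_mirrorField _ _ _ ((hψ.pderiv _).memLp _),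
    testIntegral_mirrorField _ _ _ ((hψ.pderiv _).memLp _)]
  exact h

lemma coeFn_mirrorField_eq_reflectedExtension (hsymm : ∀ p ∈ Ω, reflectX p ∈ Ω)
    (F : L2Field (halfGuide Ω)) :
    mirrorField hsymm (-mirrorSign) F =ᵐ[volume.restrict (Ω : Set Space)] reflectedExtension F := by
  filter_upwards [coeFn_mirrorField hsymm (-mirrorSign) F] with p hp
  rw [hp]
  ext i
  by_cases h : 0 < p 0
  · simp [mirrorExtension, reflectedExtension, h]
  · fin_cases i <;> simp [mirrorExtension, reflectedExtension, h, mirrorSign]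

lemma mirrorField_smul (hsymm : ∀ p ∈ Ω, reflectX p ∈ Ω) (c : Fin 3 → ℝ) (μ : ℂ)
    (F : L2Field (halfGuide Ω)) : mirrorField hsymm c (μ • F) = μ • mirrorField hsymm c F := by
  refine ext_inner_left ℂ fun Φ => ?_
  rw [inner_mirrorField, inner_smul_right, inner_smul_right, inner_mirrorField]

lemma eq_zero_of_mirrorField_eq_zero (hsymm : ∀ p ∈ Ω, reflectX p ∈ Ω) (c : Fin 3 → ℝ)
    {F : L2Field (halfGuide Ω)} (h : mirrorField hsymm c F = 0) : F = 0 := by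
  have h1 := coeFn_mirrorField hsymm c F
  rw [h] at h1
  have h2 := ae_restrict_of_ae_restrict_of_subset (halfGuide_le (Ω := Ω))
    (h1.symm.trans (Lp.coeFn_zero CVec 2 (volume.restrict (Ω : Set Space))))
  apply Lp.ext
  filter_upwards [h2, Lp.coeFn_zero CVec 2 (volume.restrict (halfGuide Ω : Set Space)),
    ae_restrict_mem (halfGuide Ω).isOpen.measurableSet] with p hp h0 hm
  rw [h0]
  ext i
  have h3 := congrArg (fun v : CVec => v i) hp
  simp only [mirrorExtension_of_pos _ _ hm.2] at h3
  exact h3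

/-- The reflected extension of an eigenvector is an eigenvector. -/
theorem exists_reflected_eigenvector (hsymm : ∀ p ∈ Ω, reflectX p ∈ Ω) {μ : ℂ}
    (u : (electricOperator (halfGuide Ω)).domain)
    (hu : IsEigenvector (electricOperator (halfGuide Ω)) μ u) :
    ∃ E : (electricOperator Ω).domain,
      ((E : HDivZero Ω) : L2Field Ω) =ᵐ[volume.restrict (Ω : Set Space)]
        reflectedExtension ((u : HDivZero (halfGuide Ω)) : L2Field (halfGuide Ω)) ∧
      IsEigenvector (electricOperator Ω) μ E := by
  obtain ⟨C, hN, -, hC⟩ := exists_curl_of_mem_domain u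
  set F : L2Field (halfGuide Ω) := ((u : HDivZero (halfGuide Ω)) : L2Field (halfGuide Ω)) with hF
  have hdiv : mirrorField hsymm (-mirrorSign) F ∈ HDivZero Ω :=
    mirrorField_mem_HDivZero hsymm (u : HDivZero (halfGuide Ω)).2
  have hTu : (electricOperator (halfGuide Ω) u : L2Field (halfGuide Ω)) = μ • F :=
    congrArg Subtype.val hu.2
  rw [hTu] at hC
  -- This is where the boundary condition of the half domain enters: Green's formula there is
  -- applied to the folded pair, which is again a field with its weak curl.
  have hgreen : ∀ P ∈ weakCurlGraph Ω, ⟪P.2, mirrorField hsymm (-mirrorSign) F⟫_ℂ =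
      ⟪P.1, mirrorField hsymm mirrorSign C⟫_ℂ := fun P hP =>
    (inner_mirrorField hsymm _ F P.2).trans ((hN _ (foldField_mem_weakCurlGraph hsymm hP)).trans
      (inner_mirrorField hsymm _ C P.1).symm)
  -- The field C = curl E has the opposite symmetry type, for which extension commutes with curl
  -- without any boundary condition.
  have hcurl : (mirrorField hsymm mirrorSign C, mirrorField hsymm (-mirrorSign) (μ • F)) ∈
      weakCurlGraph Ω := mirrorField_mem_weakCurlGraph (P := (C, μ • F)) hsymm hC
  obtain ⟨E, hE, hTE⟩ := mem_domain_electricOperator hdiv hgreen hcurl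
  refine ⟨E, ?_, fun h0 => hu.1 ?_, ?_⟩
  · rw [hE]
    exact coeFn_mirrorField_eq_reflectedExtension hsymm F
  · refine Subtype.ext (eq_zero_of_mirrorField_eq_zero hsymm (-mirrorSign) (F := F) ?_)
    rw [← hE, h0]
    rfl
  · apply Subtype.ext
    rw [hTE, mirrorField_smul, ← hE]
    rfl

end Cutoff

/-! ### Conclusion -/

theorem IsWaveguide.essentialSpectrum_eq {Ω : TopologicalSpace.Opens Space} {S : Set Plane}
    (hΩ : IsWaveguide Ω S) (hS : ¬IsSimplyConnected S) :
    essentialSpectrum (electricOperator Ω) = (fun t : ℝ => (t : ℂ)) '' Set.Ici 0 := by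
  refine (hasNonnegForm_electricOperator Ω).essentialSpectrum_subset.antisymm ?_
  obtain ⟨V, hV, hVS, hVpos, hdiv, g, hg, hlim⟩ := exists_transverse_mode hΩ.section_isOpen
    hΩ.section_isBounded hΩ.section_lipschitz
    (hΩ.section_isOpen.isConnected_iff_isPathConnected.1 hΩ.section_isConnected) hS
  exact Ici_subset_essentialSpectrum hΩ.cylinder hV hVS hVpos hdiv hg hlim

end Maxwell

end

theorem mainTheorem12
    (Ω : TopologicalSpace.Opens Maxwell.Space) (S : Set (EuclideanSpace ℝ (Fin 2)))
    (hΩ : Maxwell.IsWaveguide Ω S)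
    (hsymm : ∀ p ∈ Ω, Maxwell.reflectX p ∈ Ω)
    (hS : ¬ IsSimplyConnected S)
    (hSplus : IsSimplyConnected (Maxwell.halfSection S)) :
    Maxwell.essentialSpectrum (Maxwell.electricOperator Ω) =
        (fun t : ℝ => (t : ℂ)) '' Set.Ici 0 ∧
      ∀ μ ∈ Maxwell.discreteSpectrum (Maxwell.electricOperator (Maxwell.halfGuide Ω)),
        μ ∈ Maxwell.embeddedSpectrum (Maxwell.electricOperator Ω) ∧
        ∀ Eplus : (Maxwell.electricOperator (Maxwell.halfGuide Ω)).domain,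
          Maxwell.IsEigenvector (Maxwell.electricOperator (Maxwell.halfGuide Ω)) μ Eplus →
          ∃ E : (Maxwell.electricOperator Ω).domain,
            ((E : Maxwell.HDivZero Ω) : Maxwell.L2Field Ω)
                =ᵐ[volume.restrict (Ω : Set Maxwell.Space)]
              Maxwell.reflectedExtension
                ((Eplus : Maxwell.HDivZero (Maxwell.halfGuide Ω)) :
                  Maxwell.L2Field (Maxwell.halfGuide Ω)) ∧
            Maxwell.IsEigenvector (Maxwell.electricOperator Ω) μ E := by

  have hess := hΩ.essentialSpectrum_eq hS
  refine ⟨hess, fun μ hμ => ⟨⟨?_, ?_⟩, fun u hu => Maxwell.exists_reflected_eigenvector hsymm u hu⟩⟩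
  · obtain ⟨u, hu⟩ := hμ.1
    obtain ⟨E, -, hE⟩ := Maxwell.exists_reflected_eigenvector hsymm u hu
    exact ⟨E, hE⟩
  -- Every eigenvalue of the half problem is nonnegative and therefore lies in the essential
  -- spectrum of the full problem.
  · rw [hess]
    exact (Maxwell.hasNonnegForm_electricOperator _).pointSpectrum_subset hμ.1
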